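/- **Setting.** Let $\Lambda=[-L,L]^D$ with open or periodic boundary conditions and graph distance, $n=|\Lambda|=(2L+1)^D$; a qubit and a finite-dimensional ancilla sit at every site, and the total ancilla dimension is at most $2^{\mathrm{poly}(n)}$. A *local Lindbladian* is a sum $\sum_{j\in\Lambda}\mathcal L_j$ of terms in Lindblad form, $\mathcal L_j$ being supported on the ball of radius $r_0$ around $j$ (qubits and ancillas) with $\|\mathcal L_j\|_{1\to1,cb}\le J$. Below, $\mathrm{poly}(s)=c\,s^\kappa$ and $g>0$ is a rate; $r_0,J,c,\kappa,g$ (and $K,\ell,D,|W|,k_0$ below) are constants independent of $n$. A state $\rho_0$ of the $n$ qubits *can be driven fast* to $\rho_1$ if, for some ancilla system as above, some local Lindbladian $\mathcal L$ and ancilla states $\omega_0,\omega_1$, $\|e^{t\mathcal L}(\rho_0\otimes\omega_0)-\rho_1\otimes\omega_1\|_1\le \mathrm{poly}(n)e^{-gt}$ for all $t\ge0$. Two states are in the *same phase* if each can be driven fast to the other. **Parameterised phase.** Let $\rho^*$ be a reference state, $W$ a finite set of auxiliary states, and $\mathcal L(x)=\sum_{j\in\Lambda}\mathcal L_j(x_j)$,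 $x_j\in[-1,1]^\ell$, i.e. $x\in[-1,1]^m$ with $m=\ell n$, where each $\mathcal L(x)$ is a local Lindbladian and $\|\mathcal L_j(y)-\mathcal L_j(y')\|_{1\to1,cb}\le K\|y-y'\|_\infty$. For every $x$ and $\omega\in W$ assume: 1. there are states $\rho_1,\omega_1$ with $\|e^{t\mathcal L(x)}(\rho^*\otimes\omega)-\rho_1\otimes\omega_1\|_1\le\mathrm{poly}(n)e^{-gt}$ for all $t\ge 0$, and $\rho_1$ is in the same phase as $\rho^*$; 2. (compatibility) there is a local Lindbladian $\mathcal L'$ such that, with $\mathcal L_S$ consisting of the terms of $\mathcal L(x)$ whose interaction ball lies in $S\subseteq\Lambda$ and of the terms of $\mathcal L'$ at all other sites, $e^{t\mathcal L_S}(\rho^*\otimes\omega)$ converges as $t\to\infty$ to a product state $\rho_\infty^S\otimes\omega_1^S$ for every $S$; and for all regions $A\subseteq R\subseteq V$ such that $A$ avoids the boundary of $R$ and $R$ avoids the boundary of $V$ (the boundary of $S$ being the set of sites of $S$ within distance $\max(r_0,1)$ of $\Lambda\setminus S$), for both initial states $\sigma=\rho_\infty^V$ and $\sigma=\rho^*$,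 and for all $t\ge0$, $$\big\|\operatorname{tr}_{A^c}\big[e^{t\mathcal L_R}(\sigma\otimes\omega)-\rho_\infty^R\otimes\omega_1^R\big]\big\|_1\le \mathrm{poly}(|R|)\,e^{-gt},$$ where $\operatorname{tr}_{A^c}$ traces out the qubits outside $A$ and all ancillas. Put $\rho(\mathcal L(x),\omega,t)=e^{t\mathcal L(x)}(\rho^*\otimes\omega)$. For $O=\sum_{i=1}^MO_i$, where $O_i$ is a Hermitian operator on the qubits of a region $S_i$ of diameter at most $k_0$, put $f_O(\mathcal L(x),\omega,t)=\operatorname{tr}[(O\otimes 1)\rho(\mathcal L(x),\omega,t)]$. **Data.** For each $\omega\in W$ take $N$ independent samples ($|W|N$ in total): $(X_k,\tau_k)$ is uniform on $[-1,1]^m\times[0,t_\epsilon]$, and each qubit of one copy of $\rho(\mathcal L(X_k),\omega,\tau_k)$ is measured in an independent uniformly random Pauli basis, giving the single-copy classical shadow $\widetilde\rho_k=\bigotimes_{j}(3|z_j\rangle\langle z_j|-1)$, where $|z_j\rangle$ is the observed Pauli eigenvector of qubit $j$. **Estimator.** For a region $B$, let $B(r)$ be the set of sites within distance $r$ of $B$,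 and let $x|_{B(r)}$ be the components $x_j$ with the radius-$r_0$ ball around $j$ meeting $B(r)$. Let $\Gamma_B$ be the set of samples $k$ for $\omega$ with $\|x|_{B(r)}-X_k|_{B(r)}\|_\infty\le\gamma$ and $|\min(t,t_\epsilon)-\tau_k|\le\gamma$. The aggregated shadow is $\widetilde\rho_B(x,\omega,t)=\frac1{|\Gamma_B|}\sum_{k\in\Gamma_B}\operatorname{tr}_{B^c}\widetilde\rho_k$ (zero if $\Gamma_B=\emptyset$), and $\tilde f_O(\mathcal L(x),\omega,t)=\sum_{i=1}^M\operatorname{tr}[O_i\,\widetilde\rho_{S_i}(x,\omega,t)]$. **Theorem.** There are constants $C_r,C_t,C_\gamma,C_N>0$ depending only on $D,\ell,|W|,k_0,r_0,J,K,g,c,\kappa$ such that the following holds for every $L$, either boundary condition, every phase as above, every $M$ and every $O$ as above, and all $\epsilon,\delta,\delta'\in(0,1)$. With $$r=\lceil C_r\log(2/\epsilon)\rceil,\qquad t_\epsilon=C_t\log(2/\epsilon),\qquad \gamma=\frac{\epsilon}{C_\gamma\log^{D+1}(2/\epsilon)},$$ and any $$N\ \ge\ C_N\,\log\!\Big(\frac{2n}{\delta'}\Big)\log\!\Big(\frac{2M}{\delta}\Big)\,2^{\,C_N\log^{D+1}(2/\epsilon)},$$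 one has, with probability at least $(1-\delta)(1-\delta')$, $$\sup_{x\in[-1,1]^m,\;t\ge0,\;\omega\in W}\big|f_O(\mathcal L(x),\omega,t)-\tilde f_O(\mathcal L(x),\omega,t)\big|\le\epsilon\sum_{i=1}^M\|O_i\|_\infty .$$ -/

import Mathlib

open MeasureTheory Filter Topology Matrix
open scoped Kronecker ENNReal Nat ComplexOrder

noncomputable section

/-! ### The lattice `[-L, L]^D` -/

/-- Open or periodic boundary conditions. -/
inductive Boundary
  | openEnds
  | periodic

/-- The sites of the box with `2 L + 1` sites in each of the `D` directions. -/
abbrev Site (D L : ℕ) := Fin D → Fin (2 * L + 1)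

/-- Distance along one coordinate axis: on a segment, or on a cycle of length `2 L + 1`. -/
def coordDist {L : ℕ} (b : Boundary) (u v : Fin (2 * L + 1)) : ℕ :=
  match b with
  | .openEnds => Nat.dist u v
  | .periodic => min (Nat.dist u v) (2 * L + 1 - Nat.dist u v)

/-- The graph distance of the lattice. -/
def siteDist {D L : ℕ} (b : Boundary) (u v : Site D L) : ℕ :=
  ∑ i, coordDist b (u i) (v i)

/-- The ball of radius `r` around the site `u`. -/
def siteBall {D L : ℕ} (b : Boundary) (u : Site D L) (r : ℕ) : Finset (Site D L) :=
  Finset.univ.filter fun v => siteDist b u v ≤ r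

/-- The enlargement `A(r)` of a region: all sites at distance at most `r` from `A`. -/
def thicken {D L : ℕ} (b : Boundary) (A : Finset (Site D L)) (r : ℕ) : Finset (Site D L) :=
  Finset.univ.filter fun v => ∃ u ∈ A, siteDist b u v ≤ r

/-- The boundary of a region `S` for interactions of range `r₀`: the sites of `S` that are within
the interaction range (and at least within distance one) of a site outside `S`. -/
def regionBoundary {D L : ℕ} (b : Boundary) (r₀ : ℕ) (S : Finset (Site D L)) :
    Finset (Site D L) :=
  S.filter fun u => ∃ v, v ∉ S ∧ siteDist b u v ≤ max r₀ 1

/-! ### States, trace norm, partial traces -/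

/-- Density matrices. -/
def IsState {ι : Type*} [Fintype ι] (ρ : Matrix ι ι ℂ) : Prop :=
  ρ.PosSemidef ∧ ρ.trace = 1

/-- The trace norm (Schatten 1-norm): the sum of the singular values. -/
def traceNorm {ι : Type*} [Fintype ι] [DecidableEq ι] (X : Matrix ι ι ℂ) : ℝ :=
  ∑ i, Real.sqrt ((Matrix.isHermitian_conjTranspose_mul_self X).eigenvalues i)

/-- The operator norm (Schatten ∞-norm). -/
def opNorm {ι : Type*} [Fintype ι] [DecidableEq ι] (X : Matrix ι ι ℂ) : ℝ :=
  ‖Matrix.toEuclideanCLM (𝕜 := ℂ) X‖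

/-- Partial trace over the second tensor factor. -/
def traceSnd {α β : Type*} [Fintype β] (X : Matrix (α × β) (α × β) ℂ) : Matrix α α ℂ :=
  Matrix.of fun σ τ => ∑ e, X (σ, e) (τ, e)

/-- Basis configurations of the primary system: one qubit per site. -/
abbrev Qubits (D L : ℕ) := Site D L → Fin 2

/-- Basis configurations of the ancillary system: a Hilbert space of dimension `a j` at site `j`. -/
abbrev Anc {D L : ℕ} (a : Site D L → ℕ) := ∀ j, Fin (a j)

/-- Operators on the primary system. -/
abbrev SysOp (D L : ℕ) := Matrix (Qubits D L) (Qubits D L) ℂ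

/-- Operators on the ancillary system. -/
abbrev AncOp {D L : ℕ} (a : Site D L → ℕ) := Matrix (Anc a) (Anc a) ℂ

/-- Operators on the primary and the ancillary system together. -/
abbrev FullOp {D L : ℕ} (a : Site D L → ℕ) := Matrix (Qubits D L × Anc a) (Qubits D L × Anc a) ℂ

/-- Operators on the qubits of a region. -/
abbrev RegionOp {D L : ℕ} (A : Finset (Site D L)) := Matrix (A → Fin 2) (A → Fin 2) ℂ

/-- The configuration that is `σ` on `A` and `η` off `A`. -/
def glue {D L : ℕ} (A : Finset (Site D L)) (σ : A → Fin 2) (η : {j // j ∉ A} → Fin 2) :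
    Qubits D L :=
  fun j => if h : j ∈ A then σ ⟨j, h⟩ else η ⟨j, h⟩

/-- The partial trace over all qubits outside `A`. -/
def reduceTo {D L : ℕ} (A : Finset (Site D L)) (X : SysOp D L) : RegionOp A :=
  Matrix.of fun σ τ => ∑ η : {j // j ∉ A} → Fin 2, X (glue A σ η) (glue A τ η)

/-- The operator `O ⊗ 1` on all qubits, for an operator `O` on the qubits of `A`. -/
def embedOp {D L : ℕ} (A : Finset (Site D L)) (O : RegionOp A) : SysOp D L :=
  Matrix.of fun σ τ => if ∀ j, j ∉ A → σ j = τ j then O (fun j => σ j) (fun j => τ j) else 0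

/-! ### Local Lindbladians -/

/-- Two configurations of system and ancilla agree at every site of a set. -/
def AgreeOn {D L : ℕ} {a : Site D L → ℕ} (S : Set (Site D L)) (σ τ : Qubits D L × Anc a) : Prop :=
  ∀ j ∈ S, σ.1 j = τ.1 j ∧ σ.2 j = τ.2 j

/-- `X` acts as `Y ⊗ 1`, with `Y` acting on the qubits and ancillas at the sites of `S`. -/
def SupportedOn {D L : ℕ} {a : Site D L → ℕ} (S : Set (Site D L)) (X : FullOp a) : Prop :=
  (∀ σ τ, ¬ AgreeOn Sᶜ σ τ → X σ τ = 0) ∧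
  ∀ σ τ σ' τ', AgreeOn Sᶜ σ τ → AgreeOn Sᶜ σ' τ' → AgreeOn S σ σ' → AgreeOn S τ τ' →
    X σ τ = X σ' τ'

/-- Superoperators. -/
abbrev SuperOp {D L : ℕ} (a : Site D L → ℕ) := Module.End ℂ (FullOp a)

/-- `T ⊗ id` on `k × k` block matrices. -/
def amplify {D L : ℕ} {a : Site D L → ℕ} (k : ℕ) (T : SuperOp a)
    (X : Matrix ((Qubits D L × Anc a) × Fin k) ((Qubits D L × Anc a) × Fin k) ℂ) :
    Matrix ((Qubits D L × Anc a) × Fin k) ((Qubits D L × Anc a) × Fin k) ℂ :=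
  Matrix.of fun σ τ => T (Matrix.of fun σ' τ' => X (σ', σ.2) (τ', τ.2)) σ.1 τ.1

/-- The completely bounded `1 → 1` norm of `T` is at most `J`. -/
def CBNormLE {D L : ℕ} {a : Site D L → ℕ} (T : SuperOp a) (J : ℝ) : Prop :=
  ∀ k X, traceNorm (amplify k T X) ≤ J * traceNorm X

/-- `T` is a Lindbladian whose Hamiltonian and Lindblad operators are supported on `S`. -/
def IsLindbladianOn {D L : ℕ} {a : Site D L → ℕ} (S : Set (Site D L)) (T : SuperOp a) : Prop :=
  ∃ (K : ℕ) (H : FullOp a) (V : Fin K → FullOp a),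
    H.IsHermitian ∧ SupportedOn S H ∧ (∀ k, SupportedOn S (V k)) ∧
    ∀ X, T X = Complex.I • (X * H - H * X) +
      ∑ k, (V k * X * (V k)ᴴ - (1 / 2 : ℂ) • ((V k)ᴴ * V k * X + X * ((V k)ᴴ * V k)))

/-- The evolution `e^{tT}`, given by the exponential series. -/
def evolve {D L : ℕ} {a : Site D L → ℕ} (T : SuperOp a) (t : ℝ) (X : FullOp a) : FullOp a :=
  ∑' k : ℕ, ((t ^ k / (k ! : ℝ) : ℝ) : ℂ) • (T ^ k) X

/-- The constants of a phase, which do not depend on the system size: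
interaction range `range`, interaction strength `strength`, Lipschitz constant `lip` of the
parameterisation, mixing rate `rate`, and the polynomial `coeff * n ^ degree`. -/
structure PhaseConstants where
  range : ℕ
  strength : ℝ
  lip : ℝ
  rate : ℝ
  coeff : ℝ
  degree : ℕ

/-- The polynomial bound `poly(n)`. -/
def PhaseConstants.poly (c : PhaseConstants) (n : ℕ) : ℝ := c.coeff * (n : ℝ) ^ c.degree

/-- The terms of a geometrically local Lindbladian `∑ j, T j`: the term `T j` is a Lindbladian
supported on the ball of radius `range` around `j`, of strength at most `strength`. -/
def IsLocalLindbladian {D L : ℕ} {a : Site D L → ℕ} (c : PhaseConstants) (b : Boundary)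
    (T : Site D L → SuperOp a) : Prop :=
  ∀ j, IsLindbladianOn (siteBall b j c.range : Set (Site D L)) (T j) ∧ CBNormLE (T j) c.strength

/-- The ancillary system is of polynomial size: its Hilbert space has dimension at least one and
at most `2 ^ poly(n)`. -/
def PolyAncilla {D L : ℕ} (c : PhaseConstants) (a : Site D L → ℕ) : Prop :=
  (∀ j, 0 < a j) ∧
    Real.logb 2 (Fintype.card (Anc a)) ≤ c.poly (Fintype.card (Site D L))

/-! ### Lindbladian phases of matter -/

/-- `‖e^{tL}(ρ₀ ⊗ ω₀) - ρ₁ ⊗ ω₁‖₁ ≤ poly(n) e^{-rate t}` for all `t ≥ 0`, where `L = ∑ j, T j`. -/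
def MixesFast {D L : ℕ} {a : Site D L → ℕ} (c : PhaseConstants) (T : Site D L → SuperOp a)
    (ρ₀ : SysOp D L) (ω₀ : AncOp a) (ρ₁ : SysOp D L) (ω₁ : AncOp a) : Prop :=
  ∀ t : ℝ, 0 ≤ t →
    traceNorm (evolve (∑ j, T j) t (ρ₀ ⊗ₖ ω₀) - ρ₁ ⊗ₖ ω₁) ≤
      c.poly (Fintype.card (Site D L)) * Real.exp (-(c.rate * t))

/-- `ρ₀` can be driven fast to `ρ₁`, with the help of some ancillary system, by a geometrically
local time-independent Lindbladian. -/
def DrivenFast {D L : ℕ} (c : PhaseConstants) (b : Boundary) (ρ₀ ρ₁ : SysOp D L) : Prop :=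
  ∃ (a : Site D L → ℕ) (T : Site D L → SuperOp a) (ω₀ ω₁ : AncOp a),
    PolyAncilla c a ∧ IsLocalLindbladian c b T ∧ IsState ω₀ ∧ IsState ω₁ ∧
      MixesFast c T ρ₀ ω₀ ρ₁ ω₁

/-- Two states belong to the same phase: each can be driven fast to the other. -/
def SamePhase {D L : ℕ} (c : PhaseConstants) (b : Boundary) (ρ₀ ρ₁ : SysOp D L) : Prop :=
  DrivenFast c b ρ₀ ρ₁ ∧ DrivenFast c b ρ₁ ρ₀

/-- The Lindbladian `L_S`: the terms of `T` supported in `S`, and the terms of `T'` elsewhere. -/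
def patched {D L : ℕ} {a : Site D L → ℕ} (c : PhaseConstants) (b : Boundary)
    (T T' : Site D L → SuperOp a) (S : Finset (Site D L)) : SuperOp a :=
  ∑ j, if siteBall b j c.range ⊆ S then T j else T' j

/-- The compatibility condition between system sizes, for the Lindbladians `L_S` that act as `T`
inside `S` and as `T'` outside, and the initial state `ρ₀ ⊗ ω₀`. The evolution under `L_S`
converges to some `ρ_S ⊗ ω_S`. For regions `A ⊆ R ⊆ W`, with `A` avoiding the boundary of `R` and
`R` avoiding the boundary of `W`, the evolution under `L_R` mixes rapidly on `A` to the steady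
state of `L_R`, at the rate of a system of size `|R|`; it does so from the steady state `ρ_W` of
the larger region, and also from the initial state `ρ₀` of the phase. -/
def IsCompatible {D L : ℕ} {a : Site D L → ℕ} (c : PhaseConstants) (b : Boundary)
    (T T' : Site D L → SuperOp a) (ρ₀ : SysOp D L) (ω₀ : AncOp a) : Prop :=
  ∃ (ρ : Finset (Site D L) → SysOp D L) (ω : Finset (Site D L) → AncOp a),
    (∀ S, IsState (ρ S) ∧ IsState (ω S) ∧
      Tendsto (fun t : ℝ => evolve (patched c b T T' S) t (ρ₀ ⊗ₖ ω₀)) atTop (𝓝 (ρ S ⊗ₖ ω S))) ∧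
    ∀ A R W : Finset (Site D L), A ⊆ R → R ⊆ W →
      Disjoint A (regionBoundary b c.range R) → Disjoint R (regionBoundary b c.range W) →
      ∀ σ : SysOp D L, σ = ρ W ∨ σ = ρ₀ → ∀ t : ℝ, 0 ≤ t →
        traceNorm (reduceTo A (traceSnd
            (evolve (patched c b T T' R) t (σ ⊗ₖ ω₀) - ρ R ⊗ₖ ω R))) ≤
          c.poly R.card * Real.exp (-(c.rate * t))

/-- Parameters: `ℓ` numbers in `[-1, 1]` for each term of the Lindbladian. -/
abbrev Param (D L ℓ : ℕ) := Site D L → Fin ℓ → Set.Icc (-1 : ℝ) 1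

/-- An efficiently parameterised Lindbladian phase satisfying the compatibility condition.
The Lindbladians are `L(x) = ∑ j, T j (x j)`, the reference state is `ρs`, and the auxiliary states
are `ω w`, `w : Fin W`. -/
structure IsLindbladianPhase {D L ℓ W : ℕ} (c : PhaseConstants) (b : Boundary)
    (a : Site D L → ℕ) (T : Site D L → (Fin ℓ → Set.Icc (-1 : ℝ) 1) → SuperOp a)
    (ρs : SysOp D L) (ω : Fin W → AncOp a) : Prop where
  ancilla : PolyAncilla c a
  reference_state : IsState ρs
  auxiliary_state : ∀ w, IsState (ω w)
  local_terms : ∀ x : Param D L ℓ, IsLocalLindbladian c b fun j => T j (x j)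
  lipschitz : ∀ j y y', CBNormLE (T j y - T j y') (c.lip * dist y y')
  /-- Each `L(x)` drives the reference state fast to a state of the same phase. -/
  phase : ∀ (x : Param D L ℓ) w, ∃ (ρ₁ : SysOp D L) (ω₁ : AncOp a), IsState ρ₁ ∧ IsState ω₁ ∧
    MixesFast c (fun j => T j (x j)) ρs (ω w) ρ₁ ω₁ ∧ SamePhase c b ρs ρ₁
  compatible : ∀ (x : Param D L ℓ) w, ∃ T' : Site D L → SuperOp a,
    IsLocalLindbladian c b T' ∧ IsCompatible c b (fun j => T j (x j)) T' ρs (ω w)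

/-- The states `ρ(L(x), ω, t) = e^{t L(x)}(ρs ⊗ ω)` of the phase. -/
def phaseState {D L ℓ : ℕ} {a : Site D L → ℕ}
    (T : Site D L → (Fin ℓ → Set.Icc (-1 : ℝ) 1) → SuperOp a)
    (ρs : SysOp D L) (ω : AncOp a) (x : Param D L ℓ) (t : ℝ) : FullOp a :=
  evolve (∑ j, T j (x j)) t (ρs ⊗ₖ ω)

/-! ### Classical shadows -/

/-- The three Pauli matrices. -/
def pauli : Fin 3 → Matrix (Fin 2) (Fin 2) ℂ :=
  ![!![0, 1; 1, 0], !![0, -Complex.I; Complex.I, 0], !![1, 0; 0, -1]]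

/-- The projector `(1 ± P) / 2` onto an eigenvector of a Pauli matrix `P`: the states
`|+⟩, |-⟩`, `|+i⟩, |-i⟩`, `|0⟩, |1⟩`. -/
def pauliProj (z : Fin 3 × Fin 2) : Matrix (Fin 2) (Fin 2) ℂ :=
  (1 / 2 : ℂ) • (1 + ((-1 : ℂ) ^ (z.2 : ℕ)) • pauli z.1)

/-- The product operator `⨂ j, A j`. -/
def productOp {D L : ℕ} (A : Site D L → Matrix (Fin 2) (Fin 2) ℂ) : SysOp D L :=
  Matrix.of fun σ τ => ∏ j, A j (σ j) (τ j)

/-- A measurement record: for each qubit the Pauli basis and the outcome. -/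
abbrev Record (D L : ℕ) := Site D L → Fin 3 × Fin 2

/-- The single-copy classical shadow `⨂ j, (3 |z_j⟩⟨z_j| - 1)`. -/
def shadow {D L : ℕ} (z : Record D L) : SysOp D L :=
  productOp fun j => (3 : ℂ) • pauliProj (z j) - 1

/-- The probability of a record when each qubit of `ρ` is measured in an independent uniformly
random Pauli basis. -/
def recordProb {D L : ℕ} (ρ : SysOp D L) (z : Record D L) : ℝ :=
  (1 / 3 : ℝ) ^ Fintype.card (Site D L) * (productOp (fun j => pauliProj (z j)) * ρ).trace.re

/-- The uniform distribution on parameters. -/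
def uniformParam (D L ℓ : ℕ) : Measure (Param D L ℓ) :=
  Measure.pi fun _ => Measure.pi fun _ =>
    (2 : ℝ≥0∞)⁻¹ • (volume : Measure ℝ).comap (Subtype.val : Set.Icc (-1 : ℝ) 1 → ℝ)

/-- The uniform distribution on times in `[0, tmax]`. -/
def uniformTime (tmax : ℝ) : Measure ℝ :=
  (ENNReal.ofReal tmax)⁻¹ • volume.restrict (Set.Icc 0 tmax)

/-- A labelled sample: parameters `x`, time `τ`, and the measurement record. -/
abbrev Sample (D L ℓ : ℕ) := Param D L ℓ × ℝ × Record D L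

/-- The law of one sample for the auxiliary state `ω`: `(x, τ)` is uniform, and the record is that
of the randomised Pauli measurement of a single copy of `ρ(L(x), ω, τ)`. -/
def sampleLaw {D L ℓ : ℕ} {a : Site D L → ℕ}
    (T : Site D L → (Fin ℓ → Set.Icc (-1 : ℝ) 1) → SuperOp a)
    (ρs : SysOp D L) (ω : AncOp a) (tmax : ℝ) : Measure (Sample D L ℓ) :=
  ((uniformParam D L ℓ).prod ((uniformTime tmax).prod Measure.count)).withDensity
    fun s => ENNReal.ofReal (recordProb (traceSnd (phaseState T ρs ω s.1 s.2.1)) s.2.2)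

/-- The law of the data: `N` independent samples for each auxiliary state. -/
def dataLaw {D L ℓ W : ℕ} {a : Site D L → ℕ}
    (T : Site D L → (Fin ℓ → Set.Icc (-1 : ℝ) 1) → SuperOp a)
    (ρs : SysOp D L) (ω : Fin W → AncOp a) (tmax : ℝ) (N : ℕ) :
    Measure (Fin W × Fin N → Sample D L ℓ) :=
  Measure.pi fun p => sampleLaw T ρs (ω p.1) tmax

/-! ### The estimator -/

/-- The sites whose interaction ball meets `S(r)`. -/
def nearbyTerms {D L : ℕ} (b : Boundary) (r₀ : ℕ) (S : Finset (Site D L)) (r : ℕ) :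
    Finset (Site D L) :=
  Finset.univ.filter fun j => ¬ Disjoint (siteBall b j r₀) (thicken b S r)

open Classical in
/-- The samples whose parameters near `S` and whose time are within `γ` of those of the query
point `(x, t)`; query times beyond `tmax` are replaced by `tmax`. -/
def closeSamples {D L ℓ N : ℕ} (b : Boundary) (r₀ r : ℕ) (γ tmax : ℝ) (S : Finset (Site D L))
    (s : Fin N → Sample D L ℓ) (x : Param D L ℓ) (t : ℝ) : Finset (Fin N) :=
  Finset.univ.filter fun k =>
    (∀ j ∈ nearbyTerms b r₀ S r, dist (x j) ((s k).1 j) ≤ γ) ∧ |min t tmax - (s k).2.1| ≤ γ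

/-- The aggregated shadow on `S`: the average of the reduced shadows of the close samples. -/
def aggregatedShadow {D L ℓ N : ℕ} (b : Boundary) (r₀ r : ℕ) (γ tmax : ℝ)
    (S : Finset (Site D L)) (s : Fin N → Sample D L ℓ) (x : Param D L ℓ) (t : ℝ) : RegionOp S :=
  ((closeSamples b r₀ r γ tmax S s x t).card : ℂ)⁻¹ •
    ∑ k ∈ closeSamples b r₀ r γ tmax S s x t, reduceTo S (shadow (s k).2.2)

/-- The estimator of `tr[O ρ(L(x), ω, t)]` for `O = ∑ i, O i`. -/
def estimator {D L ℓ N M : ℕ} (b : Boundary) (r₀ r : ℕ) (γ tmax : ℝ)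
    (S : Fin M → Finset (Site D L)) (O : ∀ i, RegionOp (S i))
    (s : Fin N → Sample D L ℓ) (x : Param D L ℓ) (t : ℝ) : ℂ :=
  ∑ i, (O i * aggregatedShadow b r₀ r γ tmax (S i) s x t).trace

/-- The expectation value `f_O = tr[O ρ(L(x), ω, t)]` for `O = ∑ i, O i`. -/
def expectation {D L ℓ M : ℕ} {a : Site D L → ℕ}
    (T : Site D L → (Fin ℓ → Set.Icc (-1 : ℝ) 1) → SuperOp a) (ρs : SysOp D L) (ω : AncOp a)
    (S : Fin M → Finset (Site D L)) (O : ∀ i, RegionOp (S i)) (x : Param D L ℓ) (t : ℝ) : ℂ :=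
  (((∑ i, embedOp (S i) (O i)) ⊗ₖ (1 : AncOp a)) * phaseState T ρs ω x t).trace

end

/-! The error of the estimator splits into three parts, each made at most `ε / 3` times the norm of
the observable: late times are replaced by a finite horizon, samples from nearby labels are used in
place of the query label, and expectation values are replaced by averages over finitely many
samples.

All dynamics is studied in the Heisenberg picture, where a Lindbladian generates a contraction
semigroup for the operator norm. The reason is `LindbladForm.isDissip`: to first order in the time
step, `1 + x L` is a completely positive map that nearly fixes the identity. Commutation of terms
with disjoint supports then gives the Lieb-Robinson bound `lieb_robinson`. Through Duhamel's formula
it yields `IsLocalLindbladian.norm_semi_sub_le`: an observable on `A` hardly notices changes of the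
generator far from `A`, and responds to nearby changes in proportion to their size. Consequently a
local expectation value is Lipschitz in the time and in the nearby parameters, up to an
exponentially small tail in `r`.

Relaxation must be independent of the system size (`exists_relaxation`). During the time interval
from `t` to `t + 1` the global evolution is compared with a patched one on a neighbourhood of `A` of
radius proportional to `t + 1`. By compatibility the patched evolution mixes with a prefactor
polynomial in `t`, which half of the mixing rate absorbs. This bounds the increment over one time
unit, and the increments sum to a geometric series.

For the statistics, a classical shadow is unbiased conditionally on its label (`sum_smul_shadow`).
Hence its error, restricted to any window of labels, has mean zero, and Hoeffding's inequality
applies. Uniformity over the continuum of queries comes from a finite grid in the nearby coordinates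
and the time only: the window of a query differs from that of its grid point only by samples in a
thin shell, whose number is controlled by the same concentration bound. This is
`IsLindbladianPhase.measure_inaccurate_le`. A union bound over regions and auxiliary states follows.

The sample size is governed by the window probability `p`, roughly a power `γ ^ (ℓ * n₁)` with `n₁`
of order `log (2 / ε) ^ D`. Since `log (1 / γ)` is of order `log (2 / ε)`, this produces the
exponent `log (2 / ε) ^ (D + 1)`. -/

/-! ### Contraction semigroups and Lieb-Robinson bounds -/

section LiebRobinson

variable {E : Type*} [NormedAddCommGroup E] [NormedSpace ℂ E]

/-- `1 + h D` is a contraction up to second order in `h`. -/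
def IsDissip (D : E →L[ℂ] E) : Prop := ∃ C : ℝ, 0 ≤ C ∧ ∀ h : ℝ, 0 ≤ h → ‖1 + h • D‖ ≤ 1 + C * h ^ 2

/-- The semigroup generated by `D`. -/
noncomputable def semi (D : E →L[ℂ] E) (t : ℝ) : E →L[ℂ] E := NormedSpace.exp (t • D)

lemma IsDissip.zero : IsDissip (0 : E →L[ℂ] E) :=
  ⟨0, le_rfl, fun h _ => by
    simp only [smul_zero, add_zero, zero_mul]
    exact ContinuousLinearMap.norm_id_le⟩

/-- Convexity: `1 + h (D₁ + D₂)` is the midpoint of `1 + 2h D₁` and `1 + 2h D₂`, so no commutation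
and no product formula is needed. -/
lemma IsDissip.add {D₁ D₂ : E →L[ℂ] E} (h₁ : IsDissip D₁) (h₂ : IsDissip D₂) :
    IsDissip (D₁ + D₂) := by
  obtain ⟨C₁, hC₁, h₁⟩ := h₁
  obtain ⟨C₂, hC₂, h₂⟩ := h₂
  refine ⟨2 * (C₁ + C₂), by positivity, fun h hh => ?_⟩
  have e : 1 + h • (D₁ + D₂) =
      (1 / 2 : ℝ) • (1 + (2 * h) • D₁) + (1 / 2 : ℝ) • (1 + (2 * h) • D₂) := by
    have : (1 : E →L[ℂ] E) = (1 / 2 : ℝ) • 1 + (1 / 2 : ℝ) • 1 := by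
      rw [← add_smul]; norm_num
    nth_rw 1 [this]
    module
  rw [e]
  refine (norm_add_le _ _).trans ?_
  rw [norm_smul, norm_smul]
  have := h₁ (2 * h) (by positivity)
  have := h₂ (2 * h) (by positivity)
  norm_num
  nlinarith

lemma IsDissip.sum {ι : Type*} (s : Finset ι) {D : ι → E →L[ℂ] E} (h : ∀ i ∈ s, IsDissip (D i)) :
    IsDissip (∑ i ∈ s, D i) := by
  classical
  induction s using Finset.induction_on with
  | empty => simpa using IsDissip.zero
  | insert i s hi ih =>
    rw [Finset.sum_insert hi]
    exact (h i (by simp)).add (ih fun j hj => h j (by simp [hj]))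

lemma semi_zero (D : E →L[ℂ] E) : semi D 0 = 1 := by simp [semi]

lemma semi_commute {D K : E →L[ℂ] E} (h : Commute D K) (t : ℝ) : Commute (semi D t) K :=
  (h.smul_left t).exp_left

variable [CompleteSpace E]

lemma hasDerivAt_semi (D : E →L[ℂ] E) (t : ℝ) : HasDerivAt (semi D) (semi D t * D) t :=
  hasDerivAt_exp_smul_const D t

/-- Cut `[0, t]` into `n + 1` short steps of length `x`. Each has norm at most `1 + 2 e x`, where
one `e` pays for the Taylor remainder of the exponential and the other for the second-order term `C
x ^ 2`. The product is at most `exp (2 e t)`, and `e` tends to zero. -/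
lemma IsDissip.norm_semi_le {D : E →L[ℂ] E} (hD : IsDissip D) {t : ℝ} (ht : 0 ≤ t) :
    ‖semi D t‖ ≤ 1 := by
  obtain ⟨C, hC, h⟩ := hD
  have key : ∀ e : ℝ, 0 < e → ‖semi D t‖ ≤ Real.exp (2 * e * t) := by
    intro e he
    have hd := (hasDerivAt_semi D 0).isLittleO
    rw [semi_zero, one_mul] at hd
    have hd' := hd.def he
    have hC' : ∀ᶠ x : ℝ in 𝓝 0, C * |x| < e := by
      have : Tendsto (fun x : ℝ => C * |x|) (𝓝 0) (𝓝 (C * |0|)) :=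
        (continuous_const.mul continuous_abs).tendsto 0
      exact this.eventually_lt_const (by simpa using he)
    have hlim : Tendsto (fun n : ℕ => t / ((n : ℝ) + 1)) atTop (𝓝 0) :=
      tendsto_const_nhds.div_atTop (tendsto_natCast_atTop_atTop.atTop_add tendsto_const_nhds)
    obtain ⟨n, hn⟩ := (hlim.eventually (hd'.and hC')).exists
    set x := t / ((n : ℝ) + 1) with hx
    have hx0 : 0 ≤ x := by positivity
    obtain ⟨h1, h2⟩ := hn
    simp only [sub_zero, Real.norm_eq_abs, abs_of_nonneg hx0] at h1 h2
    have hb : ‖semi D x‖ ≤ 1 + 2 * e * x := by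
      have e1 : semi D x = (semi D x - 1 - x • D) + (1 + x • D) := by abel
      rw [e1]
      refine (norm_add_le _ _).trans ?_
      have := h x hx0
      nlinarith
    have e2 : semi D t = semi D x ^ (n + 1) := by
      let _ : NormedAlgebra ℚ (E →L[ℂ] E) := NormedAlgebra.restrictScalars ℚ ℝ _
      unfold semi
      rw [← NormedSpace.exp_nsmul, ← Nat.cast_smul_eq_nsmul ℝ, smul_smul, hx]
      congr 2
      push_cast
      field_simp
    rw [e2]
    calc ‖semi D x ^ (n + 1)‖ ≤ ‖semi D x‖ ^ (n + 1) := norm_pow_le' _ (by omega)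
      _ ≤ (Real.exp (2 * e * x)) ^ (n + 1) := by
        gcongr
        have := Real.add_one_le_exp (2 * e * x)
        linarith
      _ = Real.exp (2 * e * t) := by
        rw [← Real.exp_nat_mul, hx]
        congr 1
        push_cast
        field_simp
  have hlim : Tendsto (fun e : ℝ => Real.exp (2 * e * t)) (𝓝[>] 0) (𝓝 (Real.exp (2 * 0 * t))) := by
    refine Tendsto.mono_left (Continuous.tendsto (by fun_prop) 0) nhdsWithin_le_nhds
  rw [mul_zero, zero_mul, Real.exp_zero] at hlim
  exact ge_of_tendsto hlim (eventually_nhdsWithin_of_forall fun e he => key e he)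

/-- Duhamel's formula with an operator `K` inserted. If `F` commutes with `K`, only `K (D - F)`
survives in the derivative; for `K = 1` it is the usual comparison of two semigroups. -/
lemma hasDerivAt_interaction (F K D : E →L[ℂ] E) (O : E) (t s : ℝ) :
    HasDerivAt (fun s => semi F (t - s) (K (semi D s O)))
      (semi F (t - s) ((K * D - F * K) (semi D s O))) s := by
  have h1 : HasDerivAt (fun s => semi F (t - s)) ((-1 : ℝ) • (semi F (t - s) * F)) s :=
    (hasDerivAt_semi F (t - s)).scomp s ((hasDerivAt_id s).const_sub t)
  have h2 : HasDerivAt (fun s => K * semi D s) (K * (semi D s * D)) s :=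
    (hasDerivAt_semi D s).const_mul K
  have h3 := h1.mul h2
  have h4 := ((ContinuousLinearMap.apply ℂ E O).restrictScalars ℝ).hasFDerivAt.comp_hasDerivAt s h3
  refine h4.congr_deriv ?_
  have hc : semi D s * D = D * semi D s := semi_commute (Commute.refl D) s
  have hc' : semi D s (D O) = D (semi D s O) := congrArg (fun f => f O) hc
  simp [hc', sub_eq_add_neg, add_comm]

variable {ι : Type*} [Fintype ι]

/-- The part `F` of the generator that commutes with `K` acts as a contraction in the interaction
picture, so `K (semi D s O)` can grow only through the remaining part `N`. -/
lemma norm_interaction_le {F K D N : E →L[ℂ] E} (hD : D = F + N) (hFK : Commute F K)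
    (hF : IsDissip F) (O : E) {B B' : ℝ → ℝ} (hB : ∀ s, HasDerivAt B (B' s) s)
    (h0 : ‖K O‖ ≤ B 0) (hb : ∀ s, 0 ≤ s → ‖K (N (semi D s O))‖ ≤ B' s) {t : ℝ} (ht : 0 ≤ t) :
    ‖K (semi D t O)‖ ≤ B t := by
  have hder := fun s => hasDerivAt_interaction F K D O t s
  have := image_norm_le_of_norm_deriv_right_le_deriv_boundary
    (f := fun s => semi F (t - s) (K (semi D s O))) (a := 0) (b := t)
    (fun s _ => (hder s).continuousAt.continuousWithinAt)
    (fun s _ => (hder s).hasDerivWithinAt) (B := B) (B' := B') ?_ hB ?_ (Set.right_mem_Icc.2 ht)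
  · simpa [semi_zero] using this
  · simp only [sub_zero, semi_zero]
    refine le_trans ?_ h0
    refine ((semi F t).le_opNorm _).trans ?_
    have := hF.norm_semi_le ht
    simpa using mul_le_mul_of_nonneg_right this (norm_nonneg (K O))
  · intro s hs
    have e : K * D - F * K = K * N := by rw [hD, mul_add, hFK.eq]; abel
    rw [e]
    refine le_trans (((semi F (t - s)).le_opNorm _).trans ?_) (hb s hs.1)
    have := hF.norm_semi_le (sub_nonneg.2 hs.2.le)
    simpa using mul_le_mul_of_nonneg_right this (norm_nonneg (K (N (semi D s O))))

/-- Lieb-Robinson bound: `adj i j` says that terms `i` and `j` may fail to commute, the weights `w`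
decay with the distance from the support of `O`. -/
theorem lieb_robinson {D K : ι → E →L[ℂ] E} {adj : ι → ι → Prop} {J κ : ℝ} {Z : ℕ} {w : ι → ℝ}
    (hJ : 0 ≤ J) (hκ : 0 ≤ κ) (hdis : ∀ i, IsDissip (D i))
    (hcomm : ∀ i j, ¬ adj i j → Commute (D i) (D j))
    (hcommK : ∀ i j, ¬ adj i j → Commute (D i) (K j))
    (hDJ : ∀ i, ‖D i‖ ≤ J) (hKJ : ∀ i, ‖K i‖ ≤ J) (hw : ∀ i, 0 < w i)
    (hadj : ∀ i j, adj i j → w i ≤ κ * w j)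
    (hZ : ∀ j, {i | adj i j}.ncard ≤ Z) (O : E) {a : ℝ} (ha : 0 ≤ a)
    (hDO : ∀ i, ‖D i O‖ ≤ a * w i) (hKO : ∀ i, ‖K i O‖ ≤ a * w i) {t : ℝ} (ht : 0 ≤ t) (j : ι) :
    ‖K j (semi (∑ i, D i) t O)‖ ≤ 2 * a * w j * Real.exp (2 * (J * Z * κ) * t) := by
  classical
  set b := J * Z * κ with hb
  have hb0 : 0 ≤ b := by positivity
  -- A Grönwall step: only the at most `Z` terms adjacent to `j` contribute to the growth, at rate
  -- `b * G`. Running the exponential at rate `2 * b` makes the integral half as large, so the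
  -- constant `G` improves to `a + G / 2`.
  have step : ∀ (T : ι → E →L[ℂ] E), (∀ i j, ¬ adj i j → Commute (D i) (T j)) →
      (∀ i, ‖T i‖ ≤ J) → (∀ i, ‖T i O‖ ≤ a * w i) → ∀ G : ℝ, 0 ≤ G →
      (∀ i s, 0 ≤ s → ‖D i (semi (∑ i, D i) s O)‖ ≤ G * w i * Real.exp (2 * b * s)) →
      ∀ j t, 0 ≤ t →
        ‖T j (semi (∑ i, D i) t O)‖ ≤ (a + G / 2) * w j * Real.exp (2 * b * t) := by
    intro T hT hTJ hTO G hG hP j t ht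
    have hsplit : ∑ i, D i = ∑ i with ¬ adj i j, D i + ∑ i with adj i j, D i := by
      rw [add_comm, Finset.sum_filter_add_sum_filter_not]
    have hcF : Commute (∑ i with ¬ adj i j, D i) (T j) :=
      Commute.sum_left _ _ _ fun i hi => hT i j (Finset.mem_filter.1 hi).2
    have h1 : ‖T j (semi (∑ i, D i) t O)‖ ≤ w j * (a + G / 2 * Real.exp (2 * b * t)) := by
      refine norm_interaction_le (B := fun s => w j * (a + G / 2 * Real.exp (2 * b * s)))
        (B' := fun s => w j * (b * G * Real.exp (2 * b * s))) hsplit hcF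
        (IsDissip.sum _ fun i _ => hdis i) O ?_ ?_ ?_ ht
      · intro s
        have := (((((hasDerivAt_id s).const_mul (2 * b)).exp).const_mul (G / 2)).const_add a).const_mul
          (w j)
        refine this.congr_deriv ?_
        simp only [id]
        ring
      · have := hTO j
        have := (hw j).le
        simp only [mul_zero, Real.exp_zero]
        nlinarith
      · intro s hs
        refine ((T j).le_opNorm _).trans ?_
        have h2 : ‖(∑ i with adj i j, D i) (semi (∑ i, D i) s O)‖ ≤
            Z * (G * (κ * w j) * Real.exp (2 * b * s)) := by
          rw [_root_.sum_apply]
          refine (norm_sum_le_of_le _ (f := fun i => (D i) (semi (∑ i, D i) s O))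
            (n := fun _ => G * (κ * w j) * Real.exp (2 * b * s)) fun i hi => ?_).trans ?_
          · refine (hP i s hs).trans ?_
            have := hadj i j (Finset.mem_filter.1 hi).2
            gcongr
          · rw [Finset.sum_const, nsmul_eq_mul]
            have hcard : ((Finset.univ.filter fun i => adj i j).card : ℝ) ≤ Z := by
              have := hZ j
              rw [Set.ncard_eq_toFinset_card', Set.toFinset_ofPred] at this
              exact_mod_cast this
            have := (hw j).le
            gcongr
        calc _ ≤ J * (Z * (G * (κ * w j) * Real.exp (2 * b * s))) := by
              gcongr
              exact hTJ j
          _ = _ := by rw [hb]; ring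
    refine h1.trans ?_
    have : 1 ≤ Real.exp (2 * b * t) := Real.one_le_exp (by positivity)
    have hwj := (hw j).le
    have : a ≤ a * Real.exp (2 * b * t) := le_mul_of_one_le_right ha this
    calc _ ≤ w j * (a * Real.exp (2 * b * t) + G / 2 * Real.exp (2 * b * t)) := by gcongr
      _ = _ := by ring
  have hcontr : ∀ s, 0 ≤ s → ‖semi (∑ i, D i) s O‖ ≤ ‖O‖ := fun s hs =>
    ((semi _ s).le_opNorm _).trans (by
      have := (IsDissip.sum Finset.univ fun i _ => hdis i).norm_semi_le hs
      simpa using mul_le_mul_of_nonneg_right this (norm_nonneg O))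
  -- An a priori bound from contractivity alone. It depends on the number of terms, but the
  -- iteration below removes it.
  obtain ⟨G₀, hG₀, hG₀'⟩ : ∃ G₀ : ℝ, 0 ≤ G₀ ∧ ∀ i, J * ‖O‖ ≤ G₀ * w i := by
    refine ⟨∑ i, J * ‖O‖ / w i, Finset.sum_nonneg fun i _ => ?_, fun i => ?_⟩
    · have := (hw i).le; positivity
    · rw [← div_le_iff₀ (hw i)]
      exact Finset.single_le_sum (f := fun i => J * ‖O‖ / w i)
        (fun i _ => by have := (hw i).le; positivity) (Finset.mem_univ i)
  -- The map `G ↦ a + G / 2` has the fixed point `2 * a` and halves the distance to it.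
  have iter : ∀ n : ℕ, ∀ i s, 0 ≤ s →
      ‖D i (semi (∑ i, D i) s O)‖ ≤ (2 * a + G₀ / 2 ^ n) * w i * Real.exp (2 * b * s) := by
    intro n
    induction n with
    | zero =>
      intro i s hs
      have h1 : ‖D i (semi (∑ i, D i) s O)‖ ≤ J * ‖O‖ :=
        ((D i).le_opNorm _).trans (mul_le_mul (hDJ i) (hcontr s hs) (norm_nonneg _) hJ)
      have h2 : 1 ≤ Real.exp (2 * b * s) := Real.one_le_exp (by positivity)
      have h3 := (hw i).le
      refine (h1.trans (hG₀' i)).trans ?_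
      rw [pow_zero, div_one]
      calc G₀ * w i ≤ (2 * a + G₀) * w i := by gcongr; linarith
        _ ≤ _ := le_mul_of_one_le_right (by positivity) h2
    | succ n ih =>
      intro i s hs
      have := step D hcomm hDJ hDO _ (by positivity) ih i s hs
      refine this.trans (le_of_eq ?_)
      rw [pow_succ]
      field_simp
      ring
  have lim : ∀ i s, 0 ≤ s →
      ‖D i (semi (∑ i, D i) s O)‖ ≤ (2 * a) * w i * Real.exp (2 * b * s) := by
    intro i s hs
    have h1 : Tendsto (fun n : ℕ => (2 * a + G₀ / 2 ^ n) * w i * Real.exp (2 * b * s)) atTop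
        (𝓝 ((2 * a + 0) * w i * Real.exp (2 * b * s))) := by
      refine ((tendsto_const_nhds.add ?_).mul_const _).mul_const _
      exact tendsto_const_nhds.div_atTop (tendsto_pow_atTop_atTop_of_one_lt one_lt_two)
    rw [add_zero] at h1
    exact ge_of_tendsto' h1 fun n => iter n i s hs
  -- One last step passes from the generator's own terms to the probes `K j`, and keeps the constant
  -- because `a + (2 * a) / 2 = 2 * a`.
  have := step K hcommK hKJ hKO (2 * a) (by positivity) lim j t ht
  refine this.trans (le_of_eq (by ring))

/-- Comparison of two semigroups. -/
lemma norm_semi_sub_le {D D' : E →L[ℂ] E} (hD' : IsDissip D') (O : E) {t C : ℝ} (ht : 0 ≤ t)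
    (h : ∀ s, 0 ≤ s → s ≤ t → ‖(D - D') (semi D s O)‖ ≤ C) :
    ‖semi D t O - semi D' t O‖ ≤ C * t := by
  have hder := fun s => hasDerivAt_interaction D' 1 D O t s
  have := norm_image_sub_le_of_norm_deriv_le_segment'
    (f := fun s => semi D' (t - s) ((1 : E →L[ℂ] E) (semi D s O))) (a := 0) (b := t) (C := C)
    (fun s _ => (hder s).hasDerivWithinAt) ?_ t (Set.right_mem_Icc.2 ht)
  · simpa [semi_zero] using this
  · intro s hs
    rw [one_mul, mul_one]
    refine (((semi D' (t - s)).le_opNorm _).trans ?_).trans (h s hs.1 hs.2.le)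
    have := hD'.norm_semi_le (sub_nonneg.2 hs.2.le)
    simpa using mul_le_mul_of_nonneg_right this (norm_nonneg ((D - D') (semi D s O)))

lemma norm_semi_time_sub_le {D : E →L[ℂ] E} (hD : IsDissip D) (O : E) {s t : ℝ} (hs : 0 ≤ s)
    (hst : s ≤ t) : ‖semi D t O - semi D s O‖ ≤ ‖D O‖ * (t - s) := by
  have hder : ∀ u, HasDerivAt (fun u => semi D u O) (semi D u (D O)) u := fun u => by
    have h4 := ((ContinuousLinearMap.apply ℂ E O).restrictScalars ℝ).hasFDerivAt.comp_hasDerivAt u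
      (hasDerivAt_semi D u)
    exact h4
  refine norm_image_sub_le_of_norm_deriv_le_segment' (f := fun u => semi D u O)
    (fun u _ => (hder u).hasDerivWithinAt) (fun u hu => ?_) t (Set.right_mem_Icc.2 hst)
  have := hD.norm_semi_le (hs.trans hu.1)
  exact ((semi D u).le_opNorm _).trans (by
    simpa using mul_le_mul_of_nonneg_right this (norm_nonneg (D O)))

end LiebRobinson

/-! ### The Heisenberg picture -/

section Heisenberg

open scoped Matrix.Norms.L2Operator

variable {ι κ : Type*} [Fintype ι] [DecidableEq ι] [Fintype κ] [DecidableEq κ]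

lemma traceNorm_nonneg (X : Matrix ι ι ℂ) : 0 ≤ traceNorm X :=
  Finset.sum_nonneg fun _ _ => Real.sqrt_nonneg _

lemma inner_toEuclideanCLM_eq (O : Matrix ι ι ℂ) (u v : EuclideanSpace ℂ ι) :
    inner ℂ u (Matrix.toEuclideanCLM (𝕜 := ℂ) O v) = (O * vecMulVec v.ofLp (star u.ofLp)).trace := by
  rw [EuclideanSpace.inner_eq_star_dotProduct, Matrix.mul_vecMulVec, Matrix.trace_vecMulVec]
  rfl

lemma trace_eq_sum_inner_toEuclideanCLM (X : Matrix ι ι ℂ)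
    (b : OrthonormalBasis ι ℂ (EuclideanSpace ℂ ι)) :
    X.trace = ∑ i, inner ℂ (b i) (Matrix.toEuclideanCLM (𝕜 := ℂ) X (b i)) := by
  have h1 : LinearMap.trace ℂ _ (Matrix.toEuclideanLin X) = X.trace := by
    rw [Matrix.toEuclideanLin_eq_toLin_orthonormal, Matrix.trace_toLin_eq]
  rw [← h1, LinearMap.trace_eq_sum_inner _ b]
  rfl

/-- Evaluated in an eigenbasis of `Xᴴ * X`, where the vectors `X (b i)` have the singular values of
`X` as their lengths. -/
lemma norm_trace_mul_le (O X : Matrix ι ι ℂ) : ‖(O * X).trace‖ ≤ ‖O‖ * traceNorm X := by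
  set hX := Matrix.isHermitian_conjTranspose_mul_self X
  set b := hX.eigenvectorBasis
  have hXb : ∀ i, ‖Matrix.toEuclideanCLM (𝕜 := ℂ) X (b i)‖ = Real.sqrt (hX.eigenvalues i) := by
    intro i
    rw [eq_comm, Real.sqrt_eq_iff_mul_self_eq
      ((Matrix.posSemidef_conjTranspose_mul_self X).eigenvalues_nonneg i) (norm_nonneg _)]
    have h1 : Matrix.toEuclideanCLM (𝕜 := ℂ) (Xᴴ * X) (b i) = (hX.eigenvalues i : ℂ) • b i := by
      apply (WithLp.ofLp_injective 2)
      rw [Matrix.ofLp_toEuclideanCLM, hX.mulVec_eigenvectorBasis]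
      rfl
    have h2 : inner ℂ (b i) (Matrix.toEuclideanCLM (𝕜 := ℂ) (Xᴴ * X) (b i)) =
        ((‖Matrix.toEuclideanCLM (𝕜 := ℂ) X (b i)‖ ^ 2 : ℝ) : ℂ) := by
      rw [← Matrix.star_eq_conjTranspose, map_mul, map_star, mul_apply_eq_comp,
        ContinuousLinearMap.star_eq_adjoint, ContinuousLinearMap.adjoint_inner_right,
        inner_self_eq_norm_sq_to_K]
      norm_cast
    rw [h1, inner_smul_right, inner_self_eq_norm_sq_to_K, b.norm_eq_one] at h2
    have h3 : ((hX.eigenvalues i : ℝ) : ℂ) =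
      ((‖Matrix.toEuclideanCLM (𝕜 := ℂ) X (b i)‖ ^ 2 : ℝ) : ℂ) := by simpa using h2
    rw [← sq]
    exact_mod_cast h3
  rw [trace_eq_sum_inner_toEuclideanCLM _ b, traceNorm, Finset.mul_sum]
  refine norm_sum_le_of_le _ fun i _ => ?_
  refine (norm_inner_le_norm _ _).trans ?_
  rw [b.norm_eq_one, one_mul, map_mul, mul_apply_eq_comp, ← hXb]
  exact ContinuousLinearMap.le_opNorm _ _

/-- The matrix has rank at most one, so at most one singular value is nonzero, and its square is the
trace of `Xᴴ * X`. -/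
lemma traceNorm_vecMulVec_le (u v : EuclideanSpace ℂ ι) :
    traceNorm (vecMulVec u.ofLp (star v.ofLp)) ≤ ‖u‖ * ‖v‖ := by
  set X := vecMulVec u.ofLp (star v.ofLp) with hXdef
  set hX := Matrix.isHermitian_conjTranspose_mul_self X
  have hnn := (Matrix.posSemidef_conjTranspose_mul_self X).eigenvalues_nonneg
  have hrank : Fintype.card {i // hX.eigenvalues i ≠ 0} ≤ 1 := by
    rw [← hX.rank_eq_card_non_zero_eigs, Matrix.rank_conjTranspose_mul_self]
    exact Matrix.rank_vecMulVec_le _ _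
  have htr : ∑ i, hX.eigenvalues i = (‖u‖ * ‖v‖) ^ 2 := by
    have h1 := hX.trace_eq_sum_eigenvalues
    have h2 : (Xᴴ * X).trace = (((‖u‖ * ‖v‖) ^ 2 : ℝ) : ℂ) := by
      rw [hXdef, Matrix.conjTranspose_vecMulVec, star_star, Matrix.vecMulVec_mul_vecMulVec,
        Matrix.vecMulVec_smul, Matrix.trace_smul, Matrix.trace_vecMulVec, dotProduct_comm (star u.ofLp),
        ← EuclideanSpace.inner_eq_star_dotProduct, ← EuclideanSpace.inner_eq_star_dotProduct,
        inner_self_eq_norm_sq_to_K, inner_self_eq_norm_sq_to_K]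
      push_cast
      simp [mul_pow]
    rw [h2] at h1
    exact Complex.ofReal_injective (by simpa using h1.symm)
  by_cases h0 : ∀ i, hX.eigenvalues i = 0
  · have : traceNorm X = 0 := Finset.sum_eq_zero fun i _ => by
      have := h0 i
      rw [this, Real.sqrt_zero]
    rw [this]; positivity
  · push Not at h0
    obtain ⟨i, hi⟩ := h0
    have hone : ∀ j, j ≠ i → hX.eigenvalues j = 0 := by
      intro j hj
      by_contra hne
      have := Fintype.card_le_one_iff.1 hrank ⟨i, hi⟩ ⟨j, hne⟩
      exact hj (congrArg Subtype.val this).symm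
    have e1 : traceNorm X = Real.sqrt (hX.eigenvalues i) :=
      Finset.sum_eq_single i (fun j _ hj => by rw [hone j hj, Real.sqrt_zero]) (by simp)
    rw [Finset.sum_eq_single i (fun j _ hj => hone j hj) (by simp)] at htr
    rw [e1, htr, Real.sqrt_sq (by positivity)]

/-- Rank-one operators suffice to detect the operator norm: test with `u` and `B u`. -/
lemma norm_le_of_norm_trace_le {B : Matrix ι ι ℂ} {C : ℝ} (hC : 0 ≤ C)
    (h : ∀ u v : EuclideanSpace ℂ ι, ‖(B * vecMulVec u.ofLp (star v.ofLp)).trace‖ ≤ C * (‖u‖ * ‖v‖)) :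
    ‖B‖ ≤ C := by
  refine ContinuousLinearMap.opNorm_le_bound _ hC fun u => ?_
  have h1 := h u (Matrix.toEuclideanCLM (𝕜 := ℂ) B u)
  rw [← inner_toEuclideanCLM_eq, inner_self_eq_norm_sq_to_K, norm_pow] at h1
  simp only [Complex.coe_algebraMap, Complex.norm_real, norm_norm] at h1
  by_cases h0 : ‖Matrix.toEuclideanCLM (𝕜 := ℂ) B u‖ = 0
  · exact h0.le.trans (by positivity)
  · have : 0 < ‖Matrix.toEuclideanCLM (𝕜 := ℂ) B u‖ := lt_of_le_of_ne (norm_nonneg _) (Ne.symm h0)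
    refine le_of_mul_le_mul_right ?_ this
    change ‖Matrix.toEuclideanCLM (𝕜 := ℂ) B u‖ * _ ≤ _
    nlinarith

/-- In an eigenbasis of `ρ` the trace is an average of diagonal elements of `B`, with the
eigenvalues as weights. In the Heisenberg picture this is applied to the initial state only. -/
lemma norm_trace_mul_state_le {ρ : Matrix ι ι ℂ} (hρ : IsState ρ) (B : Matrix ι ι ℂ) :
    ‖(B * ρ).trace‖ ≤ ‖B‖ := by
  obtain ⟨hps, htr⟩ := hρ
  set b := hps.isHermitian.eigenvectorBasis
  rw [trace_eq_sum_inner_toEuclideanCLM _ b]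
  have hone : ∑ i, hps.isHermitian.eigenvalues i = 1 := by
    have := hps.isHermitian.trace_eq_sum_eigenvalues
    rw [htr] at this
    exact Complex.ofReal_injective (by simpa using this.symm)
  calc _ ≤ ∑ i, ‖B‖ * hps.isHermitian.eigenvalues i := by
        refine norm_sum_le_of_le _ fun i _ => ?_
        have h1 : Matrix.toEuclideanCLM (𝕜 := ℂ) ρ (b i) =
            (hps.isHermitian.eigenvalues i : ℂ) • b i := by
          apply (WithLp.ofLp_injective 2)
          rw [Matrix.ofLp_toEuclideanCLM, hps.isHermitian.mulVec_eigenvectorBasis]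
          rfl
        rw [map_mul, mul_apply_eq_comp, h1, map_smul, inner_smul_right, norm_mul,
          Complex.norm_real, Real.norm_of_nonneg (hps.eigenvalues_nonneg i), mul_comm]
        refine mul_le_mul_of_nonneg_right ?_ (hps.eigenvalues_nonneg i)
        refine (norm_inner_le_norm _ _).trans ?_
        rw [b.norm_eq_one, one_mul]
        refine (ContinuousLinearMap.le_opNorm _ _).trans ?_
        rw [b.norm_eq_one, mul_one]
        rfl
    _ = ‖B‖ := by rw [← Finset.mul_sum, hone, mul_one]

/-- The ordered eigenvalues of the definition are awkward under a change of index type; the roots of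
the characteristic polynomial are manifestly invariant under reindexing. -/
lemma traceNorm_eq_sum_roots (Y : Matrix ι ι ℂ) :
    traceNorm Y = (((Yᴴ * Y).charpoly.roots).map fun z : ℂ => Real.sqrt z.re).sum := by
  rw [(Matrix.isHermitian_conjTranspose_mul_self Y).roots_charpoly_eq_eigenvalues,
    Multiset.map_map]
  rfl

lemma traceNorm_submatrix (e : κ ≃ ι) (X : Matrix ι ι ℂ) :
    traceNorm (X.submatrix e e) = traceNorm X := by
  rw [traceNorm_eq_sum_roots, traceNorm_eq_sum_roots, Matrix.conjTranspose_submatrix,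
    Matrix.submatrix_mul_equiv]
  have := Matrix.charpoly_reindex e.symm (Xᴴ * X)
  rw [Matrix.reindex_apply, Equiv.symm_symm] at this
  rw [this]

/-- The adjoint of a superoperator with respect to the trace pairing. -/
noncomputable def heis : Module.End ℂ (Matrix ι ι ℂ) →ₗ[ℂ] Module.End ℂ (Matrix ι ι ℂ) where
  toFun T :=
    { toFun := fun B => Matrix.of fun τ σ => (B * T (Matrix.single σ τ 1)).trace
      map_add' := fun B C => by ext; simp [add_mul]
      map_smul' := fun c B => by ext; simp }
  map_add' T T' := by ext; simp [mul_add]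
  map_smul' c T := by ext; simp

lemma trace_heis_mul (T : Module.End ℂ (Matrix ι ι ℂ)) (B X : Matrix ι ι ℂ) :
    (heis T B * X).trace = (B * T X).trace := by
  conv_rhs => rw [Matrix.matrix_eq_sum_single X]
  have : ∀ i j, T (Matrix.single i j (X i j)) = X i j • T (Matrix.single i j 1) := by
    intro i j
    rw [← map_smul, Matrix.smul_single, smul_eq_mul, mul_one]
  simp only [map_sum, this, Finset.mul_sum, Matrix.trace_sum, Matrix.mul_smul, Matrix.trace_smul]
  rw [Finset.sum_comm]
  simp [Matrix.trace, Matrix.mul_apply, heis, mul_comm]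

lemma heis_eq_of_trace {T T' : Module.End ℂ (Matrix ι ι ℂ)}
    (h : ∀ B X, (T' B * X).trace = (B * T X).trace) : heis T = T' := by
  ext1 B
  rw [Matrix.ext_iff_trace_mul_right]
  intro X
  rw [trace_heis_mul, h]

/-- `heis T` as a bounded operator. -/
noncomputable def heisL (T : Module.End ℂ (Matrix ι ι ℂ)) : Matrix ι ι ℂ →L[ℂ] Matrix ι ι ℂ :=
  LinearMap.toContinuousLinearMap (heis T)

lemma heisL_apply (T : Module.End ℂ (Matrix ι ι ℂ)) (B : Matrix ι ι ℂ) : heisL T B = heis T B := rfl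

lemma heisL_sub (T T' : Module.End ℂ (Matrix ι ι ℂ)) : heisL (T - T') = heisL T - heisL T' := by
  simp [heisL]

lemma heisL_sum {α : Type*} (s : Finset α) (T : α → Module.End ℂ (Matrix ι ι ℂ)) :
    heisL (∑ i ∈ s, T i) = ∑ i ∈ s, heisL (T i) := by
  simp [heisL]

/-- Duality between trace norm and operator norm. Rank-one test operators are enough. -/
lemma norm_heisL_le {T : Module.End ℂ (Matrix ι ι ℂ)} {J : ℝ} (hJ : 0 ≤ J)
    (h : ∀ X, traceNorm (T X) ≤ J * traceNorm X) : ‖heisL T‖ ≤ J := by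
  refine ContinuousLinearMap.opNorm_le_bound _ hJ fun B => ?_
  refine norm_le_of_norm_trace_le (by positivity) fun u v => ?_
  rw [heisL_apply, trace_heis_mul]
  refine (norm_trace_mul_le _ _).trans ?_
  have h1 := h (vecMulVec u.ofLp (star v.ofLp))
  have h2 := traceNorm_vecMulVec_le u v
  calc _ ≤ ‖B‖ * (J * (‖u‖ * ‖v‖)) := by gcongr; exact h1.trans (by gcongr)
    _ = _ := by ring

/-- A completely positive map is bounded by its value at the identity. Matrix elements between `u`
and `v` are estimated by Cauchy-Schwarz over the index `k`, using that `∑ k, ‖A k u‖ ^ 2` is the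
quadratic form of that value. -/
lemma norm_sum_conj_le {α : Type*} [Fintype α] {A : α → Matrix ι ι ℂ} (O : Matrix ι ι ℂ) :
    ‖∑ k, (A k)ᴴ * O * A k‖ ≤ ‖O‖ * ‖∑ k, (A k)ᴴ * A k‖ := by
  set f := Matrix.toEuclideanCLM (n := ι) (𝕜 := ℂ)
  set c := ‖∑ k, (A k)ᴴ * A k‖
  have hsq : ∀ u, ∑ k, ‖f (A k) u‖ ^ 2 ≤ c * ‖u‖ ^ 2 := by
    intro u
    have h1 : inner ℂ u (f (∑ k, (A k)ᴴ * A k) u) = ((∑ k, ‖f (A k) u‖ ^ 2 : ℝ) : ℂ) := by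
      rw [map_sum, _root_.sum_apply, inner_sum]
      push_cast
      refine Finset.sum_congr rfl fun k _ => ?_
      rw [← Matrix.star_eq_conjTranspose, map_mul, map_star, mul_apply_eq_comp,
        ContinuousLinearMap.star_eq_adjoint, ContinuousLinearMap.adjoint_inner_right,
        inner_self_eq_norm_sq_to_K]
      rfl
    have h2 := norm_inner_le_norm (𝕜 := ℂ) u (f (∑ k, (A k)ᴴ * A k) u)
    rw [h1, Complex.norm_real, Real.norm_of_nonneg (by positivity)] at h2
    have h3 := (f (∑ k, (A k)ᴴ * A k)).le_opNorm u
    calc _ ≤ ‖u‖ * (c * ‖u‖) := h2.trans (by gcongr; exact h3)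
      _ = _ := by ring
  refine norm_le_of_norm_trace_le (by positivity) fun v u => ?_
  rw [← inner_toEuclideanCLM_eq]
  change ‖inner ℂ u (f (∑ k, (A k)ᴴ * O * A k) v)‖ ≤ _
  rw [map_sum, _root_.sum_apply, inner_sum]
  calc _ ≤ ∑ k, ‖O‖ * (‖f (A k) u‖ * ‖f (A k) v‖) := by
        refine norm_sum_le_of_le _ fun k _ => ?_
        rw [← Matrix.star_eq_conjTranspose, map_mul, map_mul, map_star,
          mul_apply_eq_comp, mul_apply_eq_comp,
          ContinuousLinearMap.star_eq_adjoint, ContinuousLinearMap.adjoint_inner_right]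
        refine (norm_inner_le_norm _ _).trans ?_
        have := (f O).le_opNorm (f (A k) v)
        calc _ ≤ ‖f (A k) u‖ * (‖O‖ * ‖f (A k) v‖) := by gcongr; exact this
          _ = _ := by ring
    _ = ‖O‖ * ∑ k, (‖f (A k) u‖ * ‖f (A k) v‖) := by rw [Finset.mul_sum]
    _ ≤ ‖O‖ * (c * (‖u‖ * ‖v‖)) := by
        gcongr
        have hc : 0 ≤ c := norm_nonneg _
        refine (Real.sum_mul_le_sqrt_mul_sqrt _ _ _).trans ?_
        calc _ ≤ Real.sqrt (c * ‖u‖ ^ 2) * Real.sqrt (c * ‖v‖ ^ 2) := by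
              gcongr
              · exact hsq u
              · exact hsq v
          _ = c * (‖u‖ * ‖v‖) := by
              rw [Real.sqrt_mul hc, Real.sqrt_mul hc, Real.sqrt_sq (norm_nonneg _),
                Real.sqrt_sq (norm_nonneg _)]
              linear_combination (‖u‖ * ‖v‖) * Real.mul_self_sqrt hc
    _ = _ := by ring

/-- `T` is of Lindblad form with the given Hamiltonian and jump operators. -/
def LindbladForm {K : ℕ} (T : Module.End ℂ (Matrix ι ι ℂ)) (H : Matrix ι ι ℂ)
    (V : Fin K → Matrix ι ι ℂ) : Prop :=
  H.IsHermitian ∧ ∀ X, T X = Complex.I • (X * H - H * X) +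
      ∑ k, (V k * X * (V k)ᴴ - (1 / 2 : ℂ) • ((V k)ᴴ * V k * X + X * ((V k)ᴴ * V k)))

section LindbladForm

variable {K : ℕ} {T : Module.End ℂ (Matrix ι ι ℂ)} {H : Matrix ι ι ℂ} {V : Fin K → Matrix ι ι ℂ}

/-- The Heisenberg picture of a Lindbladian. -/
lemma LindbladForm.heis_eq (h : LindbladForm T H V) :
    heis T = Complex.I • (LinearMap.mulLeft ℂ H - LinearMap.mulRight ℂ H) +
      ∑ k, (LinearMap.mulLeft ℂ (V k)ᴴ * LinearMap.mulRight ℂ (V k) -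
        (1 / 2 : ℂ) • (LinearMap.mulLeft ℂ (V k)ᴴ * LinearMap.mulLeft ℂ (V k) +
          LinearMap.mulRight ℂ (V k) * LinearMap.mulRight ℂ (V k)ᴴ)) := by
  refine heis_eq_of_trace fun B X => ?_
  rw [h.2 X]
  simp only [LinearMap.add_apply, LinearMap.smul_apply, LinearMap.sub_apply,
    LinearMap.mulLeft_apply, LinearMap.mulRight_apply, LinearMap.sum_apply, Module.End.mul_apply,
    add_mul, mul_add, Matrix.trace_add, Matrix.smul_mul, Matrix.mul_smul, Matrix.trace_smul,
    sub_mul, mul_sub, Matrix.trace_sub, Finset.sum_mul, Finset.mul_sum, Matrix.trace_sum]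
  congr 1
  · rw [Matrix.mul_assoc H B X, Matrix.trace_mul_comm H (B * X)]
    simp only [Matrix.mul_assoc]
  · refine Finset.sum_congr rfl fun k _ => ?_
    have e1 : ((V k)ᴴ * (B * V k) * X).trace = (B * (V k * X * (V k)ᴴ)).trace := by
      rw [Matrix.mul_assoc (V k)ᴴ, Matrix.trace_mul_comm]
      simp only [Matrix.mul_assoc]
    have e2 : ((V k)ᴴ * (V k * B) * X).trace = (B * (X * ((V k)ᴴ * V k))).trace := by
      rw [← Matrix.mul_assoc (V k)ᴴ, Matrix.mul_assoc _ B X, Matrix.trace_mul_comm]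
      simp only [Matrix.mul_assoc]
    rw [e1, e2]
    simp only [Matrix.mul_assoc]
    ring

lemma LindbladForm.heis_apply (h : LindbladForm T H V) (O : Matrix ι ι ℂ) :
    heis T O = Complex.I • (H * O - O * H) +
      ∑ k, ((V k)ᴴ * O * V k - (1 / 2 : ℂ) • ((V k)ᴴ * V k * O + O * ((V k)ᴴ * V k))) := by
  rw [h.heis_eq]
  simp [Module.End.mul_apply, Matrix.mul_assoc]

lemma LindbladForm.heis_eq_zero (h : LindbladForm T H V) {O : Matrix ι ι ℂ} (hH : Commute H O)
    (hV : ∀ k, Commute (V k) O) (hV' : ∀ k, Commute (V k)ᴴ O) : heis T O = 0 := by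
  rw [h.heis_apply, hH.eq, sub_self, smul_zero, zero_add]
  refine Finset.sum_eq_zero fun k _ => ?_
  have e : (V k)ᴴ * V k * O = (V k)ᴴ * O * V k := by rw [mul_assoc, (hV k).eq, mul_assoc]
  have e' : O * ((V k)ᴴ * V k) = (V k)ᴴ * O * V k := by rw [← mul_assoc, ← (hV' k).eq]
  rw [e, e', ← two_smul ℂ, smul_smul]
  norm_num

/-- The generator is a polynomial in the left and right multiplications by `H`, `V k` and `(V k)ᴴ`,
so it inherits whatever commutes with all of these. -/
lemma LindbladForm.commute_heis (h : LindbladForm T H V) {F : Module.End ℂ (Matrix ι ι ℂ)}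
    (hH : Commute F (LinearMap.mulLeft ℂ H) ∧ Commute F (LinearMap.mulRight ℂ H))
    (hV : ∀ k, Commute F (LinearMap.mulLeft ℂ (V k)) ∧ Commute F (LinearMap.mulRight ℂ (V k)))
    (hV' : ∀ k, Commute F (LinearMap.mulLeft ℂ (V k)ᴴ) ∧ Commute F (LinearMap.mulRight ℂ (V k)ᴴ)) :
    Commute F (heis T) := by
  rw [h.heis_eq]
  refine ((hH.1.sub_right hH.2).smul_right _).add_right (Commute.sum_right _ _ _ fun k _ => ?_)
  exact ((hV' k).1.mul_right (hV k).2).sub_right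
    ((((hV' k).1.mul_right (hV k).1).add_right ((hV k).2.mul_right (hV' k).2)).smul_right _)

lemma LindbladForm.commute_of_commute (h : LindbladForm T H V) {X : Matrix ι ι ℂ} (hH : Commute X H)
    (hV : ∀ k, Commute X (V k)) (hV' : ∀ k, Commute X (V k)ᴴ) :
    Commute (heis T) (LinearMap.mulLeft ℂ X) ∧ Commute (heis T) (LinearMap.mulRight ℂ X) := by
  have hl : ∀ {Y : Matrix ι ι ℂ}, Commute X Y →
      Commute (LinearMap.mulLeft ℂ X) (LinearMap.mulLeft ℂ Y) := fun hXY => by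
    rw [commute_iff_eq, Module.End.mul_eq_comp, Module.End.mul_eq_comp, ← LinearMap.mulLeft_mul,
      ← LinearMap.mulLeft_mul, hXY.eq]
  have hr : ∀ {Y : Matrix ι ι ℂ}, Commute X Y →
      Commute (LinearMap.mulRight ℂ X) (LinearMap.mulRight ℂ Y) := fun hXY => by
    rw [commute_iff_eq, Module.End.mul_eq_comp, Module.End.mul_eq_comp, ← LinearMap.mulRight_mul,
      ← LinearMap.mulRight_mul, hXY.eq]
  have hlr : ∀ Y Z : Matrix ι ι ℂ, Commute (LinearMap.mulLeft ℂ Y) (LinearMap.mulRight ℂ Z) :=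
    fun Y Z => LinearMap.commute_mulLeft_right Y Z
  exact ⟨(h.commute_heis ⟨hl hH, hlr _ _⟩ (fun k => ⟨hl (hV k), hlr _ _⟩)
      fun k => ⟨hl (hV' k), hlr _ _⟩).symm,
    (h.commute_heis ⟨(hlr _ _).symm, hr hH⟩ (fun k => ⟨(hlr _ _).symm, hr (hV k)⟩)
      fun k => ⟨(hlr _ _).symm, hr (hV' k)⟩).symm⟩

/-- With the effective Hamiltonian `G`, the map with Kraus operators `1 + x G` and `√x V k` equals
`1 + x L` up to the term `x ^ 2 Gᴴ O G`. As `L` kills the identity, the value at `1` is `1 + x ^ 2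
Gᴴ G`, so `norm_sum_conj_le` applies. The constant `2 * ‖G‖ ^ 2` counts that excess once and the
discarded second-order term once. -/
lemma LindbladForm.isDissip (h : LindbladForm T H V) : IsDissip (heisL T) := by
  set S := ∑ k, (V k)ᴴ * V k with hS
  set G := -(Complex.I • H) - (1 / 2 : ℂ) • S with hG
  have hSh : Sᴴ = S := by simp [hS, Matrix.conjTranspose_sum]
  have hGh : Gᴴ = Complex.I • H - (1 / 2 : ℂ) • S := by
    simp [hG, hSh, h.1.eq]
  have hT : ∀ O, heis T O = Gᴴ * O + O * G + ∑ k, (V k)ᴴ * O * V k := by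
    intro O
    rw [h.heis_apply, Finset.sum_sub_distrib, ← Finset.smul_sum, Finset.sum_add_distrib,
      ← Finset.sum_mul, ← Finset.mul_sum, ← hS, hGh, hG]
    simp only [sub_mul, mul_sub, Matrix.smul_mul, Matrix.mul_smul, mul_neg]
    module
  refine ⟨2 * ‖G‖ ^ 2, by positivity, fun x hx => ?_⟩
  let A : Option (Fin K) → Matrix ι ι ℂ := fun o => o.elim (1 + (x : ℂ) • G)
    fun k => ((Real.sqrt x : ℝ) : ℂ) • V k
  have hsx : ((Real.sqrt x : ℝ) : ℂ) * ((Real.sqrt x : ℝ) : ℂ) = (x : ℂ) := by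
    rw [← Complex.ofReal_mul, Real.mul_self_sqrt hx]
  have hA : ∀ O, ∑ o, (A o)ᴴ * O * A o = O + (x : ℂ) • heis T O + ((x : ℂ) ^ 2) • (Gᴴ * O * G) := by
    intro O
    rw [Fintype.sum_option]
    simp only [A, Option.elim, hT, Matrix.conjTranspose_add, Matrix.conjTranspose_one,
      Matrix.conjTranspose_smul, Matrix.smul_mul, Matrix.mul_smul, smul_smul, add_mul, mul_add,
      one_mul, mul_one, Finset.smul_sum, smul_add]
    simp only [RCLike.star_def, Complex.conj_ofReal, hsx]
    rw [sq]
    abel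
  have h1 : ‖∑ o, (A o)ᴴ * A o‖ ≤ 1 + x ^ 2 * ‖G‖ ^ 2 := by
    have h2 := hA 1
    have h3 : heis T 1 = 0 := h.heis_eq_zero (Commute.one_right _) (fun k => Commute.one_right _)
      fun k => Commute.one_right _
    simp only [mul_one, h3, smul_zero, add_zero] at h2
    rw [h2]
    refine (norm_add_le _ _).trans (add_le_add ?_ ?_)
    · rcases isEmpty_or_nonempty ι with hι | hι
      · rw [show (1 : Matrix ι ι ℂ) = 0 from Subsingleton.elim _ _, norm_zero]; norm_num
      · rw [norm_one]
    · rw [norm_smul, norm_pow, Complex.norm_real, Real.norm_of_nonneg hx,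
        Matrix.l2_opNorm_conjTranspose_mul_self, sq ‖G‖]
  refine ContinuousLinearMap.opNorm_le_bound _ (by positivity) fun O => ?_
  have e : (1 + x • heisL T) O = ∑ o, (A o)ᴴ * O * A o - ((x : ℂ) ^ 2) • (Gᴴ * O * G) := by
    rw [hA]
    simp only [_root_.add_apply, _root_.smul_apply,
      one_apply_eq_self, heisL_apply, add_sub_cancel_right]
    rfl
  rw [e]
  refine (norm_sub_le _ _).trans ?_
  have h4 := norm_sum_conj_le (A := A) O
  have h5 : ‖((x : ℂ) ^ 2) • (Gᴴ * O * G)‖ ≤ x ^ 2 * (‖G‖ * ‖O‖ * ‖G‖) := by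
    rw [norm_smul, norm_pow, Complex.norm_real, Real.norm_of_nonneg hx]
    gcongr
    refine (norm_mul_le _ _).trans ?_
    gcongr
    refine (norm_mul_le _ _).trans ?_
    rw [Matrix.l2_opNorm_conjTranspose]
  have h6 : ‖O‖ * ‖∑ o, (A o)ᴴ * A o‖ ≤ ‖O‖ * (1 + x ^ 2 * ‖G‖ ^ 2) := by gcongr
  nlinarith

lemma LindbladForm.conjTranspose_apply (h : LindbladForm T H V) (X : Matrix ι ι ℂ) :
    (T X)ᴴ = T Xᴴ := by
  rw [h.2, h.2, Matrix.conjTranspose_add, Matrix.conjTranspose_sum]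
  congr 1
  · simp [h.1.eq]
    module
  · refine Finset.sum_congr rfl fun k _ => ?_
    simp [Matrix.mul_assoc, add_comm]

end LindbladForm

end Heisenberg

/-! ### Locality of Lindbladian terms -/

section Locality

open scoped Matrix.Norms.L2Operator

variable {D L : ℕ} {a : Site D L → ℕ}

open Classical in
/-- The configuration that is `τ` on `S` and `σ` elsewhere. -/
noncomputable def mixConfig (S : Set (Site D L)) (τ σ : Qubits D L × Anc a) : Qubits D L × Anc a :=
  (fun j => if j ∈ S then τ.1 j else σ.1 j, fun j => if j ∈ S then τ.2 j else σ.2 j)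

lemma agreeOn_mixConfig (S : Set (Site D L)) (τ σ : Qubits D L × Anc a) :
    AgreeOn S (mixConfig S τ σ) τ := fun j hj => by simp [mixConfig, hj]

lemma agreeOn_compl_mixConfig (S : Set (Site D L)) (τ σ : Qubits D L × Anc a) :
    AgreeOn Sᶜ σ (mixConfig S τ σ) := fun j hj => by
  have : j ∉ S := hj
  simp [mixConfig, this]

lemma eq_mixConfig {S : Set (Site D L)} {τ σ ρ : Qubits D L × Anc a} (h₁ : AgreeOn S ρ τ)
    (h₂ : AgreeOn Sᶜ σ ρ) : ρ = mixConfig S τ σ := by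
  ext j
  · by_cases hj : j ∈ S
    · simp [mixConfig, hj, (h₁ j hj).1]
    · simp [mixConfig, hj, (h₂ j hj).1]
  · by_cases hj : j ∈ S
    · simp [mixConfig, hj, (h₁ j hj).2]
    · simp [mixConfig, hj, (h₂ j hj).2]

/-- Only one intermediate configuration contributes: on `S` it must already equal `τ`, because `Y`
acts trivially there, and off `S` it must still equal `σ`. -/
lemma SupportedOn.mul_apply {S S' : Set (Site D L)} (hd : Disjoint S S') {X Y : FullOp a}
    (hX : SupportedOn S X) (hY : SupportedOn S' Y) (σ τ : Qubits D L × Anc a) :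
    (X * Y) σ τ = X σ (mixConfig S τ σ) * Y (mixConfig S τ σ) τ := by
  rw [Matrix.mul_apply]
  refine Finset.sum_eq_single _ (fun ρ _ hρ => ?_) (by simp)
  by_contra hne
  have h1 : AgreeOn Sᶜ σ ρ := by
    by_contra h; exact hne (by rw [hX.1 σ ρ h, zero_mul])
  have h2 : AgreeOn S'ᶜ ρ τ := by
    by_contra h; exact hne (by rw [hY.1 ρ τ h, mul_zero])
  exact hρ (eq_mixConfig (fun j hj => h2 j (Set.disjoint_left.1 hd hj)) h1)

/-- Both products reduce to one entry of `X` times one entry of `Y`. The entries agree in the two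
orders because they are insensitive to the configuration outside the support; if `σ` and `τ` differ
outside `S ∪ S'`, both products vanish. -/
lemma SupportedOn.commute {S S' : Set (Site D L)} (hd : Disjoint S S') {X Y : FullOp a}
    (hX : SupportedOn S X) (hY : SupportedOn S' Y) : Commute X Y := by
  ext σ τ
  rw [hX.mul_apply hd hY, hY.mul_apply hd.symm hX, mul_comm]
  by_cases h : AgreeOn (S ∪ S')ᶜ σ τ
  · have e : ∀ {A B : Set (Site D L)} {Z : FullOp a}, Disjoint A B → AgreeOn (A ∪ B)ᶜ σ τ →
        SupportedOn A Z → Z σ (mixConfig A τ σ) = Z (mixConfig B τ σ) τ := by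
      intro A B Z hAB hστ hZ
      refine hZ.2 _ _ _ _ (agreeOn_compl_mixConfig _ _ _) (fun j hj => ?_) (fun j hj => ?_)
        (agreeOn_mixConfig _ _ _)
      · by_cases hB : j ∈ B
        · exact agreeOn_mixConfig B τ σ j hB
        · have h1 := agreeOn_compl_mixConfig B τ σ j hB
          have h2 := hστ j (by simp only [Set.mem_compl_iff, Set.mem_union, not_or]; exact ⟨hj, hB⟩)
          exact ⟨h1.1.symm.trans h2.1, h1.2.symm.trans h2.2⟩
      · exact agreeOn_compl_mixConfig B τ σ j (Set.disjoint_left.1 hAB hj)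
    rw [e hd h hX, e hd.symm (by rwa [Set.union_comm]) hY]
  · have e : ∀ {A B : Set (Site D L)} {Z : FullOp a}, ¬ AgreeOn (A ∪ B)ᶜ σ τ →
        SupportedOn B Z → Z (mixConfig A τ σ) τ = 0 := by
      intro A B Z hστ hZ
      refine hZ.1 _ _ fun hag => hστ fun j hj => ?_
      simp only [Set.mem_compl_iff, Set.mem_union, not_or] at hj
      have h1 := agreeOn_compl_mixConfig A τ σ j hj.1
      have h2 := hag j hj.2
      exact ⟨h1.1.trans h2.1, h1.2.trans h2.2⟩
    rw [e h hY, e (by rwa [Set.union_comm]) hX, zero_mul, mul_zero]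

lemma SupportedOn.conjTranspose {S : Set (Site D L)} {X : FullOp a} (hX : SupportedOn S X) :
    SupportedOn S Xᴴ := by
  have hs : ∀ {B : Set (Site D L)} {σ τ : Qubits D L × Anc a}, AgreeOn B σ τ → AgreeOn B τ σ :=
    fun h j hj => ⟨(h j hj).1.symm, (h j hj).2.symm⟩
  refine ⟨fun σ τ h => ?_, fun σ τ σ' τ' h h' h1 h2 => ?_⟩
  · rw [Matrix.conjTranspose_apply, hX.1 τ σ fun h' => h (hs h'), star_zero]
  · rw [Matrix.conjTranspose_apply, Matrix.conjTranspose_apply,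
      hX.2 τ σ τ' σ' (hs h) (hs h') h2 h1]

lemma IsLindbladianOn.isDissip {S : Set (Site D L)} {T : SuperOp a} (h : IsLindbladianOn S T) :
    IsDissip (heisL T) := by
  obtain ⟨K, H, V, hH, -, -, hT⟩ := h
  exact LindbladForm.isDissip ⟨hH, hT⟩

lemma IsLindbladianOn.conjTranspose_apply {S : Set (Site D L)} {T : SuperOp a}
    (h : IsLindbladianOn S T) (X : FullOp a) : (T X)ᴴ = T Xᴴ := by
  obtain ⟨K, H, V, hH, -, -, hT⟩ := h
  exact LindbladForm.conjTranspose_apply ⟨hH, hT⟩ X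

lemma IsLindbladianOn.heisL_one {S : Set (Site D L)} {T : SuperOp a}
    (h : IsLindbladianOn S T) : heisL T 1 = 0 := by
  obtain ⟨K, H, V, hH, -, -, hT⟩ := h
  exact LindbladForm.heis_eq_zero ⟨hH, hT⟩ (Commute.one_right _) (fun k => Commute.one_right _)
      fun k => Commute.one_right _

lemma IsLindbladianOn.heisL_eq_zero {S A : Set (Site D L)} {T : SuperOp a}
    (h : IsLindbladianOn S T) (hd : Disjoint S A) {O : FullOp a} (hO : SupportedOn A O) :
    heisL T O = 0 := by
  obtain ⟨K, H, V, hH, hHS, hVS, hT⟩ := h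
  exact LindbladForm.heis_eq_zero ⟨hH, hT⟩ (hHS.commute hd hO) (fun k => (hVS k).commute hd hO)
    fun k => (hVS k).conjTranspose.commute hd hO

lemma IsLindbladianOn.commute {S S' : Set (Site D L)} {T T' : SuperOp a}
    (h : IsLindbladianOn S T) (h' : IsLindbladianOn S' T') (hd : Disjoint S S') :
    Commute (heisL T) (heisL T') := by
  obtain ⟨K, H, V, hH, hHS, hVS, hT⟩ := h
  obtain ⟨K', H', V', hH', hHS', hVS', hT'⟩ := h'
  have hf : LindbladForm T H V := ⟨hH, hT⟩
  have hf' : LindbladForm T' H' V' := ⟨hH', hT'⟩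
  have key : ∀ {X : FullOp a}, SupportedOn S' X →
      Commute (heis T) (LinearMap.mulLeft ℂ X) ∧ Commute (heis T) (LinearMap.mulRight ℂ X) :=
    fun hX => hf.commute_of_commute (hX.commute hd.symm hHS) (fun k => hX.commute hd.symm (hVS k))
      fun k => hX.commute hd.symm (hVS k).conjTranspose
  have hc : Commute (heis T) (heis T') :=
    hf'.commute_heis (key hHS') (fun k => key (hVS' k)) fun k => key (hVS' k).conjTranspose
  ext1 O
  exact congrArg (fun f => f O) hc.eq

/-- Amplification by a one-dimensional factor recovers the plain `1 → 1` norm, whose dual is the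
operator norm. The absolute value covers constants of either sign. -/
lemma CBNormLE.norm_heisL_le {T : SuperOp a} {J : ℝ} (h : CBNormLE T J) : ‖heisL T‖ ≤ |J| := by
  refine _root_.norm_heisL_le (abs_nonneg J) fun X => ?_
  let e : (Qubits D L × Anc a) × Fin 1 ≃ Qubits D L × Anc a := Equiv.prodUnique _ _
  have h1 := h 1 (X.submatrix e e)
  have h2 : amplify 1 T (X.submatrix e e) = (T X).submatrix e e := rfl
  rw [h2, traceNorm_submatrix, traceNorm_submatrix] at h1
  exact h1.trans (mul_le_mul_of_nonneg_right (le_abs_self J) (traceNorm_nonneg X))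

end Locality

/-! ### The evolution and its adjoint -/

section Evolution

open scoped Matrix.Norms.L2Operator

variable {D L : ℕ} {a : Site D L → ℕ}

lemma hasSum_semi_apply {E : Type*} [NormedAddCommGroup E] [NormedSpace ℂ E] [CompleteSpace E]
    (T : E →L[ℂ] E) (t : ℝ) (X : E) :
    HasSum (fun k : ℕ => ((t ^ k / (k ! : ℝ) : ℝ) : ℂ) • (T ^ k) X) (semi T t X) := by
  let _ : NormedAlgebra ℚ (E →L[ℂ] E) := NormedAlgebra.restrictScalars ℚ ℝ _
  have h1 := NormedSpace.exp_series_hasSum_exp' (𝕂 := ℝ) (t • T)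
  have h2 := ((ContinuousLinearMap.apply ℂ E X).restrictScalars ℝ).hasSum h1
  convert h2 using 1
  · funext k
    simp only [ContinuousLinearMap.coe_restrictScalars',
      ContinuousLinearMap.apply_apply, smul_pow, _root_.smul_apply, smul_smul]
    rw [← Complex.coe_smul]
    congr 2
    field_simp
  · rfl

lemma hasSum_evolve (T : SuperOp a) (t : ℝ) (X : FullOp a) :
    HasSum (fun k : ℕ => ((t ^ k / (k ! : ℝ) : ℝ) : ℂ) • (T ^ k) X) (evolve T t X) := by
  have h := hasSum_semi_apply (LinearMap.toContinuousLinearMap T) t X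
  have e : ∀ k : ℕ, (LinearMap.toContinuousLinearMap T ^ k) X = (T ^ k) X := by
    intro k
    induction k with
    | zero => simp
    | succ k ih => rw [pow_succ', pow_succ', mul_apply_eq_comp, ih]; rfl
  simp only [e] at h
  exact h.summable.hasSum

/-- The bridge between the two pictures, proved term by term on the exponential series. Afterwards,
expectation values are estimated through `semi (heisL T)` acting on observables. -/
lemma trace_mul_evolve (T : SuperOp a) (t : ℝ) (B X : FullOp a) :
    (B * evolve T t X).trace = (semi (heisL T) t B * X).trace := by
  let f : FullOp a →L[ℂ] ℂ := LinearMap.toContinuousLinearMap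
    ((Matrix.traceLinearMap _ ℂ ℂ).comp (LinearMap.mulLeft ℂ B))
  let g : FullOp a →L[ℂ] ℂ := LinearMap.toContinuousLinearMap
    ((Matrix.traceLinearMap _ ℂ ℂ).comp (LinearMap.mulRight ℂ X))
  have h1 := f.hasSum (hasSum_evolve T t X)
  have h2 := g.hasSum (hasSum_semi_apply (heisL T) t B)
  have e : ∀ (k : ℕ) (B : FullOp a), (((heisL T ^ k) B) * X).trace = (B * (T ^ k) X).trace := by
    intro k
    induction k with
    | zero => simp
    | succ k ih =>
      intro B
      rw [pow_succ, pow_succ', mul_apply_eq_comp, ih, heisL_apply, trace_heis_mul]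
      rfl
  refine h1.unique ?_
  convert h2 using 1
  · funext k
    simp only [map_smul]
    congr 1
    exact (e k B).symm
  · rfl

lemma conjTranspose_evolve {T : SuperOp a} (hT : ∀ X, (T X)ᴴ = T Xᴴ) (t : ℝ) (X : FullOp a) :
    (evolve T t X)ᴴ = evolve T t Xᴴ := by
  have e : ∀ k : ℕ, ((T ^ k) X)ᴴ = (T ^ k) Xᴴ := by
    intro k
    induction k with
    | zero => simp
    | succ k ih => rw [pow_succ', Module.End.mul_apply, Module.End.mul_apply, hT, ih]
  unfold evolve
  rw [Matrix.conjTranspose_tsum]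
  simp only [Matrix.conjTranspose_smul, e, RCLike.star_def, Complex.conj_ofReal]

end Evolution

/-! ### Local observables -/

section Observables

open scoped Matrix.Norms.L2Operator

variable {D L : ℕ} {a : Site D L → ℕ}

/-- The splitting of a configuration into its parts on and off `A`. -/
def splitEquiv (A : Finset (Site D L)) :
    Qubits D L ≃ (A → Fin 2) × ({j // j ∉ A} → Fin 2) :=
  Equiv.piEquivPiSubtypeProd (fun j => j ∈ A) fun _ => Fin 2

lemma splitEquiv_symm (A : Finset (Site D L)) (σ : A → Fin 2) (η : {j // j ∉ A} → Fin 2) :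
    (splitEquiv A).symm (σ, η) = glue A σ η := rfl

lemma embedOp_eq (A : Finset (Site D L)) (O : RegionOp A) :
    embedOp A O = (O ⊗ₖ (1 : Matrix ({j // j ∉ A} → Fin 2) ({j // j ∉ A} → Fin 2) ℂ)).submatrix
      (splitEquiv A) (splitEquiv A) := by
  ext σ τ
  simp only [embedOp, Matrix.of_apply, Matrix.submatrix_apply, Matrix.kroneckerMap_apply,
    Matrix.one_apply, splitEquiv, Equiv.piEquivPiSubtypeProd_apply]
  by_cases h : ∀ j, j ∉ A → σ j = τ j
  · rw [if_pos h, if_pos (by funext j; exact h j j.2), mul_one]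
  · rw [if_neg h, if_neg (fun h' => h fun j hj => congrFun h' ⟨j, hj⟩), mul_zero]

/-- `O ↦ O ⊗ 1` as a homomorphism of star algebras. -/
noncomputable def embedHom (A : Finset (Site D L)) (a : Site D L → ℕ) :
    RegionOp A →⋆ₙₐ[ℂ] FullOp a where
  toFun O := embedOp A O ⊗ₖ (1 : AncOp a)
  map_smul' c O := by
    rw [embedOp_eq, embedOp_eq, Matrix.smul_kronecker, Matrix.submatrix_smul,
      Pi.smul_apply, Pi.smul_apply, Matrix.smul_kronecker]
    rfl
  map_zero' := by simp [embedOp_eq]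
  map_add' O O' := by
    rw [embedOp_eq, embedOp_eq, embedOp_eq, Matrix.add_kronecker, Matrix.submatrix_add,
      Pi.add_apply, Pi.add_apply, Matrix.add_kronecker]
  map_mul' O O' := by
    rw [← Matrix.mul_kronecker_mul, one_mul, embedOp_eq, embedOp_eq, embedOp_eq,
      Matrix.submatrix_mul_equiv, ← Matrix.mul_kronecker_mul, one_mul]
  map_star' O := by
    simp only [Matrix.star_eq_conjTranspose, embedOp_eq, Matrix.conjTranspose_kronecker,
      Matrix.conjTranspose_submatrix, Matrix.conjTranspose_one]

/-- Star homomorphisms between C*-algebras are contractive. -/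
lemma norm_embedHom_le (A : Finset (Site D L)) (O : RegionOp A) : ‖embedHom A a O‖ ≤ ‖O‖ :=
  NonUnitalStarAlgHom.norm_apply_le _ O

lemma supportedOn_embedHom (A : Finset (Site D L)) (O : RegionOp A) :
    SupportedOn (A : Set (Site D L)) (embedHom A a O) := by
  have hdef : ∀ σ τ : Qubits D L × Anc a, embedHom A a O σ τ =
      (if ∀ j, j ∉ A → σ.1 j = τ.1 j then O (fun j => σ.1 j) (fun j => τ.1 j) else 0) *
        (if σ.2 = τ.2 then 1 else 0) := fun σ τ => rfl
  refine ⟨fun σ τ h => ?_, fun σ τ σ' τ' h h' h1 h2 => ?_⟩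
  · rw [hdef]
    by_contra hne
    refine h fun j hj => ?_
    have ha : ∀ j, j ∉ A → σ.1 j = τ.1 j := by
      by_contra hc; exact hne (by rw [if_neg hc, zero_mul])
    have hb : σ.2 = τ.2 := by
      by_contra hc; exact hne (by rw [if_neg hc, mul_zero])
    exact ⟨ha j hj, congrFun hb j⟩
  · have hg : ∀ j, j ∉ A → σ.1 j = τ.1 j := fun j hj => (h j hj).1
    have hg' : ∀ j, j ∉ A → σ'.1 j = τ'.1 j := fun j hj => (h' j hj).1
    simp only [hdef, if_pos hg, if_pos hg']
    congr 1
    · congr 1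
      · funext j; exact (h1 j j.2).1
      · funext j; exact (h2 j j.2).1
    · have : σ.2 = τ.2 ↔ σ'.2 = τ'.2 := by
        rw [funext_iff, funext_iff]
        refine forall_congr' fun j => ?_
        by_cases hj : j ∈ A
        · rw [(h1 j hj).2, (h2 j hj).2]
        · simp [(h j hj).2, (h' j hj).2]
      simp only [this]

lemma trace_embedOp_mul (A : Finset (Site D L)) (O : RegionOp A) (X : SysOp D L) :
    (embedOp A O * X).trace = (O * reduceTo A X).trace := by
  have e : X = (X.submatrix (splitEquiv A).symm (splitEquiv A).symm).submatrix
      (splitEquiv A) (splitEquiv A) := by simp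
  rw [embedOp_eq]
  conv_lhs => rw [e, Matrix.submatrix_mul_equiv]
  rw [Matrix.trace, ← (splitEquiv A).symm.sum_comp]
  simp only [Matrix.diag_apply, Matrix.submatrix_apply, Equiv.apply_symm_apply,
    Fintype.sum_prod_type, Matrix.mul_apply, Matrix.trace, Matrix.kroneckerMap_apply, reduceTo,
    Matrix.of_apply, Finset.mul_sum, Matrix.one_apply, splitEquiv_symm]
  refine Finset.sum_congr rfl fun σ _ => ?_
  rw [Finset.sum_comm]
  refine Finset.sum_congr rfl fun τ _ => ?_
  refine Finset.sum_congr rfl fun η _ => ?_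
  simp

lemma trace_kronecker_one_mul (B : SysOp D L) (X : FullOp a) :
    ((B ⊗ₖ (1 : AncOp a)) * X).trace = (B * traceSnd X).trace := by
  simp only [Matrix.trace, Matrix.diag_apply, Matrix.mul_apply, Fintype.sum_prod_type,
    Matrix.kroneckerMap_apply, Matrix.one_apply, traceSnd, Matrix.of_apply, Finset.mul_sum]
  refine Finset.sum_congr rfl fun σ _ => ?_
  rw [Finset.sum_comm]
  refine Finset.sum_congr rfl fun τ _ => ?_
  refine Finset.sum_congr rfl fun e _ => ?_
  simp

lemma trace_embedHom_mul (A : Finset (Site D L)) (O : RegionOp A) (X : FullOp a) :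
    (embedHom A a O * X).trace = (O * reduceTo A (traceSnd X)).trace :=
  (trace_kronecker_one_mul _ _).trans (trace_embedOp_mul _ _ _)

lemma isState_kronecker {ρ : SysOp D L} {ω : AncOp a} (hρ : IsState ρ) (hω : IsState ω) :
    IsState (ρ ⊗ₖ ω) :=
  ⟨hρ.1.kronecker hω.1, by rw [Matrix.trace_kronecker, hρ.2, hω.2, one_mul]⟩

end Observables

/-! ### Geometry of the lattice -/

section Geometry

variable {D L : ℕ} (b : Boundary)

lemma coordDist_self {L : ℕ} (u : Fin (2 * L + 1)) : coordDist b u u = 0 := by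
  cases b <;> simp [coordDist, Nat.dist]

lemma coordDist_comm {L : ℕ} (u v : Fin (2 * L + 1)) : coordDist b u v = coordDist b v u := by
  cases b <;> simp only [coordDist, Nat.dist] <;> omega

lemma coordDist_triangle {L : ℕ} (u v w : Fin (2 * L + 1)) :
    coordDist b u w ≤ coordDist b u v + coordDist b v w := by
  cases b <;> simp only [coordDist, Nat.dist] <;> omega

lemma siteDist_self (u : Site D L) : siteDist b u u = 0 := by
  simp [siteDist, coordDist_self]

lemma siteDist_comm (u v : Site D L) : siteDist b u v = siteDist b v u :=
  Finset.sum_congr rfl fun _ _ => coordDist_comm b _ _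

lemma siteDist_triangle (u v w : Site D L) :
    siteDist b u w ≤ siteDist b u v + siteDist b v w := by
  rw [siteDist, siteDist, siteDist, ← Finset.sum_add_distrib]
  exact Finset.sum_le_sum fun _ _ => coordDist_triangle b _ _ _

/-- The signed displacement from `u` injects the ball into `[-r, r]`; on the cycle, a displacement
that is too long is first reduced modulo `2 * L + 1`. -/
lemma card_coordDist_le {L : ℕ} (u : Fin (2 * L + 1)) (r : ℕ) :
    (Finset.univ.filter fun v => coordDist b u v ≤ r).card ≤ 2 * r + 1 := by
  have hc : (Finset.Icc (-(r : ℤ)) r).card = 2 * r + 1 := by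
    rw [Int.card_Icc]; omega
  rw [← hc]
  refine Finset.card_le_card_of_injOn
    (fun v => if Nat.dist u v ≤ r then (v : ℤ) - u else
      if (u : ℕ) < v then (v : ℤ) - u - (2 * L + 1) else (v : ℤ) - u + (2 * L + 1)) ?_ ?_
  · intro v hv
    simp only [Finset.coe_filter, Finset.mem_univ, true_and, Set.mem_ofPred_eq] at hv
    simp only [Finset.coe_Icc, Set.mem_Icc]
    cases b <;> simp only [coordDist, Nat.dist] at hv ⊢ <;> split_ifs <;> omega
  · intro v hv v' hv' h
    simp only [Finset.coe_filter, Finset.mem_univ, true_and, Set.mem_ofPred_eq] at hv hv'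
    apply Fin.ext
    cases b <;> simp only [coordDist, Nat.dist] at hv hv' h ⊢ <;> split_ifs at h <;> omega

lemma card_siteBall_le (u : Site D L) (r : ℕ) : (siteBall b u r).card ≤ (2 * r + 1) ^ D := by
  have hsub : siteBall b u r ⊆
      Fintype.piFinset fun i => Finset.univ.filter fun v => coordDist b (u i) v ≤ r := by
    intro v hv
    simp only [siteBall, Finset.mem_filter, Finset.mem_univ, true_and] at hv
    simp only [Fintype.mem_piFinset, Finset.mem_filter, Finset.mem_univ, true_and]
    exact fun i => (Finset.single_le_sum (f := fun i => coordDist b (u i) (v i))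
      (fun _ _ => Nat.zero_le _) (Finset.mem_univ i)).trans hv
  refine (Finset.card_le_card hsub).trans ?_
  rw [Fintype.card_piFinset]
  exact (Finset.prod_le_pow_card _ _ _ fun i _ => card_coordDist_le b (u i) r).trans (by simp)

lemma mem_siteBall {u v : Site D L} {r : ℕ} : v ∈ siteBall b u r ↔ siteDist b u v ≤ r := by
  simp [siteBall]

lemma mem_thicken {A : Finset (Site D L)} {v : Site D L} {r : ℕ} :
    v ∈ thicken b A r ↔ ∃ u ∈ A, siteDist b u v ≤ r := by
  simp [thicken]

lemma card_thicken_le (A : Finset (Site D L)) (r : ℕ) :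
    (thicken b A r).card ≤ A.card * (2 * r + 1) ^ D := by
  classical
  have : thicken b A r ⊆ A.biUnion fun u => siteBall b u r := fun v hv => by
    simpa [mem_siteBall] using (mem_thicken b).1 hv
  refine (Finset.card_le_card this).trans (Finset.card_biUnion_le.trans ?_)
  exact (Finset.sum_le_card_nsmul _ _ _ fun u _ => card_siteBall_le b u r).trans (by simp)

/-- A bound on `∑ j, e^{-d(j, u) / 2}`, independent of the size of the lattice. -/
noncomputable def latticeSum (D : ℕ) : ℝ :=
  ∑' r : ℕ, (2 * r + 1 : ℝ) ^ D * Real.exp (-(1 / 2)) ^ r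

lemma summable_latticeSum (D : ℕ) :
    Summable fun r : ℕ => (2 * r + 1 : ℝ) ^ D * Real.exp (-(1 / 2)) ^ r := by
  have hq : ‖Real.exp (-(1 / 2))‖ < 1 := by
    rw [Real.norm_of_nonneg (Real.exp_pos _).le, Real.exp_lt_one_iff]; norm_num
  have h := (summable_pow_mul_geometric_of_norm_lt_one D hq).mul_left ((3 : ℝ) ^ D)
  refine (summable_nat_add_iff 1).1 ?_
  refine Summable.of_nonneg_of_le (fun r => by positivity) (fun r => ?_)
    ((summable_nat_add_iff 1).2 h)
  rw [← mul_assoc, ← mul_pow]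
  gcongr
  push_cast
  linarith [(Nat.cast_nonneg r : (0 : ℝ) ≤ r)]

lemma latticeSum_nonneg (D : ℕ) : 0 ≤ latticeSum D := tsum_nonneg fun r => by positivity

/-- Sites are grouped by their distance to `u`, and each sphere is bounded by the ball of the same
radius. -/
lemma sum_exp_siteDist_le (u : Site D L) :
    ∑ j, Real.exp (-(siteDist b j u / 2 : ℝ)) ≤ latticeSum D := by
  classical
  set m := Finset.univ.sup fun j => siteDist b j u
  have hm : ∀ j ∈ Finset.univ, siteDist b j u ∈ Finset.range (m + 1) := fun j hj =>
    Finset.mem_range.2 (Nat.lt_succ_of_le (Finset.le_sup (f := fun j => siteDist b j u) hj))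
  rw [← Finset.sum_fiberwise_of_maps_to hm]
  refine le_trans ?_ ((summable_latticeSum D).sum_le_tsum (Finset.range (m + 1))
    fun r _ => by positivity)
  refine Finset.sum_le_sum fun r _ => ?_
  have h1 : ∀ j ∈ Finset.univ.filter (fun j => siteDist b j u = r),
      Real.exp (-(siteDist b j u / 2 : ℝ)) = Real.exp (-(1 / 2)) ^ r := by
    intro j hj
    rw [(Finset.mem_filter.1 hj).2, ← Real.exp_nat_mul]
    congr 1; ring
  rw [Finset.sum_congr rfl h1, Finset.sum_const, nsmul_eq_mul]
  gcongr
  have h2 : Finset.univ.filter (fun j => siteDist b j u = r) ⊆ siteBall b u r := fun j hj => by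
    rw [mem_siteBall, siteDist_comm]; exact (Finset.mem_filter.1 hj).2.le
  have := (Finset.card_le_card h2).trans (card_siteBall_le b u r)
  exact_mod_cast this

/-- The weight `∑_{u ∈ A} e^{-d(j, u)}` of the site `j` with respect to the region `A`. -/
noncomputable def siteWeight (A : Finset (Site D L)) (j : Site D L) : ℝ :=
  ∑ u ∈ A, Real.exp (-(siteDist b j u : ℝ))

lemma siteWeight_pos {A : Finset (Site D L)} (hA : A.Nonempty) (j : Site D L) :
    0 < siteWeight b A j :=
  Finset.sum_pos (fun _ _ => Real.exp_pos _) hA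

lemma siteWeight_le (A : Finset (Site D L)) (i j : Site D L) :
    siteWeight b A i ≤ Real.exp (siteDist b i j) * siteWeight b A j := by
  rw [siteWeight, siteWeight, Finset.mul_sum]
  refine Finset.sum_le_sum fun u _ => ?_
  rw [← Real.exp_add, Real.exp_le_exp]
  have h : siteDist b j u ≤ siteDist b i j + siteDist b i u := by
    rw [siteDist_comm b i j]; exact siteDist_triangle b _ _ _
  have : (siteDist b j u : ℝ) ≤ siteDist b i j + siteDist b i u := by exact_mod_cast h
  linarith

lemma exp_neg_le_siteWeight {A : Finset (Site D L)} {j u : Site D L} (hu : u ∈ A) {r : ℕ}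
    (h : siteDist b j u ≤ r) : Real.exp (-(r : ℝ)) ≤ siteWeight b A j := by
  refine le_trans ?_ (Finset.single_le_sum (f := fun u => Real.exp (-(siteDist b j u : ℝ)))
    (fun _ _ => (Real.exp_pos _).le) hu)
  have : (siteDist b j u : ℝ) ≤ r := by exact_mod_cast h
  exact Real.exp_le_exp.2 (by linarith)

/-- Half of the exponential decay pays for the distance `s`; the other half keeps the sum over sites
bounded uniformly in `L`. -/
lemma sum_siteWeight_far_le (A F : Finset (Site D L)) {s : ℝ}
    (hF : ∀ j ∈ F, ∀ u ∈ A, s ≤ siteDist b j u) :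
    ∑ j ∈ F, siteWeight b A j ≤ A.card * latticeSum D * Real.exp (-(s / 2)) := by
  unfold siteWeight
  rw [Finset.sum_comm]
  refine (Finset.sum_le_card_nsmul _ _ (latticeSum D * Real.exp (-(s / 2))) fun u hu => ?_).trans
    (le_of_eq (by rw [nsmul_eq_mul, mul_assoc]))
  calc _ ≤ ∑ j ∈ F, Real.exp (-(siteDist b j u / 2 : ℝ)) * Real.exp (-(s / 2)) := by
        refine Finset.sum_le_sum fun j hj => ?_
        rw [← Real.exp_add, Real.exp_le_exp]
        have := hF j hj u hu
        linarith
    _ ≤ _ := by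
        rw [← Finset.sum_mul]
        gcongr
        refine le_trans ?_ (sum_exp_siteDist_le b u)
        exact Finset.sum_le_sum_of_subset_of_nonneg (Finset.subset_univ _)
          fun _ _ _ => (Real.exp_pos _).le

lemma card_le_of_diam {A : Finset (Site D L)} {k₀ : ℕ}
    (hA : ∀ u ∈ A, ∀ v ∈ A, siteDist b u v ≤ k₀) : A.card ≤ (2 * k₀ + 1) ^ D := by
  rcases A.eq_empty_or_nonempty with rfl | ⟨u, hu⟩
  · simp
  · refine (Finset.card_le_card (t := siteBall b u k₀) fun v hv => ?_).trans (card_siteBall_le b u k₀)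
    exact (mem_siteBall b).2 (hA u hu v hv)

lemma card_nearbyTerms_le (A : Finset (Site D L)) (r₀ r : ℕ) :
    (nearbyTerms b r₀ A r).card ≤ A.card * (2 * (r + r₀) + 1) ^ D := by
  refine (Finset.card_le_card (t := thicken b A (r + r₀)) fun j hj => ?_).trans
    (card_thicken_le b A (r + r₀))
  obtain ⟨v, hv, hv'⟩ := Finset.not_disjoint_iff.1 (Finset.mem_filter.1 hj).2
  obtain ⟨u, hu, huv⟩ := (mem_thicken b).1 hv'
  rw [mem_siteBall] at hv
  refine (mem_thicken b).2 ⟨u, hu, ?_⟩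
  have := siteDist_triangle b u v j
  rw [siteDist_comm b v j] at this
  omega

end Geometry

/-! ### Quasi-locality of the evolution -/

section QuasiLocality

open scoped Matrix.Norms.L2Operator

variable {D L : ℕ} {a : Site D L → ℕ} {c : PhaseConstants} {b : Boundary}

/-- Lieb-Robinson velocity. -/
noncomputable def PhaseConstants.velocity (c : PhaseConstants) (D : ℕ) : ℝ :=
  2 * (|c.strength| * ((2 * (2 * c.range) + 1) ^ D : ℕ) * Real.exp ((2 * c.range : ℕ) : ℝ))

/-- Prefactor of the Lieb-Robinson bound. -/
noncomputable def PhaseConstants.lrConst (c : PhaseConstants) (D : ℕ) : ℝ :=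
  4 * |c.strength| * Real.exp c.range * latticeSum D

lemma PhaseConstants.velocity_nonneg (c : PhaseConstants) (D : ℕ) : 0 ≤ c.velocity D := by
  unfold velocity; positivity

lemma PhaseConstants.lrConst_nonneg (c : PhaseConstants) (D : ℕ) : 0 ≤ c.lrConst D := by
  have := latticeSum_nonneg D
  unfold lrConst; positivity

lemma semi_apply_of_apply_eq_zero {E : Type*} [NormedAddCommGroup E] [NormedSpace ℂ E]
    [CompleteSpace E] {G : E →L[ℂ] E} (hG : IsDissip G) {O : E} (h : G O = 0) {t : ℝ}
    (ht : 0 ≤ t) : semi G t O = O := by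
  have := norm_semi_time_sub_le hG O le_rfl ht
  rw [h, norm_zero, zero_mul, semi_zero] at this
  exact sub_eq_zero.1 (norm_le_zero_iff.1 this)

lemma IsLocalLindbladian.isDissip {T : Site D L → SuperOp a} (hT : IsLocalLindbladian c b T)
    (s : Finset (Site D L)) : IsDissip (heisL (∑ j ∈ s, T j)) := by
  rw [heisL_sum]
  exact IsDissip.sum _ fun j _ => (hT j).1.isDissip

lemma IsLocalLindbladian.norm_heisL_le {T : Site D L → SuperOp a} (hT : IsLocalLindbladian c b T)
    (j : Site D L) : ‖heisL (T j)‖ ≤ |c.strength| := (hT j).2.norm_heisL_le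

/-- A term whose ball misses `A` annihilates `O`. Otherwise its centre is within `range` of `A`, and
the factor `exp range` lifts its weight to at least one. -/
lemma IsLocalLindbladian.norm_heisL_apply_le {T : Site D L → SuperOp a}
    (hT : IsLocalLindbladian c b T) {A : Finset (Site D L)} {O : FullOp a}
    (hO : SupportedOn (A : Set (Site D L)) O) (j : Site D L) :
    ‖heisL (T j) O‖ ≤ |c.strength| * ‖O‖ * Real.exp c.range * siteWeight b A j := by
  by_cases hd : Disjoint (siteBall b j c.range) A
  · rw [(hT j).1.heisL_eq_zero (Finset.disjoint_coe.2 hd) hO, norm_zero]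
    have : 0 ≤ siteWeight b A j := Finset.sum_nonneg fun _ _ => (Real.exp_pos _).le
    positivity
  · obtain ⟨u, hu, hu'⟩ := Finset.not_disjoint_iff.1 hd
    have h1 := exp_neg_le_siteWeight b hu' ((mem_siteBall b).1 hu)
    have h2 : 1 ≤ Real.exp c.range * siteWeight b A j := by
      calc (1 : ℝ) = Real.exp c.range * Real.exp (-(c.range : ℝ)) := by
            rw [← Real.exp_add, add_neg_cancel, Real.exp_zero]
        _ ≤ _ := by gcongr
    refine ((heisL (T j)).le_opNorm O).trans ?_
    calc _ ≤ |c.strength| * ‖O‖ * 1 := by rw [mul_one]; gcongr; exact hT.norm_heisL_le j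
      _ ≤ |c.strength| * ‖O‖ * (Real.exp c.range * siteWeight b A j) := by gcongr
      _ = _ := by ring

lemma IsLocalLindbladian.lieb_robinson {T T' : Site D L → SuperOp a}
    (hT : IsLocalLindbladian c b T) (hT' : IsLocalLindbladian c b T') {A : Finset (Site D L)}
    (hA : A.Nonempty) {O : FullOp a} (hO : SupportedOn (A : Set (Site D L)) O) {t : ℝ}
    (ht : 0 ≤ t) (j : Site D L) :
    ‖heisL (T' j) (semi (heisL (∑ j, T j)) t O)‖ ≤
      2 * (|c.strength| * ‖O‖ * Real.exp c.range) * siteWeight b A j *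
        Real.exp (c.velocity D * t) := by
  rw [heisL_sum]
  have hadj : ∀ i j : Site D L, ¬ Disjoint (siteBall b i c.range) (siteBall b j c.range) →
      siteDist b i j ≤ 2 * c.range := by
    intro i j hij
    obtain ⟨v, hv, hv'⟩ := Finset.not_disjoint_iff.1 hij
    rw [mem_siteBall] at hv hv'
    have := siteDist_triangle b i v j
    rw [siteDist_comm b v j] at this
    omega
  -- Terms are adjacent when their balls overlap, so adjacent centres are at most `2 * range` apart;
  -- this fixes both the number `Z` of neighbours and the ratio `κ` of their weights.
  refine _root_.lieb_robinson (D := fun j => heisL (T j)) (K := fun j => heisL (T' j))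
    (adj := fun i j => ¬ Disjoint (siteBall b i c.range) (siteBall b j c.range))
    (J := |c.strength|) (κ := Real.exp ((2 * c.range : ℕ) : ℝ)) (Z := (2 * (2 * c.range) + 1) ^ D)
    (w := siteWeight b A) (abs_nonneg _) (Real.exp_pos _).le (fun i => (hT i).1.isDissip) ?_ ?_
    hT.norm_heisL_le hT'.norm_heisL_le (siteWeight_pos b hA) ?_ ?_ O (by positivity)
    (hT.norm_heisL_apply_le hO) (hT'.norm_heisL_apply_le hO) ht j
  · intro i j hij
    exact (hT i).1.commute (hT j).1 (Finset.disjoint_coe.2 (not_not.1 hij))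
  · intro i j hij
    exact (hT i).1.commute (hT' j).1 (Finset.disjoint_coe.2 (not_not.1 hij))
  · intro i j hij
    refine (siteWeight_le b A i j).trans ?_
    have := (siteWeight_pos b hA j).le
    gcongr
    exact hadj i j hij
  · intro j
    refine le_trans ?_ (card_siteBall_le b j (2 * c.range))
    rw [← Set.ncard_coe_finset]
    refine Set.ncard_le_ncard (fun i hi => ?_) (Finset.finite_toSet _)
    rw [Finset.mem_coe, mem_siteBall, siteDist_comm]
    exact hadj i j hi

/-- Two local Lindbladians whose terms are close on `N`, where `N` contains all terms at distance
less than `s` from `A`, evolve observables on `A` similarly. -/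
theorem IsLocalLindbladian.norm_semi_sub_le {T T' : Site D L → SuperOp a}
    (hT : IsLocalLindbladian c b T) (hT' : IsLocalLindbladian c b T') {A : Finset (Site D L)}
    {O : FullOp a} (hO : SupportedOn (A : Set (Site D L)) O) (N : Finset (Site D L)) {θ s t : ℝ}
    (hθ : 0 ≤ θ) (hN : ∀ j ∈ N, ‖heisL (T j - T' j)‖ ≤ θ)
    (hF : ∀ j, j ∉ N → ∀ u ∈ A, s ≤ siteDist b j u) (ht : 0 ≤ t) :
    ‖semi (heisL (∑ j, T j)) t O - semi (heisL (∑ j, T' j)) t O‖ ≤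
      ‖O‖ * (θ * N.card +
        c.lrConst D * A.card * Real.exp (c.velocity D * t) * Real.exp (-(s / 2))) * t := by
  have hlr := c.lrConst_nonneg D
  -- For empty `A` the weights vanish and the Lieb-Robinson bound does not apply, but then `O` is
  -- stationary under both evolutions.
  rcases A.eq_empty_or_nonempty with rfl | hA
  · have h0 : ∀ {T : Site D L → SuperOp a}, IsLocalLindbladian c b T →
        semi (heisL (∑ j, T j)) t O = O := by
      intro T hT
      refine semi_apply_of_apply_eq_zero (hT.isDissip _) ?_ ht
      rw [heisL_sum, _root_.sum_apply]
      exact Finset.sum_eq_zero fun j _ => (hT j).1.heisL_eq_zero (by simp) hO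
    rw [h0 hT, h0 hT', sub_self, norm_zero]
    positivity
  -- By Duhamel it suffices to bound the difference of the generators on the evolved observable:
  -- terms in `N` through `θ` and contractivity, the others by applying the Lieb-Robinson bound
  -- separately to the terms of `T` and of `T'`.
  · refine _root_.norm_semi_sub_le (hT'.isDissip _) O ht fun u hu hut => ?_
    have e : heisL (∑ j, T j) - heisL (∑ j, T' j) = ∑ j, (heisL (T j) - heisL (T' j)) := by
      rw [heisL_sum, heisL_sum, Finset.sum_sub_distrib]
    rw [e, _root_.sum_apply]
    classical
    rw [← Finset.sum_add_sum_compl N]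
    refine (norm_add_le _ _).trans ?_
    rw [mul_add]
    refine add_le_add ?_ ?_
    · refine (norm_sum_le_of_le _ (n := fun _ => θ * ‖O‖) fun j hj => ?_).trans
        (le_of_eq (by rw [Finset.sum_const, nsmul_eq_mul]; ring))
      rw [← heisL_sub]
      refine ((heisL (T j - T' j)).le_opNorm _).trans ?_
      refine mul_le_mul (hN j hj) ?_ (norm_nonneg _) hθ
      refine ((semi _ u).le_opNorm O).trans ?_
      exact mul_le_of_le_one_left (norm_nonneg O) ((hT.isDissip _).norm_semi_le hu)
    · have hexp : Real.exp (c.velocity D * u) ≤ Real.exp (c.velocity D * t) :=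
        Real.exp_le_exp.2 (mul_le_mul_of_nonneg_left hut (c.velocity_nonneg D))
      calc _ ≤ ∑ j ∈ Nᶜ, (4 * (|c.strength| * ‖O‖ * Real.exp c.range) *
              Real.exp (c.velocity D * t)) * siteWeight b A j := by
            refine norm_sum_le_of_le _ fun j _ => ?_
            refine (norm_sub_le _ _).trans ?_
            have h1 := hT.lieb_robinson hT hA hO hu j
            have h2 := hT.lieb_robinson hT' hA hO hu j
            have h3 : 2 * (|c.strength| * ‖O‖ * Real.exp c.range) * siteWeight b A j *
                Real.exp (c.velocity D * u) ≤ 2 * (|c.strength| * ‖O‖ * Real.exp c.range) *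
                  siteWeight b A j * Real.exp (c.velocity D * t) := by
              have := (siteWeight_pos b hA j).le
              gcongr
            exact (add_le_add (h1.trans h3) (h2.trans h3)).trans (le_of_eq (by ring))
        _ ≤ (4 * (|c.strength| * ‖O‖ * Real.exp c.range) * Real.exp (c.velocity D * t)) *
              (A.card * latticeSum D * Real.exp (-(s / 2))) := by
            rw [← Finset.mul_sum]
            gcongr
            exact sum_siteWeight_far_le b A _ fun j hj => hF j (Finset.mem_compl.1 hj)
        _ = _ := by unfold PhaseConstants.lrConst; ring

lemma IsLocalLindbladian.norm_heisL_sum_apply_le {T : Site D L → SuperOp a}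
    (hT : IsLocalLindbladian c b T) {A : Finset (Site D L)}
    {O : FullOp a} (hO : SupportedOn (A : Set (Site D L)) O) :
    ‖heisL (∑ j, T j) O‖ ≤ |c.strength| * (A.card * (2 * c.range + 1) ^ D : ℕ) * ‖O‖ := by
  classical
  rw [heisL_sum, _root_.sum_apply, ← Finset.sum_add_sum_compl (thicken b A c.range)]
  have h0 : ∑ j ∈ (thicken b A c.range)ᶜ, heisL (T j) O = 0 := by
    refine Finset.sum_eq_zero fun j hj => (hT j).1.heisL_eq_zero (Finset.disjoint_coe.2 ?_) hO
    rw [Finset.mem_compl, mem_thicken] at hj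
    refine Finset.disjoint_left.2 fun u hu hu' => hj ⟨u, hu', ?_⟩
    rw [siteDist_comm]
    exact (mem_siteBall b).1 hu
  rw [h0, add_zero]
  refine (norm_sum_le_of_le _ (n := fun _ => |c.strength| * ‖O‖) fun j _ =>
    ((heisL (T j)).le_opNorm O).trans ?_).trans ?_
  · gcongr
    exact hT.norm_heisL_le j
  · rw [Finset.sum_const, nsmul_eq_mul]
    have : ((thicken b A c.range).card : ℝ) ≤ (A.card * (2 * c.range + 1) ^ D : ℕ) := by
      exact_mod_cast card_thicken_le b A c.range
    calc _ ≤ ((A.card * (2 * c.range + 1) ^ D : ℕ) : ℝ) * (|c.strength| * ‖O‖) := by gcongr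
      _ = _ := by ring

/-- The terms of the patched Lindbladian. -/
def patchedTerm (c : PhaseConstants) (b : Boundary) (T T' : Site D L → SuperOp a)
    (S : Finset (Site D L)) (j : Site D L) : SuperOp a :=
  if siteBall b j c.range ⊆ S then T j else T' j

lemma isLocalLindbladian_patchedTerm {T T' : Site D L → SuperOp a} (hT : IsLocalLindbladian c b T)
    (hT' : IsLocalLindbladian c b T') (S : Finset (Site D L)) :
    IsLocalLindbladian c b (patchedTerm c b T T' S) := by
  intro j
  unfold patchedTerm
  split_ifs
  exacts [hT j, hT' j]

lemma norm_trace_evolve_sub_le {ρ₀ : FullOp a} (hρ : IsState ρ₀) (T T' : SuperOp a)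
    (O : FullOp a) (s t : ℝ) :
    ‖(O * evolve T s ρ₀).trace - (O * evolve T' t ρ₀).trace‖ ≤
      ‖semi (heisL T) s O - semi (heisL T') t O‖ := by
  rw [trace_mul_evolve, trace_mul_evolve, ← Matrix.trace_sub, ← sub_mul]
  exact norm_trace_mul_state_le hρ _

/-- The evolution of an observable on `A` is approximated by that of a patched Lindbladian. -/
lemma norm_trace_evolve_sub_patched_le {T T' : Site D L → SuperOp a}
    (hT : IsLocalLindbladian c b T) (hT' : IsLocalLindbladian c b T') {ρ₀ : FullOp a}
    (hρ : IsState ρ₀) {A : Finset (Site D L)} {O : FullOp a}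
    (hO : SupportedOn (A : Set (Site D L)) O) (s : ℕ) {t : ℝ} (ht : 0 ≤ t) :
    ‖(O * evolve (∑ j, T j) t ρ₀).trace -
        (O * evolve (patched c b T T' (thicken b A s)) t ρ₀).trace‖ ≤
      ‖O‖ * (c.lrConst D * A.card * Real.exp (c.velocity D * t) *
        Real.exp (-(((s : ℝ) - c.range) / 2))) * t := by
  classical
  have hp : patched c b T T' (thicken b A s) = ∑ j, patchedTerm c b T T' (thicken b A s) j := rfl
  rw [hp]
  refine (norm_trace_evolve_sub_le hρ _ _ O t t).trans ?_
  -- Inside the thickened region the two generators coincide, hence `θ = 0`. A ball of radius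
  -- `range` that leaves the region has its centre at distance at least `s - range` from `A`.
  have := hT.norm_semi_sub_le (isLocalLindbladian_patchedTerm hT hT' (thicken b A s)) hO
    (Finset.univ.filter fun j => siteBall b j c.range ⊆ thicken b A s) (θ := 0)
    (s := (s : ℝ) - c.range) le_rfl ?_ ?_ ht
  · simpa using this
  · intro j hj
    rw [patchedTerm, if_pos (Finset.mem_filter.1 hj).2, sub_self]
    simp [heisL]
  · intro j hj u hu
    simp only [Finset.mem_filter, Finset.mem_univ, true_and] at hj
    obtain ⟨v, hv, hv'⟩ := Finset.not_subset.1 hj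
    rw [mem_thicken] at hv'
    push Not at hv'
    have h1 := hv' u hu
    rw [mem_siteBall] at hv
    have h2 := siteDist_triangle b u j v
    rw [siteDist_comm b u j] at h2
    have h3 : s ≤ siteDist b j u + c.range := by omega
    have : (s : ℝ) ≤ siteDist b j u + c.range := by exact_mod_cast h3
    linarith

/-! ### Relaxation of local observables -/

/-- Half of the decay rate absorbs the polynomial, by the estimate `y ^ m / m! ≤ exp y`. -/
lemma exists_pow_mul_exp_le (m : ℕ) {g : ℝ} (hg : 0 < g) :
    ∃ C : ℝ, 0 ≤ C ∧ ∀ t : ℝ, 0 ≤ t → (t + 1) ^ m * Real.exp (-(g * t)) ≤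
      C * Real.exp (-(g / 2 * t)) := by
  refine ⟨m ! * (2 / g) ^ m * Real.exp (g / 2), by positivity, fun t ht => ?_⟩
  have h1 := Real.pow_div_factorial_le_exp (x := g / 2 * (t + 1)) (by positivity) m
  rw [div_le_iff₀ (by positivity), mul_pow] at h1
  have h2 : (t + 1) ^ m ≤ m ! * (2 / g) ^ m * Real.exp (g / 2 * (t + 1)) := by
    calc (t + 1) ^ m = (2 / g) ^ m * ((g / 2) ^ m * (t + 1) ^ m) := by
          rw [← mul_assoc, ← mul_pow]
          have : 2 / g * (g / 2) = 1 := by field_simp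
          rw [this, one_pow, one_mul]
      _ ≤ (2 / g) ^ m * (Real.exp (g / 2 * (t + 1)) * m !) := by gcongr
      _ = _ := by ring
  calc _ ≤ m ! * (2 / g) ^ m * Real.exp (g / 2 * (t + 1)) * Real.exp (-(g * t)) := by gcongr
    _ = m ! * (2 / g) ^ m * (Real.exp (g / 2 * (t + 1)) * Real.exp (-(g * t))) := by ring
    _ = m ! * (2 / g) ^ m * (Real.exp (g / 2) * Real.exp (-(g / 2 * t))) := by
      rw [← Real.exp_add, ← Real.exp_add]
      ring_nf
    _ = _ := by ring

/-- Local mixing: the local steady-state estimate for patched Lindbladians. -/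
lemma norm_trace_patched_sub_le {T T' : Site D L → SuperOp a} {ρs : SysOp D L} {ω : AncOp a}
    {A : Finset (Site D L)} (hcomp : IsCompatible c b T T' ρs ω) {s : ℕ} (hs : max c.range 1 ≤ s) :
    ∃ z : RegionOp A → ℂ, ∀ (O : RegionOp A) (t : ℝ), 0 ≤ t →
      ‖(embedHom A a O * evolve (patched c b T T' (thicken b A s)) t (ρs ⊗ₖ ω)).trace - z O‖ ≤
        ‖O‖ * (c.poly (thicken b A s).card * Real.exp (-(c.rate * t))) := by
  obtain ⟨ρ, η, -, h⟩ := hcomp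
  refine ⟨fun O => (embedHom A a O * (ρ (thicken b A s) ⊗ₖ η (thicken b A s))).trace,
    fun O t ht => ?_⟩
  have hb : regionBoundary b c.range (Finset.univ : Finset (Site D L)) = ∅ := by
    simp [regionBoundary]
  -- The outer region is the whole lattice, whose boundary is empty, and compatibility is used for
  -- the initial state `ρs`. The condition on `s` keeps `A` away from the boundary of its
  -- thickening.
  have h1 := h A (thicken b A s) Finset.univ
    (fun u hu => (mem_thicken b).2 ⟨u, hu, by simp [siteDist_self]⟩) (Finset.subset_univ _)
    (Finset.disjoint_left.2 fun u hu hu' => by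
      obtain ⟨v, hv, hv'⟩ := (Finset.mem_filter.1 hu').2
      exact hv ((mem_thicken b).2 ⟨u, hu, hv'.trans hs⟩))
    (by simp [hb]) ρs (Or.inr rfl) t ht
  rw [← Matrix.trace_sub, ← mul_sub, trace_embedHom_mul]
  exact (norm_trace_mul_le _ _).trans (mul_le_mul_of_nonneg_left h1 (norm_nonneg _))

lemma PhaseConstants.poly_card_thicken_le (c : PhaseConstants) (b : Boundary)
    {A : Finset (Site D L)} {k : ℕ} (hA : A.card ≤ k) (s : ℕ) :
    c.poly (thicken b A s).card ≤ |c.coeff| * ((k : ℝ) * (2 * s + 1) ^ D) ^ c.degree := by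
  unfold poly
  have h1 : ((thicken b A s).card : ℝ) ≤ k * (2 * s + 1) ^ D := by
    have h2 := (card_thicken_le b A s).trans (Nat.mul_le_mul_right _ hA)
    exact_mod_cast h2
  calc _ ≤ |c.coeff| * ((thicken b A s).card : ℝ) ^ c.degree := by
        gcongr; exact le_abs_self _
    _ ≤ _ := by gcongr

/-- Expectation values of local observables relax exponentially, uniformly in the system size. -/
theorem exists_relaxation (D k : ℕ) (c : PhaseConstants) (hrate : 0 < c.rate) :
    ∃ H g : ℝ, 0 < H ∧ 0 < g ∧
      ∀ (L : ℕ) (b : Boundary) (a : Site D L → ℕ) (T T' : Site D L → SuperOp a) (ρs : SysOp D L)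
        (ω : AncOp a), IsLocalLindbladian c b T → IsLocalLindbladian c b T' → IsState ρs →
        IsState ω → IsCompatible c b T T' ρs ω → ∀ A : Finset (Site D L), A.card ≤ k →
        ∀ (O : RegionOp A) (t t' : ℝ), 0 ≤ t → t ≤ t' →
          ‖(embedHom A a O * evolve (∑ j, T j) t' (ρs ⊗ₖ ω)).trace -
            (embedHom A a O * evolve (∑ j, T j) t (ρs ⊗ₖ ω)).trace‖ ≤
              ‖O‖ * (H * Real.exp (-(g * t))) := by
  set v := c.velocity D
  have hv : 0 ≤ v := c.velocity_nonneg D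
  have hlr := c.lrConst_nonneg D
  set m := max c.range 1
  -- Chosen so that the radius `s` used below satisfies `2 * s + 1 ≤ β * (t + 1)`.
  set β : ℝ := 2 * (2 * (v + 2)) + 2 * m + 3 with hβ
  obtain ⟨C, hC, hCt⟩ := exists_pow_mul_exp_le (D * c.degree) hrate
  set P := |c.coeff| * ((k : ℝ) * β ^ D) ^ c.degree with hP
  have hβ0 : 0 ≤ β := by positivity
  have hP0 : 0 ≤ P := by positivity
  set g := min 1 (c.rate / 2)
  have hg : 0 < g := lt_min one_pos (by positivity)
  set H₀ := 2 * (c.lrConst D * k * Real.exp (c.range / 2)) + 2 * (P * C) + 1 with hH₀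
  have hH₀pos : 0 < H₀ := by positivity
  have hq : Real.exp (-g) < 1 := by rw [Real.exp_lt_one_iff]; linarith
  refine ⟨H₀ / (1 - Real.exp (-g)), g, div_pos hH₀pos (by linarith), hg, ?_⟩
  intro L b a T T' ρs ω hT hT' hρ hω hcomp A hA O
  have hst := isState_kronecker hρ hω
  set f : ℝ → ℂ := fun t => (embedHom A a O * evolve (∑ j, T j) t (ρs ⊗ₖ ω)).trace with hf
  have hAk : (A.card : ℝ) ≤ k := by exact_mod_cast hA
  have hstep : ∀ t t', 0 ≤ t → t ≤ t' → t' ≤ t + 1 →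
      ‖f t' - f t‖ ≤ ‖O‖ * (H₀ * Real.exp (-(g * t))) := by
    intro t t' ht htt' ht'
    -- The radius grows linearly with time. Then `exp (-s / 2)` beats the factor `exp (v * u)`, the
    -- extra factor `u ≤ exp (t + 1)`, and still leaves `exp (-(t + 1))`.
    set s : ℕ := ⌈2 * (v + 2) * (t + 1)⌉₊ + m with hs
    have hs1 : 2 * (v + 2) * (t + 1) ≤ s := by
      rw [hs]; push_cast
      have := Nat.le_ceil (2 * (v + 2) * (t + 1))
      have : (0 : ℝ) ≤ m := Nat.cast_nonneg m
      linarith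
    have hs2 : 2 * (s : ℝ) + 1 ≤ β * (t + 1) := by
      have h1 := (Nat.ceil_lt_add_one (show 0 ≤ 2 * (v + 2) * (t + 1) by positivity)).le
      rw [hs, hβ]; push_cast
      have : (0 : ℝ) ≤ m := Nat.cast_nonneg m
      nlinarith
    obtain ⟨z, hz⟩ := norm_trace_patched_sub_le (A := A) hcomp (s := s) (by rw [hs]; exact le_add_self)
    -- All times in the unit interval are compared with the same number `z O`, the steady-state
    -- value of the patched evolution. It depends on `t` through `s`, so this controls increments
    -- rather than giving a limit directly.
    have hloc : ∀ u, 0 ≤ u → u ≤ t + 1 → t ≤ u → ‖f u - z O‖ ≤ ‖O‖ * (c.lrConst D * k *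
        Real.exp (c.range / 2) * Real.exp (-(g * t)) + P * C * Real.exp (-(g * t))) := by
      intro u hu hut htu
      have h1 := norm_trace_evolve_sub_patched_le hT hT' hst (supportedOn_embedHom (a := a) A O) s hu
      have h2 := hz O u hu
      have h3 : ‖O‖ * (c.poly (thicken b A s).card * Real.exp (-(c.rate * u))) ≤
          ‖O‖ * (P * C * Real.exp (-(g * t))) := by
        refine mul_le_mul_of_nonneg_left ?_ (norm_nonneg O)
        have h4 : c.poly (thicken b A s).card ≤ P * (t + 1) ^ (D * c.degree) := by
          refine (c.poly_card_thicken_le b hA s).trans ?_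
          rw [hP, mul_assoc, pow_mul, ← mul_pow]
          refine mul_le_mul_of_nonneg_left (pow_le_pow_left₀ (by positivity) ?_ _) (abs_nonneg _)
          rw [mul_assoc, ← mul_pow]
          gcongr
        calc c.poly (thicken b A s).card * Real.exp (-(c.rate * u))
            ≤ P * (t + 1) ^ (D * c.degree) * Real.exp (-(c.rate * t)) := by gcongr
          _ = P * ((t + 1) ^ (D * c.degree) * Real.exp (-(c.rate * t))) := by ring
          _ ≤ P * (C * Real.exp (-(c.rate / 2 * t))) := mul_le_mul_of_nonneg_left (hCt t ht) hP0
          _ ≤ P * (C * Real.exp (-(g * t))) := by gcongr; exact min_le_right _ _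
          _ = _ := by ring
      have h5 : ‖embedHom A a O‖ * (c.lrConst D * A.card * Real.exp (v * u) *
          Real.exp (-(((s : ℝ) - c.range) / 2))) * u ≤
          ‖O‖ * (c.lrConst D * k * Real.exp (c.range / 2) * Real.exp (-(g * t))) := by
        have h6 : Real.exp (v * u) * Real.exp (-(((s : ℝ) - c.range) / 2)) * u ≤
            Real.exp (c.range / 2) * Real.exp (-(g * t)) := by
          have h7 : u ≤ Real.exp (t + 1) := by
            have := Real.add_one_le_exp (t + 1)
            linarith
          calc _ ≤ Real.exp (v * u) * Real.exp (-(((s : ℝ) - c.range) / 2)) * Real.exp (t + 1) := by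
                gcongr
            _ = Real.exp (v * u + -(((s : ℝ) - c.range) / 2) + (t + 1)) := by
                rw [← Real.exp_add, ← Real.exp_add]
            _ ≤ Real.exp (c.range / 2 + -(g * t)) := by
                rw [Real.exp_le_exp]
                have h8 : v * u ≤ v * (t + 1) := by gcongr
                have h9 : g * t ≤ 1 * t := by gcongr; exact min_le_left _ _
                nlinarith
            _ = _ := Real.exp_add _ _
        calc _ ≤ ‖O‖ * (c.lrConst D * k * Real.exp (v * u) *
              Real.exp (-(((s : ℝ) - c.range) / 2))) * u := by
              gcongr
              exact norm_embedHom_le A O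
          _ = ‖O‖ * (c.lrConst D * k * (Real.exp (v * u) *
              Real.exp (-(((s : ℝ) - c.range) / 2)) * u)) := by ring
          _ ≤ ‖O‖ * (c.lrConst D * k * (Real.exp (c.range / 2) * Real.exp (-(g * t)))) := by gcongr
          _ = _ := by ring
      have h10 : f u - z O = (f u -
          (embedHom A a O * evolve (patched c b T T' (thicken b A s)) u (ρs ⊗ₖ ω)).trace) +
          ((embedHom A a O * evolve (patched c b T T' (thicken b A s)) u (ρs ⊗ₖ ω)).trace - z O) := by
        ring
      rw [h10, mul_add]
      exact (norm_add_le _ _).trans (add_le_add (h1.trans h5) (h2.trans h3))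
    have e : f t' - f t = (f t' - z O) - (f t - z O) := by ring
    rw [e]
    refine (norm_sub_le _ _).trans ((add_le_add (hloc t' (ht.trans htt') ht' htt')
      (hloc t ht (by linarith) le_rfl)).trans ?_)
    rw [← mul_add]
    gcongr
    rw [hH₀]
    have := Real.exp_pos (-(g * t))
    nlinarith
  set H := H₀ / (1 - Real.exp (-g)) with hH
  -- `H` is the sum of the geometric series of unit-step increments; this fixed-point equation
  -- drives the induction.
  have hHeq : H * Real.exp (-g) + H₀ = H := by
    have : 1 - Real.exp (-g) ≠ 0 := by linarith
    rw [hH]; field_simp; ring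
  have hH0 : 0 < H := div_pos hH₀pos (by linarith)
  have hmain : ∀ (n : ℕ) (t t' : ℝ), 0 ≤ t → t ≤ t' → t' ≤ t + n →
      ‖f t' - f t‖ ≤ ‖O‖ * (H * Real.exp (-(g * t))) := by
    intro n
    induction n with
    | zero =>
      intro t t' ht h1 h2
      have : t' = t := by push_cast at h2; linarith
      rw [this, sub_self, norm_zero]; positivity
    | succ n ih =>
      intro t t' ht h1 h2
      rcases le_total t' (t + 1) with h3 | h3
      · refine (hstep t t' ht h1 h3).trans ?_
        have : H₀ ≤ H := by
          have := mul_pos hH0 (Real.exp_pos (-g)); linarith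
        gcongr
      · have h4 := ih (t + 1) t' (by linarith) h3 (by push_cast at h2; linarith)
        have h5 := hstep t (t + 1) ht (by linarith) le_rfl
        have e : f t' - f t = (f t' - f (t + 1)) + (f (t + 1) - f t) := by ring
        rw [e]
        refine (norm_add_le _ _).trans ((add_le_add h4 h5).trans (le_of_eq ?_))
        have e2 : Real.exp (-(g * (t + 1))) = Real.exp (-g) * Real.exp (-(g * t)) := by
          rw [← Real.exp_add]; ring_nf
        rw [e2]
        linear_combination ‖O‖ * Real.exp (-(g * t)) * hHeq
  intro t t' ht htt'
  exact hmain ⌈t' - t⌉₊ t t' ht htt' (by have := Nat.le_ceil (t' - t); linarith)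

end QuasiLocality

/-! ### Classical shadows -/

section Shadows

open scoped Matrix.Norms.L2Operator

variable {D L : ℕ} {a : Site D L → ℕ}

lemma trace_mul_im_eq_zero {ι : Type*} [Fintype ι] {A B : Matrix ι ι ℂ} (hA : A.IsHermitian)
    (hB : B.IsHermitian) : (A * B).trace.im = 0 := by
  have : star (A * B).trace = (A * B).trace := by
    rw [← Matrix.trace_conjTranspose, Matrix.conjTranspose_mul, hA.eq, hB.eq, Matrix.trace_mul_comm]
  exact Complex.conj_eq_iff_im.1 this

lemma norm_entry_le {ι : Type*} [Fintype ι] [DecidableEq ι] (O : Matrix ι ι ℂ) (i j : ι) :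
    ‖O i j‖ ≤ ‖O‖ := by
  have h1 := (Matrix.toEuclideanCLM (𝕜 := ℂ) O).le_opNorm (EuclideanSpace.single j 1)
  rw [PiLp.norm_single, norm_one, mul_one] at h1
  refine le_trans ?_ h1
  refine le_trans (le_of_eq ?_)
    (PiLp.norm_apply_le (Matrix.toEuclideanCLM (𝕜 := ℂ) O (EuclideanSpace.single j 1)) i)
  rw [Matrix.ofLp_toEuclideanCLM]
  simp

lemma pauli_isHermitian (p : Fin 3) : (pauli p).IsHermitian := by
  fin_cases p <;> ext i j <;> fin_cases i <;> fin_cases j <;> simp [pauli]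

lemma pauli_mul_self (p : Fin 3) : pauli p * pauli p = 1 := by
  fin_cases p <;> ext i j <;> fin_cases i <;> fin_cases j <;> simp [pauli]

lemma pauliProj_isHermitian (z : Fin 3 × Fin 2) : (pauliProj z).IsHermitian := by
  rw [Matrix.IsHermitian, pauliProj, Matrix.conjTranspose_smul, Matrix.conjTranspose_add,
    Matrix.conjTranspose_smul, (pauli_isHermitian z.1).eq]
  simp

lemma pauliProj_mul_self (z : Fin 3 × Fin 2) : pauliProj z * pauliProj z = pauliProj z := by
  have h : ((-1 : ℂ) ^ (z.2 : ℕ)) * (-1 : ℂ) ^ (z.2 : ℕ) = 1 := by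
    rw [← mul_pow]; norm_num
  simp only [pauliProj, Matrix.smul_mul, Matrix.mul_smul, smul_smul, add_mul, mul_add, one_mul,
    mul_one, pauli_mul_self]
  match_scalars
  · linear_combination (1 / 4) * h
  · ring

lemma pauliProj_trace (z : Fin 3 × Fin 2) : (pauliProj z).trace = 1 := by
  obtain ⟨p, s⟩ := z
  fin_cases p <;> simp [pauliProj, pauli, Matrix.trace, Fin.sum_univ_two] <;> ring

lemma norm_shadow_entry_le (z : Fin 3 × Fin 2) (i j : Fin 2) :
    ‖((3 : ℂ) • pauliProj z - 1 : Matrix (Fin 2) (Fin 2) ℂ) i j‖ ≤ 2 := by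
  obtain ⟨p, s⟩ := z
  fin_cases p <;> fin_cases s <;> fin_cases i <;> fin_cases j <;>
    simp [pauliProj, pauli] <;> norm_num

/-- The tomographic identity of one qubit: measuring in a random Pauli basis and preparing the
outcome maps `X` to `(X + tr X) / 3`, and `3 P - 1` is the inverse of this channel at `P`. It is
verified entry by entry. -/
lemma sum_pauliProj_mul_shadow (α β σ τ : Fin 2) :
    ∑ z : Fin 3 × Fin 2, (1 / 3 : ℂ) * pauliProj z α β *
      ((3 : ℂ) • pauliProj z - 1 : Matrix (Fin 2) (Fin 2) ℂ) σ τ =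
        (if β = σ then 1 else 0) * (if α = τ then 1 else 0) := by
  rw [Fintype.sum_prod_type]
  simp only [Fin.sum_univ_three, Fin.sum_univ_two]
  fin_cases α <;> fin_cases β <;> fin_cases σ <;> fin_cases τ <;>
    simp [pauliProj, pauli] <;> ring_nf <;> simp <;> norm_num

lemma productOp_mul (A B : Site D L → Matrix (Fin 2) (Fin 2) ℂ) :
    productOp A * productOp B = productOp fun j => A j * B j := by
  ext σ τ
  simp only [Matrix.mul_apply, productOp, Matrix.of_apply, ← Finset.prod_mul_distrib]
  rw [Finset.prod_univ_sum, Fintype.piFinset_univ]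

lemma productOp_isHermitian {A : Site D L → Matrix (Fin 2) (Fin 2) ℂ}
    (hA : ∀ j, (A j).IsHermitian) : (productOp A).IsHermitian := by
  ext σ τ
  simp only [Matrix.conjTranspose_apply, productOp, Matrix.of_apply, star_prod]
  exact Finset.prod_congr rfl fun j _ => (hA j).apply _ _

lemma productOp_trace (A : Site D L → Matrix (Fin 2) (Fin 2) ℂ) :
    (productOp A).trace = ∏ j, (A j).trace := by
  simp only [Matrix.trace, Matrix.diag_apply, productOp, Matrix.of_apply]
  rw [Finset.prod_univ_sum, Fintype.piFinset_univ]

lemma shadow_isHermitian (z : Record D L) : (shadow z).IsHermitian :=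
  productOp_isHermitian fun j => by
    have h := pauliProj_isHermitian (z j)
    rw [Matrix.IsHermitian, Matrix.conjTranspose_sub, Matrix.conjTranspose_smul, h.eq]
    simp

lemma shadow_factor_trace (z : Fin 3 × Fin 2) :
    ((3 : ℂ) • pauliProj z - 1 : Matrix (Fin 2) (Fin 2) ℂ).trace = 1 := by
  rw [Matrix.trace_sub, Matrix.trace_smul, pauliProj_trace]
  simp
  norm_num

lemma shadow_trace (z : Record D L) : (shadow z).trace = 1 := by
  rw [shadow, productOp_trace]
  exact Finset.prod_eq_one fun j _ => shadow_factor_trace (z j)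

/-- Classical shadows are unbiased. -/
lemma sum_smul_shadow (ρ : SysOp D L) :
    ∑ z : Record D L, ((1 / 3 : ℂ) ^ Fintype.card (Site D L) *
      (productOp (fun j => pauliProj (z j)) * ρ).trace) • shadow z = ρ := by
  ext σ τ
  -- Everything except the matrix element of `ρ` factorises over sites, so summing over records
  -- reduces to the one-qubit identity at each site.
  have h1 : ∀ z : Record D L, ((1 / 3 : ℂ) ^ Fintype.card (Site D L) *
      (productOp (fun j => pauliProj (z j)) * ρ).trace) * shadow z σ τ =
      ∑ α, ∑ β, ρ β α * ∏ j, ((1 / 3 : ℂ) * pauliProj (z j) (α j) (β j) *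
        ((3 : ℂ) • pauliProj (z j) - 1 : Matrix (Fin 2) (Fin 2) ℂ) (σ j) (τ j)) := by
    intro z
    simp only [Matrix.trace, Matrix.diag_apply, Matrix.mul_apply, Finset.sum_mul, Finset.mul_sum,
      Finset.prod_mul_distrib, Finset.prod_const, Finset.card_univ]
    refine Finset.sum_congr rfl fun α _ => Finset.sum_congr rfl fun β _ => ?_
    simp only [productOp, shadow, Matrix.of_apply]
    ring
  rw [Matrix.sum_apply]
  simp only [Matrix.smul_apply, smul_eq_mul, h1]
  rw [Finset.sum_comm]
  have h2 : ∀ α β : Qubits D L, ∑ z : Record D L,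
      ρ β α * ∏ j, ((1 / 3 : ℂ) * pauliProj (z j) (α j) (β j) *
        ((3 : ℂ) • pauliProj (z j) - 1 : Matrix (Fin 2) (Fin 2) ℂ) (σ j) (τ j)) =
      ρ β α * if β = σ ∧ α = τ then 1 else 0 := by
    intro α β
    rw [← Finset.mul_sum]
    congr 1
    have h3 := Finset.prod_univ_sum (fun _ : Site D L => (Finset.univ : Finset (Fin 3 × Fin 2)))
      (fun j z => (1 / 3 : ℂ) * pauliProj z (α j) (β j) *
        ((3 : ℂ) • pauliProj z - 1 : Matrix (Fin 2) (Fin 2) ℂ) (σ j) (τ j))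
    rw [Fintype.piFinset_univ] at h3
    rw [← h3]
    simp only [sum_pauliProj_mul_shadow]
    by_cases h : β = σ ∧ α = τ
    · rw [if_pos h]
      refine Finset.prod_eq_one fun j _ => ?_
      simp [h.1, h.2]
    · rw [if_neg h]
      rw [not_and_or, funext_iff, funext_iff, not_forall, not_forall] at h
      rcases h with ⟨j, hj⟩ | ⟨j, hj⟩
      · exact Finset.prod_eq_zero (Finset.mem_univ j) (by simp [hj])
      · exact Finset.prod_eq_zero (Finset.mem_univ j) (by simp [hj])
  have h4 : ∀ α : Qubits D L, ∑ z : Record D L, ∑ β, ρ β α * ∏ j, ((1 / 3 : ℂ) *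
      pauliProj (z j) (α j) (β j) *
        ((3 : ℂ) • pauliProj (z j) - 1 : Matrix (Fin 2) (Fin 2) ℂ) (σ j) (τ j)) =
      ∑ β, ρ β α * if β = σ ∧ α = τ then 1 else 0 := by
    intro α
    rw [Finset.sum_comm]
    exact Finset.sum_congr rfl fun β _ => h2 α β
  simp only [h4]
  rw [Finset.sum_eq_single τ (fun α _ hα => Finset.sum_eq_zero fun β _ => by simp [hα]) (by simp),
    Finset.sum_eq_single σ (fun β _ hβ => by simp [hβ]) (by simp)]
  simp

lemma ofReal_recordProb {ρ : SysOp D L} (hρ : ρ.IsHermitian) (z : Record D L) :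
    (recordProb ρ z : ℂ) = (1 / 3 : ℂ) ^ Fintype.card (Site D L) *
      (productOp (fun j => pauliProj (z j)) * ρ).trace := by
  rw [recordProb]
  push_cast
  congr 1
  apply Complex.ext
  · simp
  · rw [trace_mul_im_eq_zero (productOp_isHermitian fun j => pauliProj_isHermitian _) hρ]
    simp

lemma sum_recordProb_smul_shadow {ρ : SysOp D L} (hρ : ρ.IsHermitian) :
    ∑ z : Record D L, (recordProb ρ z : ℂ) • shadow z = ρ := by
  simp only [ofReal_recordProb hρ]
  exact sum_smul_shadow ρ

lemma sum_recordProb_mul_re_trace {ρ : SysOp D L} (hρ : ρ.IsHermitian) (B : SysOp D L) :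
    ∑ z : Record D L, recordProb ρ z * (B * shadow z).trace.re = (B * ρ).trace.re := by
  conv_rhs => rw [← sum_recordProb_smul_shadow hρ]
  simp only [Finset.mul_sum, Matrix.mul_smul, Matrix.trace_sum, Matrix.trace_smul, Complex.re_sum,
    smul_eq_mul, Complex.re_ofReal_mul]

lemma sum_recordProb {ρ : SysOp D L} (hρ : ρ.IsHermitian) (htr : ρ.trace = 1) :
    ∑ z : Record D L, recordProb ρ z = 1 := by
  have h := sum_recordProb_mul_re_trace hρ 1
  simpa [shadow_trace, htr] using h

/-- Each traced-out qubit contributes the trace of its factor, which is one. -/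
lemma reduceTo_shadow_apply (A : Finset (Site D L)) (z : Record D L) (σ τ : A → Fin 2) :
    reduceTo A (shadow z) σ τ =
      ∏ j : A, ((3 : ℂ) • pauliProj (z j) - 1 : Matrix (Fin 2) (Fin 2) ℂ) (σ j) (τ j) := by
  have h1 : ∀ η : {j // j ∉ A} → Fin 2, shadow z (glue A σ η) (glue A τ η) =
      (∏ j : A, ((3 : ℂ) • pauliProj (z j) - 1 : Matrix (Fin 2) (Fin 2) ℂ) (σ j) (τ j)) *
      ∏ j : {j // j ∉ A},
        ((3 : ℂ) • pauliProj (z j) - 1 : Matrix (Fin 2) (Fin 2) ℂ) (η j) (η j) := by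
    intro η
    rw [shadow, productOp, Matrix.of_apply, ← Fintype.prod_subtype_mul_prod_subtype (fun j => j ∈ A)]
    congr 1
    · refine Finset.prod_congr (by ext; simp) fun j _ => ?_
      simp [glue, j.2]
    · refine Finset.prod_congr rfl fun j _ => ?_
      simp [glue, j.2]
  simp only [reduceTo, Matrix.of_apply, h1, ← Finset.mul_sum]
  have h3 := Finset.prod_univ_sum
    (fun _ : {j // j ∉ A} => (Finset.univ : Finset (Fin 2)))
    (fun j i => ((3 : ℂ) • pauliProj (z j) - 1 : Matrix (Fin 2) (Fin 2) ℂ) i i)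
  rw [Fintype.piFinset_univ] at h3
  rw [← h3]
  have h4 : ∏ j : {j // j ∉ A},
      ((3 : ℂ) • pauliProj (z j) - 1 : Matrix (Fin 2) (Fin 2) ℂ).trace = 1 :=
    Finset.prod_eq_one fun j _ => shadow_factor_trace (z j)
  exact (congrArg _ h4).trans (mul_one _)

/-- There are `4 ^ |A|` matrix elements, and each entry of the shadow is a product of `|A|` numbers
of modulus at most `2`. -/
lemma norm_trace_reduceTo_shadow_le (A : Finset (Site D L)) (O : RegionOp A) (z : Record D L) :
    ‖(O * reduceTo A (shadow z)).trace‖ ≤ ‖O‖ * 8 ^ A.card := by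
  have hc : Fintype.card (A → Fin 2) = 2 ^ A.card := by simp
  simp only [Matrix.trace, Matrix.diag_apply, Matrix.mul_apply]
  have h1 : ∀ σ τ : A → Fin 2, ‖O σ τ * reduceTo A (shadow z) τ σ‖ ≤ ‖O‖ * 2 ^ A.card := by
    intro σ τ
    rw [norm_mul, reduceTo_shadow_apply, norm_prod]
    refine mul_le_mul (norm_entry_le O σ τ) ?_ (Finset.prod_nonneg fun _ _ => norm_nonneg _)
      (norm_nonneg _)
    refine (Finset.prod_le_prod (fun _ _ => norm_nonneg _)
      fun (j : A) _ => norm_shadow_entry_le (z j) (τ j) (σ j)).trans ?_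
    simp
  refine (norm_sum_le_of_le _ (n := fun _ => (2 : ℝ) ^ A.card * (‖O‖ * 2 ^ A.card))
    fun σ _ => (norm_sum_le_of_le _ fun τ _ => h1 σ τ).trans ?_).trans ?_
  · rw [Finset.sum_const, Finset.card_univ, hc, nsmul_eq_mul]; push_cast; exact le_rfl
  · rw [Finset.sum_const, Finset.card_univ, hc, nsmul_eq_mul]
    push_cast
    have : (8 : ℝ) ^ A.card = 2 ^ A.card * (2 ^ A.card * 2 ^ A.card) := by
      rw [← mul_pow, ← mul_pow]; norm_num
    rw [this]
    exact le_of_eq (by ring)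

lemma embedOp_isHermitian {A : Finset (Site D L)} {O : RegionOp A} (hO : O.IsHermitian) :
    (embedOp A O).IsHermitian := by
  rw [Matrix.IsHermitian, embedOp_eq, Matrix.conjTranspose_submatrix,
    Matrix.conjTranspose_kronecker, hO.eq, Matrix.conjTranspose_one]

lemma norm_two_smul_proj_sub_one_le {ι : Type*} [Fintype ι] [DecidableEq ι] {P : Matrix ι ι ℂ}
    (hP : P.IsHermitian) (hPP : P * P = P) : ‖(2 : ℂ) • P - 1‖ ≤ 1 := by
  have h1 := Matrix.l2_opNorm_conjTranspose_mul_self ((2 : ℂ) • P - 1)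
  have h2 : ((2 : ℂ) • P - 1)ᴴ * ((2 : ℂ) • P - 1) = 1 := by
    rw [Matrix.conjTranspose_sub, Matrix.conjTranspose_smul, hP.eq, Matrix.conjTranspose_one]
    simp only [star_ofNat, sub_mul, mul_sub, Matrix.smul_mul, Matrix.mul_smul, hPP, one_mul,
      mul_one]
    module
  rw [h2] at h1
  have h3 : ‖(1 : Matrix ι ι ℂ)‖ ≤ 1 := by
    rcases isEmpty_or_nonempty ι with hι | hι
    · rw [show (1 : Matrix ι ι ℂ) = 0 from Subsingleton.elim _ _, norm_zero]; norm_num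
    · rw [norm_one]
  nlinarith [norm_nonneg ((2 : ℂ) • P - 1)]

end Shadows

/-! ### States of the phase -/

section PhaseStates

open scoped Matrix.Norms.L2Operator

variable {D L : ℕ} {a : Site D L → ℕ} {c : PhaseConstants} {b : Boundary}

lemma traceSnd_isHermitian {X : FullOp a} (hX : X.IsHermitian) : (traceSnd X).IsHermitian := by
  ext σ τ
  simp only [Matrix.conjTranspose_apply, traceSnd, Matrix.of_apply, star_sum]
  exact Finset.sum_congr rfl fun e _ => hX.apply _ _

lemma IsLocalLindbladian.evolve_isHermitian {T : Site D L → SuperOp a}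
    (hT : IsLocalLindbladian c b T) {X : FullOp a} (hX : X.IsHermitian) (t : ℝ) :
    (evolve (∑ j, T j) t X).IsHermitian := by
  rw [Matrix.IsHermitian, conjTranspose_evolve, hX.eq]
  intro Y
  rw [LinearMap.sum_apply, LinearMap.sum_apply, Matrix.conjTranspose_sum]
  exact Finset.sum_congr rfl fun j _ => (hT j).1.conjTranspose_apply Y

lemma IsLocalLindbladian.trace_evolve {T : Site D L → SuperOp a}
    (hT : IsLocalLindbladian c b T) {ρ : FullOp a} (hρ : IsState ρ) {t : ℝ} (ht : 0 ≤ t) :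
    (evolve (∑ j, T j) t ρ).trace = 1 := by
  have h := trace_mul_evolve (∑ j, T j) t 1 ρ
  rw [semi_apply_of_apply_eq_zero (hT.isDissip _) _ ht, one_mul, one_mul, hρ.2] at h
  · exact h
  · rw [heisL_sum, _root_.sum_apply]
    exact Finset.sum_eq_zero fun j _ => (hT j).1.heisL_one

lemma IsLocalLindbladian.norm_trace_mul_evolve_le {T : Site D L → SuperOp a}
    (hT : IsLocalLindbladian c b T) {ρ : FullOp a} (hρ : IsState ρ) {t : ℝ} (ht : 0 ≤ t)
    (B : FullOp a) : ‖(B * evolve (∑ j, T j) t ρ).trace‖ ≤ ‖B‖ := by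
  rw [trace_mul_evolve]
  refine (norm_trace_mul_state_le hρ _).trans (((semi _ t).le_opNorm B).trans ?_)
  exact mul_le_of_le_one_left (norm_nonneg B) ((hT.isDissip _).norm_semi_le ht)

lemma traceSnd_trace (X : FullOp a) : (traceSnd X).trace = X.trace := by
  have := trace_kronecker_one_mul (1 : SysOp D L) X
  rw [Matrix.one_kronecker_one, one_mul, one_mul] at this
  exact this.symm

/-- Positivity is obtained without complete positivity of the evolution: the reflection `2 P - 1`
has norm at most one, so its expectation in the evolved operator is at least `-1`; as the trace is
one, the expectation of `P` is nonnegative. -/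
lemma IsLocalLindbladian.recordProb_nonneg {T : Site D L → SuperOp a}
    (hT : IsLocalLindbladian c b T) {ρ : FullOp a} (hρ : IsState ρ) {t : ℝ} (ht : 0 ≤ t)
    (z : Record D L) : 0 ≤ recordProb (traceSnd (evolve (∑ j, T j) t ρ)) z := by
  refine mul_nonneg (by positivity) ?_
  rw [← trace_kronecker_one_mul]
  set P : FullOp a := productOp (fun j => pauliProj (z j)) ⊗ₖ (1 : AncOp a)
  have h1 : P.IsHermitian := by
    rw [Matrix.IsHermitian, Matrix.conjTranspose_kronecker, Matrix.conjTranspose_one,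
      (productOp_isHermitian fun j => pauliProj_isHermitian _).eq]
  have h2 : P * P = P := by
    rw [← Matrix.mul_kronecker_mul, one_mul, productOp_mul]
    simp only [pauliProj_mul_self]
    rfl
  have h3 := (hT.norm_trace_mul_evolve_le hρ ht _).trans (norm_two_smul_proj_sub_one_le h1 h2)
  rw [sub_mul, one_mul, Matrix.smul_mul, Matrix.trace_sub, Matrix.trace_smul,
    hT.trace_evolve hρ ht] at h3
  have h4 := (abs_le.1 ((Complex.abs_re_le_norm _).trans h3)).1
  simp at h4
  linarith

variable {ℓ W : ℕ} {T : Site D L → (Fin ℓ → Set.Icc (-1 : ℝ) 1) → SuperOp a}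
  {ρs : SysOp D L} {ω : Fin W → AncOp a}

lemma expectation_eq_sum {M : ℕ} (S : Fin M → Finset (Site D L)) (O : ∀ i, RegionOp (S i))
    (η : AncOp a) (x : Param D L ℓ) (t : ℝ) :
    expectation T ρs η S O x t =
      ∑ i, (embedHom (S i) a (O i) * phaseState T ρs η x t).trace := by
  have : (∑ i, embedOp (S i) (O i)) ⊗ₖ (1 : AncOp a) = ∑ i, embedHom (S i) a (O i) := by
    ext σ τ
    rw [Matrix.kroneckerMap_apply, Matrix.sum_apply, Matrix.sum_apply, Finset.sum_mul]
    rfl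
  rw [expectation, this, Finset.sum_mul, Matrix.trace_sum]

/-- Local expectation values depend smoothly on the time and on the nearby parameters. -/
lemma IsLindbladianPhase.norm_trace_sub_le (h : IsLindbladianPhase c b a T ρs ω) (w : Fin W)
    (A : Finset (Site D L)) (O : RegionOp A) {x y : Param D L ℓ} {r : ℕ} {γ s t tmax : ℝ}
    (hγ : 0 ≤ γ) (hxy : ∀ j ∈ nearbyTerms b c.range A r, dist (x j) (y j) ≤ γ)
    (hs : 0 ≤ s) (ht : 0 ≤ t) (htm : t ≤ tmax) (hst : |t - s| ≤ γ) :
    ‖(embedHom A a O * phaseState T ρs (ω w) x t).trace -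
        (embedHom A a O * phaseState T ρs (ω w) y s).trace‖ ≤
      ‖O‖ * (|c.strength| * (A.card * (2 * c.range + 1) ^ D : ℕ) * γ +
        (|c.lip| * γ * (nearbyTerms b c.range A r).card +
          c.lrConst D * A.card * Real.exp (c.velocity D * tmax) * Real.exp (-(r / 2))) * tmax) := by
  have hst' := isState_kronecker h.reference_state (h.auxiliary_state w)
  have hx := h.local_terms x
  have hy := h.local_terms y
  have hsup := supportedOn_embedHom (a := a) A O
  have hlr := c.lrConst_nonneg D
  have htm0 : 0 ≤ tmax := ht.trans htm
  have e : ∀ p q r' : ℂ, p - r' = (p - q) + (q - r') := fun _ _ _ => by ring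
  -- The intermediate point has the parameters of `y` and the time `t`, so time and parameters are
  -- changed separately.
  rw [e _ (embedHom A a O * phaseState T ρs (ω w) y t).trace, add_comm, mul_add]
  refine (norm_add_le _ _).trans (add_le_add ?_ ?_)
  · refine (norm_trace_evolve_sub_le hst' _ _ _ _ _).trans ?_
    have key : ∀ u v : ℝ, 0 ≤ u → u ≤ v → v - u ≤ γ →
        ‖semi (heisL (∑ j, T j (y j))) v (embedHom A a O) -
          semi (heisL (∑ j, T j (y j))) u (embedHom A a O)‖ ≤
          ‖O‖ * (|c.strength| * (A.card * (2 * c.range + 1) ^ D : ℕ) * γ) := by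
      intro u v hu huv huv'
      refine (norm_semi_time_sub_le (hy.isDissip _) _ hu huv).trans ?_
      calc _ ≤ |c.strength| * (A.card * (2 * c.range + 1) ^ D : ℕ) * ‖O‖ * γ := by
            refine mul_le_mul ((hy.norm_heisL_sum_apply_le hsup).trans ?_) huv' (by linarith)
              (by positivity)
            gcongr
            exact norm_embedHom_le A O
        _ = _ := by ring
    rw [abs_le] at hst
    rcases le_total s t with h1 | h1
    · exact key s t hs h1 hst.2
    · rw [norm_sub_rev]
      exact key t s ht h1 (by linarith)
  · refine (norm_trace_evolve_sub_le hst' _ _ _ _ _).trans ?_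
    -- The nearby terms differ by at most `lip * γ`. A term outside this set has its centre outside
    -- `A(r)`, hence at distance at least `r` from `A`.
    refine (hx.norm_semi_sub_le hy hsup (nearbyTerms b c.range A r) (θ := |c.lip| * γ) (s := r)
      (by positivity) ?_ ?_ ht).trans ?_
    · intro j hj
      refine (h.lipschitz j (x j) (y j)).norm_heisL_le.trans ?_
      rw [abs_mul, abs_of_nonneg dist_nonneg]
      gcongr
      exact hxy j hj
    · intro j hj u hu
      simp only [nearbyTerms, Finset.mem_filter, Finset.mem_univ, true_and, not_not] at hj
      have h1 := Finset.disjoint_left.1 hj ((mem_siteBall b).2 ((siteDist_self b j).le.trans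
        (Nat.zero_le _)))
      rw [mem_thicken] at h1
      push Not at h1
      have := h1 u hu
      rw [siteDist_comm] at this
      exact_mod_cast this.le
    · rw [mul_assoc]
      have := c.velocity_nonneg D
      gcongr
      exact norm_embedHom_le A O

end PhaseStates

/-! ### Laws of labelled samples and concentration -/

section LabelledLaw

variable {α β Z : Type*} [MeasurableSpace α] [MeasurableSpace β] [MeasurableSpace Z] [Fintype Z]
  [MeasurableSingletonClass Z] {μ : Measure α} {ν : Measure β} [IsProbabilityMeasure μ]
  [IsProbabilityMeasure ν] {p : α × β × Z → ℝ}

/-- Conditional probabilities of the records sum to one, so the label keeps its original law.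
Almost-everywhere hypotheses suffice, which matters because times are positive only almost surely.
-/
lemma labelledLaw_preimage (hp : Measurable p) (h0 : ∀ a, ∀ᵐ b ∂ν, ∀ z, 0 ≤ p (a, b, z))
    (h1 : ∀ a, ∀ᵐ b ∂ν, ∑ z, p (a, b, z) = 1) {B : Set (α × β)} (hB : MeasurableSet B) :
    ((μ.prod (ν.prod Measure.count)).withDensity fun s => ENNReal.ofReal (p s))
      {s | (s.1, s.2.1) ∈ B} = (μ.prod ν) B := by
  have hm : Measurable fun s : α × β × Z => (s.1, s.2.1) := by fun_prop
  have hS : MeasurableSet {s : α × β × Z | (s.1, s.2.1) ∈ B} := hm hB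
  have hf : Measurable fun s : α × β × Z => ENNReal.ofReal (p s) := hp.ennreal_ofReal
  rw [withDensity_apply _ hS, ← lintegral_indicator hS, lintegral_prod _ (hf.indicator hS).aemeasurable,
    Measure.prod_apply hB]
  refine lintegral_congr fun a => ?_
  have hma : Measurable fun y : β × Z => (a, y) := by fun_prop
  have hi : AEMeasurable (fun y : β × Z => Set.indicator {s : α × β × Z | (s.1, s.2.1) ∈ B}
      (fun s => ENNReal.ofReal (p s)) (a, y)) (ν.prod Measure.count) :=
    ((hf.indicator hS).comp hma).aemeasurable
  rw [lintegral_prod _ hi, ← lintegral_indicator_one (measurable_prodMk_left hB)]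
  refine lintegral_congr_ae ?_
  filter_upwards [h0 a, h1 a] with b hb0 hb1
  rw [lintegral_count, tsum_fintype]
  by_cases hb : (a, b) ∈ B
  · have : ∀ z, Set.indicator {s : α × β × Z | (s.1, s.2.1) ∈ B}
        (fun s => ENNReal.ofReal (p s)) (a, b, z) = ENNReal.ofReal (p (a, b, z)) := fun z =>
      Set.indicator_of_mem (by exact hb) _
    simp only [this]
    rw [← ENNReal.ofReal_sum_of_nonneg fun z _ => hb0 z, hb1, ENNReal.ofReal_one,
      Set.indicator_of_mem (by exact hb)]
    rfl
  · have : ∀ z, Set.indicator {s : α × β × Z | (s.1, s.2.1) ∈ B}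
        (fun s => ENNReal.ofReal (p s)) (a, b, z) = 0 := fun z =>
      Set.indicator_of_notMem (by exact hb) _
    simp only [this, Finset.sum_const_zero]
    rw [Set.indicator_of_notMem (by exact hb)]

lemma isProbabilityMeasure_labelledLaw (hp : Measurable p)
    (h0 : ∀ a, ∀ᵐ b ∂ν, ∀ z, 0 ≤ p (a, b, z)) (h1 : ∀ a, ∀ᵐ b ∂ν, ∑ z, p (a, b, z) = 1) :
    IsProbabilityMeasure
      ((μ.prod (ν.prod Measure.count)).withDensity fun s => ENNReal.ofReal (p s)) := by
  constructor
  have h := labelledLaw_preimage (μ := μ) hp h0 h1 MeasurableSet.univ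
  simpa using h

/-- Conditional mean zero given the label integrates to zero. Integrability need not be checked,
since undefined integrals are zero by convention. -/
lemma integral_labelledLaw_eq_zero (hp : Measurable p)
    (h0 : ∀ a, ∀ᵐ b ∂ν, ∀ z, 0 ≤ p (a, b, z)) {g : α × β × Z → ℝ}
    (hg : ∀ a, ∀ᵐ b ∂ν, ∑ z, p (a, b, z) * g (a, b, z) = 0) :
    ∫ s, g s ∂((μ.prod (ν.prod Measure.count)).withDensity fun s => ENNReal.ofReal (p s)) = 0 := by
  rw [integral_withDensity_eq_integral_toReal_smul hp.ennreal_ofReal (by simp)]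
  by_cases hi : Integrable (fun s => (ENNReal.ofReal (p s)).toReal • g s)
      (μ.prod (ν.prod Measure.count))
  · rw [integral_prod _ hi]
    refine integral_eq_zero_of_ae (Eventually.of_forall fun a => ?_)
    by_cases hi' : Integrable (fun y : β × Z => (ENNReal.ofReal (p (a, y))).toReal • g (a, y))
        (ν.prod Measure.count)
    · simp only [Pi.zero_apply]
      rw [integral_prod _ hi']
      refine integral_eq_zero_of_ae ?_
      filter_upwards [h0 a, hg a] with b hb0 hb
      rw [integral_count, Pi.zero_apply, ← hb]
      refine Finset.sum_congr rfl fun z _ => ?_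
      rw [ENNReal.toReal_ofReal (hb0 z), smul_eq_mul]
    · simp only [Pi.zero_apply]
      rw [integral_undef hi']
  · rw [integral_undef hi]

end LabelledLaw

lemma ae_labelledLaw {α β Z : Type*} [MeasurableSpace α] [MeasurableSpace β] [MeasurableSpace Z]
    {μ : Measure α} {ν : Measure β} (p : α × β × Z → ℝ) {Q : β → Prop} (hQ : ∀ᵐ b ∂ν, Q b) :
    ∀ᵐ s ∂((μ.prod (ν.prod Measure.count)).withDensity fun s => ENNReal.ofReal (p s)), Q s.2.1 := by
  refine (withDensity_absolutelyContinuous _ _).ae_le ?_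
  have h1 : ∀ᵐ y ∂(ν.prod (Measure.count : Measure Z)), Q y.1 :=
    Measure.quasiMeasurePreserving_fst.ae hQ
  exact Measure.quasiMeasurePreserving_snd.ae h1

section Concentration

open ProbabilityTheory

variable {Ω : Type*} [MeasurableSpace Ω] {W N : ℕ}

/-- Hoeffding's inequality for the samples with label `w`. -/
lemma measure_pi_sum_deviation_le (ν : Fin W → Measure Ω) [∀ w, IsProbabilityMeasure (ν w)]
    (w : Fin W) {g : Ω → ℝ} (hg : Measurable g) {B κ : ℝ} (hB : 0 < B) (hκ : 0 ≤ κ)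
    (hgB : ∀ᵐ s ∂ν w, |g s| ≤ B) :
    Measure.pi (fun q : Fin W × Fin N => ν q.1)
      {s | N * (κ * B) < |∑ k, (g (s (w, k)) - ∫ u, g u ∂ν w)|} ≤
      ENNReal.ofReal (2 * Real.exp (-(N * κ ^ 2 / 2))) := by
  classical
  set P := Measure.pi (fun q : Fin W × Fin N => ν q.1)
  rcases Nat.eq_zero_or_pos N with rfl | hN
  · have : {s : Fin W × Fin 0 → Ω |
        ((0 : ℕ) : ℝ) * (κ * B) < |∑ k : Fin 0, (g (s (w, k)) - ∫ u, g u ∂ν w)|} = ∅ := by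
      ext s; simp
    rw [this, measure_empty]
    exact zero_le
  have key : ∀ h : Ω → ℝ, Measurable h → (∀ᵐ s ∂ν w, |h s| ≤ B) →
      P {s | N * (κ * B) ≤ ∑ k, (h (s (w, k)) - ∫ u, h u ∂ν w)} ≤
        ENNReal.ofReal (Real.exp (-(N * κ ^ 2 / 2))) := by
    intro h hh hhB
    have hind : iIndepFun (fun (k : Fin N) (s : Fin W × Fin N → Ω) =>
        h (s (w, k)) - ∫ u, h u ∂ν w) P :=
      (iIndepFun_pi (μ := fun q : Fin W × Fin N => ν q.1)
        (X := fun _ u => h u - ∫ u, h u ∂ν w)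
        fun q => (hh.sub_const _).aemeasurable).precomp (g := fun k : Fin N => (w, k))
          (fun k k' hk => (Prod.mk.inj hk).2)
    -- Values in `[-B, B]` give variance proxy `B ^ 2`, so a deviation of `N * (κ * B)` has exponent
    -- `N * κ ^ 2 / 2`, independent of `B`.
    have hsub : ∀ k ∈ (Finset.univ : Finset (Fin N)), HasSubgaussianMGF
        (fun s : Fin W × Fin N → Ω => h (s (w, k)) - ∫ u, h u ∂ν w) ((‖B - -B‖₊ / 2) ^ 2) P := by
      intro k _
      have h1 := hasSubgaussianMGF_of_mem_Icc (μ := ν w) (a := -B) (b := B) hh.aemeasurable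
        (hhB.mono fun s hs => abs_le.1 hs)
      have h2 := measurePreserving_eval (fun q : Fin W × Fin N => ν q.1) (w, k)
      refine HasSubgaussianMGF.of_map (Y := Function.eval (w, k)) (X := fun u => h u - ∫ u, h u ∂ν w)
        h2.measurable.aemeasurable ?_
      rw [h2.map_eq]
      exact h1
    have h3 := HasSubgaussianMGF.measure_sum_ge_le_of_iIndepFun hind hsub
      (ε := N * (κ * B)) (by positivity)
    rw [← ofReal_measureReal]
    refine ENNReal.ofReal_le_ofReal (h3.trans (le_of_eq ?_))
    congr 1
    have hN' : (0 : ℝ) < N := by exact_mod_cast hN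
    simp only [Finset.sum_const, Finset.card_univ, Fintype.card_fin, nsmul_eq_mul]
    push_cast
    rw [sub_neg_eq_add, Real.norm_of_nonneg (by positivity)]
    field_simp
    ring
  have h1 := key g hg hgB
  have h2 := key (fun s => -g s) hg.neg (by simpa using hgB)
  have hsubset : {s : Fin W × Fin N → Ω | N * (κ * B) < |∑ k, (g (s (w, k)) - ∫ u, g u ∂ν w)|} ⊆
      {s | N * (κ * B) ≤ ∑ k, (g (s (w, k)) - ∫ u, g u ∂ν w)} ∪
      {s | N * (κ * B) ≤ ∑ k, (-g (s (w, k)) - ∫ u, -g u ∂ν w)} := by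
    intro s hs
    change (N : ℝ) * (κ * B) < |∑ k, (g (s (w, k)) - ∫ u, g u ∂ν w)| at hs
    rcases lt_abs.1 hs with h | h
    · exact Or.inl h.le
    · right
      refine h.le.trans (le_of_eq ?_)
      rw [integral_neg, ← Finset.sum_neg_distrib]
      exact Finset.sum_congr rfl fun k _ => by ring
  refine (measure_mono hsubset).trans ((measure_union_le _ _).trans ((add_le_add h1 h2).trans ?_))
  rw [← ENNReal.ofReal_add (Real.exp_pos _).le (Real.exp_pos _).le, two_mul]

end Concentration

/-! ### The uniform distributions -/

section Uniform

/-- The uniform distribution on `[-1, 1]`. -/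
noncomputable def uniformIcc : Measure (Set.Icc (-1 : ℝ) 1) :=
  (2 : ℝ≥0∞)⁻¹ • (volume : Measure ℝ).comap (Subtype.val : Set.Icc (-1 : ℝ) 1 → ℝ)

lemma uniformIcc_apply (s : Set (Set.Icc (-1 : ℝ) 1)) :
    uniformIcc s = (2 : ℝ≥0∞)⁻¹ * volume (Subtype.val '' s) := by
  rw [uniformIcc, Measure.smul_apply, smul_eq_mul,
    (MeasurableEmbedding.subtype_coe measurableSet_Icc).comap_apply]

instance : IsProbabilityMeasure uniformIcc := by
  constructor
  rw [uniformIcc_apply, Set.image_univ, Subtype.range_coe, Real.volume_Icc]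
  norm_num
  exact ENNReal.inv_mul_cancel (by simp) (by simp)

lemma two_inv_mul_ofReal (x : ℝ) : (2 : ℝ≥0∞)⁻¹ * ENNReal.ofReal x = ENNReal.ofReal (x / 2) := by
  rw [ENNReal.ofReal_div_of_pos two_pos, ENNReal.ofReal_ofNat, mul_comm]
  rfl

/-- Near an endpoint part of the ball is cut off, but the half pointing towards the origin has
length `γ` and stays inside. -/
lemma le_uniformIcc_closedBall (y : Set.Icc (-1 : ℝ) 1) {γ : ℝ} (h0 : 0 ≤ γ) (h1 : γ ≤ 1) :
    ENNReal.ofReal (γ / 2) ≤ uniformIcc (Metric.closedBall y γ) := by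
  rw [uniformIcc_apply, ← two_inv_mul_ofReal]
  gcongr
  obtain ⟨y, hy1, hy2⟩ := y
  rcases le_total y 0 with hy | hy
  · calc ENNReal.ofReal γ = volume (Set.Icc y (y + γ)) := by rw [Real.volume_Icc]; congr 1; ring
      _ ≤ _ := by
        refine measure_mono fun z hz => ⟨⟨z, by linarith [hz.1], by linarith [hz.2]⟩, ?_, rfl⟩
        rw [Metric.mem_closedBall, Subtype.dist_eq, Real.dist_eq, abs_le]
        constructor <;> simp only <;> linarith [hz.1, hz.2]
  · calc ENNReal.ofReal γ = volume (Set.Icc (y - γ) y) := by rw [Real.volume_Icc]; congr 1; ring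
      _ ≤ _ := by
        refine measure_mono fun z hz => ⟨⟨z, by linarith [hz.1], by linarith [hz.2]⟩, ?_, rfl⟩
        rw [Metric.mem_closedBall, Subtype.dist_eq, Real.dist_eq, abs_le]
        constructor <;> simp only <;> linarith [hz.1, hz.2]

lemma volume_shell_le (c γ η : ℝ) :
    volume {u : ℝ | |(|c - u|) - γ| ≤ η} ≤ ENNReal.ofReal (4 * η) := by
  rcases lt_or_ge η 0 with hη | hη
  · have : {u : ℝ | |(|c - u|) - γ| ≤ η} = ∅ := by
      ext u
      simp only [Set.mem_ofPred_eq, Set.mem_empty_iff_false, iff_false, not_le]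
      exact hη.trans_le (abs_nonneg _)
    rw [this, measure_empty]
    exact zero_le
  have hsub : {u : ℝ | |(|c - u|) - γ| ≤ η} ⊆
      Set.Icc (c - γ - η) (c - γ + η) ∪ Set.Icc (c + γ - η) (c + γ + η) := by
    intro u hu
    change |(|c - u|) - γ| ≤ η at hu
    rw [abs_le] at hu
    rcases abs_cases (c - u) with ⟨h, -⟩ | ⟨h, -⟩
    · left; constructor <;> linarith [hu.1, hu.2]
    · right; constructor <;> linarith [hu.1, hu.2]
  refine (measure_mono hsub).trans ((measure_union_le _ _).trans ?_)
  rw [Real.volume_Icc, Real.volume_Icc, ← ENNReal.ofReal_add (by linarith) (by linarith)]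
  exact ENNReal.ofReal_le_ofReal (by linarith)

lemma uniformIcc_shell_le (c γ η : ℝ) :
    uniformIcc {u | |(|c - (u : ℝ)|) - γ| ≤ η} ≤ ENNReal.ofReal (2 * η) := by
  rw [uniformIcc_apply, show 2 * η = (4 * η) / 2 by ring, ← two_inv_mul_ofReal]
  gcongr
  refine (measure_mono ?_).trans (volume_shell_le c γ η)
  rintro _ ⟨u, hu, rfl⟩
  exact hu

lemma uniformTime_apply {tmax : ℝ} {s : Set ℝ} (hs : MeasurableSet s) :
    uniformTime tmax s = (ENNReal.ofReal tmax)⁻¹ * volume (s ∩ Set.Icc 0 tmax) := by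
  rw [uniformTime, Measure.smul_apply, smul_eq_mul, Measure.restrict_apply hs]

lemma isProbabilityMeasure_uniformTime {tmax : ℝ} (h : 0 < tmax) :
    IsProbabilityMeasure (uniformTime tmax) := by
  constructor
  rw [uniformTime_apply MeasurableSet.univ, Set.univ_inter, Real.volume_Icc, sub_zero]
  exact ENNReal.inv_mul_cancel (by simpa using h) ENNReal.ofReal_ne_top

lemma inv_ofReal_mul_ofReal {t : ℝ} (h : 0 < t) (x : ℝ) :
    (ENNReal.ofReal t)⁻¹ * ENNReal.ofReal x = ENNReal.ofReal (x / t) := by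
  rw [ENNReal.ofReal_div_of_pos h, mul_comm]
  rfl

lemma measurableSet_window (t γ : ℝ) : MeasurableSet {τ : ℝ | |t - τ| ≤ γ} :=
  measurableSet_le (by fun_prop) measurable_const

lemma le_uniformTime_window {tmax t γ : ℝ} (h : 0 < tmax) (ht : t ∈ Set.Icc 0 tmax) (h0 : 0 ≤ γ)
    (h1 : γ ≤ tmax / 2) : ENNReal.ofReal (γ / tmax) ≤ uniformTime tmax {τ | |t - τ| ≤ γ} := by
  rw [uniformTime_apply (measurableSet_window t γ), ← inv_ofReal_mul_ofReal h]
  gcongr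
  rcases le_total t (tmax / 2) with hy | hy
  · calc ENNReal.ofReal γ = volume (Set.Icc t (t + γ)) := by rw [Real.volume_Icc]; congr 1; ring
      _ ≤ _ := by
        refine measure_mono fun z hz => ⟨show |t - z| ≤ γ from abs_le.2 ⟨?_, ?_⟩, ?_, ?_⟩ <;>
          linarith [hz.1, hz.2, ht.1, ht.2]
  · calc ENNReal.ofReal γ = volume (Set.Icc (t - γ) t) := by rw [Real.volume_Icc]; congr 1; ring
      _ ≤ _ := by
        refine measure_mono fun z hz => ⟨show |t - z| ≤ γ from abs_le.2 ⟨?_, ?_⟩, ?_, ?_⟩ <;>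
          linarith [hz.1, hz.2, ht.1, ht.2]

lemma measurableSet_shell (c γ η : ℝ) : MeasurableSet {u : ℝ | |(|c - u|) - γ| ≤ η} :=
  measurableSet_le (by fun_prop) measurable_const

lemma uniformTime_shell_le {tmax : ℝ} (h : 0 < tmax) (c γ η : ℝ) :
    uniformTime tmax {τ | |(|c - τ|) - γ| ≤ η} ≤ ENNReal.ofReal (4 * η / tmax) := by
  rw [uniformTime_apply (measurableSet_shell c γ η), ← inv_ofReal_mul_ofReal h]
  gcongr
  exact (measure_mono Set.inter_subset_left).trans (volume_shell_le c γ η)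

lemma ae_uniformTime (tmax : ℝ) : ∀ᵐ τ ∂uniformTime tmax, τ ∈ Set.Icc 0 tmax :=
  Measure.ae_smul_measure (ae_restrict_mem measurableSet_Icc) _

variable {D L ℓ : ℕ}

lemma uniformParam_eq : uniformParam D L ℓ = Measure.pi fun _ => Measure.pi fun _ => uniformIcc :=
  rfl

instance : IsProbabilityMeasure (uniformParam D L ℓ) := by
  rw [uniformParam_eq]; infer_instance

lemma le_uniformParam_window (F : Finset (Site D L)) (x : Param D L ℓ) {γ : ℝ} (h0 : 0 ≤ γ)
    (h1 : γ ≤ 1) :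
    ENNReal.ofReal ((γ / 2) ^ (ℓ * F.card)) ≤
      uniformParam D L ℓ {y | ∀ j ∈ F, dist (x j) (y j) ≤ γ} := by
  classical
  have e : {y : Param D L ℓ | ∀ j ∈ F, dist (x j) (y j) ≤ γ} =
      Set.pi Set.univ fun j => if j ∈ F then Metric.closedBall (x j) γ else Set.univ := by
    ext y
    simp only [Set.mem_ofPred_eq, Set.mem_pi, Set.mem_univ, true_imp_iff]
    refine forall_congr' fun j => ?_
    by_cases hj : j ∈ F
    · simp [hj, dist_comm]
    · simp [hj]
  have h2 : ∀ j, ENNReal.ofReal ((γ / 2) ^ ℓ) ≤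
      (Measure.pi fun _ : Fin ℓ => uniformIcc) (Metric.closedBall (x j) γ) := by
    intro j
    rw [closedBall_pi _ h0, Measure.pi_pi, ENNReal.ofReal_pow (by positivity)]
    calc ENNReal.ofReal (γ / 2) ^ ℓ = ∏ _i : Fin ℓ, ENNReal.ofReal (γ / 2) := by simp
      _ ≤ _ := Finset.prod_le_prod' fun i _ => le_uniformIcc_closedBall (x j i) h0 h1
  rw [e, uniformParam_eq, Measure.pi_pi, pow_mul, ENNReal.ofReal_pow (by positivity)]
  calc ENNReal.ofReal ((γ / 2) ^ ℓ) ^ F.card = ∏ _j ∈ F, ENNReal.ofReal ((γ / 2) ^ ℓ) := by simp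
    _ ≤ ∏ j ∈ F, (Measure.pi fun _ : Fin ℓ => uniformIcc)
        (if j ∈ F then Metric.closedBall (x j) γ else Set.univ) :=
      Finset.prod_le_prod' fun j hj => by rw [if_pos hj]; exact h2 j
    _ = _ := Finset.prod_subset (Finset.subset_univ F) fun j _ hj => by
      rw [if_neg hj, measure_univ]

lemma uniformParam_shell_le (j : Site D L) (i : Fin ℓ) (c γ η : ℝ) :
    uniformParam D L ℓ {y | |(|c - (y j i : ℝ)|) - γ| ≤ η} ≤ ENNReal.ofReal (2 * η) := by
  have h1 := measurePreserving_eval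
    (fun _ : Site D L => Measure.pi fun _ : Fin ℓ => uniformIcc) j
  have h2 := (measurePreserving_eval (fun _ : Fin ℓ => uniformIcc) i).comp h1
  have hm : MeasurableSet {u : Set.Icc (-1 : ℝ) 1 | |(|c - (u : ℝ)|) - γ| ≤ η} :=
    measurable_subtype_coe (measurableSet_shell c γ η)
  refine le_trans (le_of_eq ?_) (uniformIcc_shell_le c γ η)
  exact h2.measure_preimage hm.nullMeasurableSet

/-- The samples close to `(x, t)`. -/
def windowSet (F : Finset (Site D L)) (γ : ℝ) (x : Param D L ℓ) (t : ℝ) :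
    Set (Param D L ℓ × ℝ) :=
  {y | (∀ j ∈ F, dist (x j) (y.1 j) ≤ γ) ∧ |t - y.2| ≤ γ}

/-- The samples close to the boundary of the window around `(x, t)`. -/
def shellSet (F : Finset (Site D L)) (γ η η' : ℝ) (x : Param D L ℓ) (t : ℝ) :
    Set (Param D L ℓ × ℝ) :=
  {y | (∃ j ∈ F, ∃ i, |(|(x j i : ℝ) - y.1 j i|) - γ| ≤ η) ∨ |(|t - y.2|) - γ| ≤ η'}

lemma measurableSet_windowParam (F : Finset (Site D L)) (γ : ℝ) (x : Param D L ℓ) :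
    MeasurableSet {y : Param D L ℓ | ∀ j ∈ F, dist (x j) (y j) ≤ γ} := by
  have : {y : Param D L ℓ | ∀ j ∈ F, dist (x j) (y j) ≤ γ} =
      ⋂ j ∈ F, {y | dist (x j) (y j) ≤ γ} := by
    ext; simp
  rw [this]
  refine Finset.measurableSet_biInter _ fun j _ => ?_
  exact (isClosed_le (by fun_prop) continuous_const).measurableSet

lemma measurableSet_windowSet (F : Finset (Site D L)) (γ : ℝ) (x : Param D L ℓ) (t : ℝ) :
    MeasurableSet (windowSet F γ x t) :=
  (measurable_fst (measurableSet_windowParam F γ x)).inter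
    (measurable_snd (measurableSet_window t γ))

lemma measurableSet_shellSet (F : Finset (Site D L)) (γ η η' : ℝ) (x : Param D L ℓ) (t : ℝ) :
    MeasurableSet (shellSet F γ η η' x t) := by
  have : shellSet F γ η η' x t =
      (⋃ j ∈ F, ⋃ i, {y | |(|(x j i : ℝ) - y.1 j i|) - γ| ≤ η}) ∪ {y | |(|t - y.2|) - γ| ≤ η'} := by
    ext; simp [shellSet]
  rw [this]
  refine (Finset.measurableSet_biUnion _ fun j _ => MeasurableSet.iUnion fun i => ?_).union ?_
  · exact (isClosed_le (by fun_prop) continuous_const).measurableSet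
  · exact measurable_snd (measurableSet_shell t γ η')

lemma le_measure_windowSet (F : Finset (Site D L)) (x : Param D L ℓ) {γ t tmax : ℝ} (h0 : 0 ≤ γ)
    (h1 : γ ≤ 1) (h : 0 < tmax) (ht : t ∈ Set.Icc 0 tmax) (h2 : γ ≤ tmax / 2) :
    ENNReal.ofReal ((γ / 2) ^ (ℓ * F.card) * (γ / tmax)) ≤
      ((uniformParam D L ℓ).prod (uniformTime tmax)) (windowSet F γ x t) := by
  have := isProbabilityMeasure_uniformTime h
  have e : windowSet F γ x t =
      {y : Param D L ℓ | ∀ j ∈ F, dist (x j) (y j) ≤ γ} ×ˢ {τ | |t - τ| ≤ γ} := by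
    ext; rfl
  rw [e, Measure.prod_prod, ENNReal.ofReal_mul (by positivity)]
  exact mul_le_mul' (le_uniformParam_window F x h0 h1) (le_uniformTime_window h ht h0 h2)

lemma measure_shellSet_le (F : Finset (Site D L)) (x : Param D L ℓ) {γ η η' t tmax : ℝ}
    (h : 0 < tmax) (hη : 0 ≤ η) (hη' : 0 ≤ η') :
    ((uniformParam D L ℓ).prod (uniformTime tmax)) (shellSet F γ η η' x t) ≤
      ENNReal.ofReal (ℓ * F.card * (2 * η) + 4 * η' / tmax) := by
  have := isProbabilityMeasure_uniformTime h
  set P := (uniformParam D L ℓ).prod (uniformTime tmax)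
  have hsub : shellSet F γ η η' x t ⊆
      (⋃ j ∈ F, ⋃ i, {y | |(|(x j i : ℝ) - y.1 j i|) - γ| ≤ η}) ∪ {y | |(|t - y.2|) - γ| ≤ η'} := by
    intro y hy
    simpa [shellSet] using hy
  have h1 : ∀ j i, P {y | |(|(x j i : ℝ) - y.1 j i|) - γ| ≤ η} ≤ ENNReal.ofReal (2 * η) := by
    intro j i
    have e : {y : Param D L ℓ × ℝ | |(|(x j i : ℝ) - y.1 j i|) - γ| ≤ η} =
        {y : Param D L ℓ | |(|(x j i : ℝ) - y j i|) - γ| ≤ η} ×ˢ Set.univ := by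
      ext; simp
    rw [e, Measure.prod_prod, measure_univ, mul_one]
    exact uniformParam_shell_le j i _ γ η
  have h2 : P {y | |(|t - y.2|) - γ| ≤ η'} ≤ ENNReal.ofReal (4 * η' / tmax) := by
    have e : {y : Param D L ℓ × ℝ | |(|t - y.2|) - γ| ≤ η'} =
        Set.univ ×ˢ {τ | |(|t - τ|) - γ| ≤ η'} := by
      ext; simp
    rw [e, Measure.prod_prod, measure_univ, one_mul]
    exact uniformTime_shell_le h t γ η'
  refine (measure_mono hsub).trans ((measure_union_le _ _).trans ?_)
  rw [ENNReal.ofReal_add (by positivity) (by positivity)]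
  refine add_le_add ?_ h2
  refine (measure_biUnion_finset_le _ _).trans ?_
  calc _ ≤ ∑ _j ∈ F, ∑ _i : Fin ℓ, ENNReal.ofReal (2 * η) := by
        refine Finset.sum_le_sum fun j _ => (measure_iUnion_fintype_le _ _).trans ?_
        exact Finset.sum_le_sum fun i _ => h1 j i
    _ = ENNReal.ofReal (ℓ * F.card * (2 * η)) := by
        simp only [Finset.sum_const, Finset.card_univ, Fintype.card_fin, nsmul_eq_mul]
        rw [mul_comm (ℓ : ℝ), mul_assoc, ENNReal.ofReal_mul (Nat.cast_nonneg F.card),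
          ENNReal.ofReal_mul (Nat.cast_nonneg ℓ), ENNReal.ofReal_natCast, ENNReal.ofReal_natCast]

/-- Away from the shell, membership in the window is stable under small displacements. -/
lemma mem_windowSet_iff_of_notMem_shellSet {F : Finset (Site D L)} {γ η η' : ℝ}
    {x x' : Param D L ℓ} {t t' : ℝ} (hx : ∀ j ∈ F, ∀ i, |(x j i : ℝ) - x' j i| ≤ η)
    (ht : |t - t'| ≤ η') (hγ : 0 ≤ γ) {y : Param D L ℓ × ℝ} (hy : y ∉ shellSet F γ η η' x' t') :
    y ∈ windowSet F γ x t ↔ y ∈ windowSet F γ x' t' := by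
  have key : ∀ {u u' v e : ℝ}, |u - u'| ≤ e → ¬ |(|u' - v|) - γ| ≤ e →
      (|u - v| ≤ γ ↔ |u' - v| ≤ γ) := by
    intro u u' v e h1 h2
    have h3 : |(|u - v|) - (|u' - v|)| ≤ e := by
      refine (abs_abs_sub_abs_le_abs_sub _ _).trans ?_
      rwa [sub_sub_sub_cancel_right]
    rw [abs_le] at h3
    rw [not_le, lt_abs] at h2
    constructor
    · intro h4
      by_contra h5
      rcases h2 with h2 | h2 <;> linarith [h3.1, h3.2]
    · intro h4
      rcases h2 with h2 | h2 <;> linarith [h3.1, h3.2]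
  simp only [shellSet, Set.mem_ofPred_eq, not_or, not_exists, not_and] at hy
  simp only [windowSet, Set.mem_ofPred_eq, dist_pi_le_iff hγ, Subtype.dist_eq, Real.dist_eq]
  refine and_congr (forall_congr' fun j => forall_congr' fun hj => forall_congr' fun i => ?_) ?_
  · exact key (hx j hj i) (hy.1 j hj i)
  · exact key ht hy.2

/-- The points of an equidistant grid on `[-1, 1]`. -/
noncomputable def gridPoint (m : ℕ) (q : Fin (m + 1)) : Set.Icc (-1 : ℝ) 1 :=
  Set.projIcc (-1) 1 (by norm_num) (2 * (q / m : ℝ) - 1)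

lemma exists_grid {m : ℕ} (hm : 0 < m) {u : ℝ} (h0 : 0 ≤ u) (h1 : u ≤ 1) :
    ∃ q : Fin (m + 1), |u - (q / m : ℝ)| ≤ 1 / m := by
  have hm' : (0 : ℝ) < m := by exact_mod_cast hm
  have h2 : ⌊u * m⌋₊ < m + 1 := by
    rw [Nat.lt_succ_iff]
    exact Nat.floor_le_of_le (by nlinarith)
  refine ⟨⟨⌊u * m⌋₊, h2⟩, ?_⟩
  have h3 := Nat.floor_le (show 0 ≤ u * m by positivity)
  have h4 := (Nat.lt_floor_add_one (u * m)).le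
  have e : u - (⌊u * m⌋₊ : ℝ) / m = (u * m - ⌊u * m⌋₊) / m := by field_simp
  simp only
  rw [e, abs_of_nonneg (div_nonneg (by linarith) hm'.le)]
  gcongr
  linarith

lemma exists_gridPoint {m : ℕ} (hm : 0 < m) (y : Set.Icc (-1 : ℝ) 1) :
    ∃ q, |(y : ℝ) - gridPoint m q| ≤ 2 / m := by
  obtain ⟨y, hy1, hy2⟩ := y
  have hm' : (0 : ℝ) < m := by exact_mod_cast hm
  obtain ⟨q, hq⟩ := exists_grid hm (u := (y + 1) / 2) (by linarith) (by linarith)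
  refine ⟨q, ?_⟩
  have h1 : (0 : ℝ) ≤ q / m := by positivity
  have h2 : (q / m : ℝ) ≤ 1 := by
    rw [div_le_one hm']; exact_mod_cast Nat.lt_succ_iff.1 q.2
  have h3 : (gridPoint m q : ℝ) = 2 * (q / m : ℝ) - 1 := by
    rw [gridPoint, Set.projIcc_of_mem _ ⟨by linarith, by linarith⟩]
  rw [h3]
  have e : y - (2 * (q / m : ℝ) - 1) = 2 * ((y + 1) / 2 - q / m) := by ring
  simp only
  rw [e, abs_mul, abs_two]
  calc _ ≤ 2 * (1 / (m : ℝ)) := by gcongr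
    _ = _ := by ring

end Uniform

/-! ### Accuracy of the aggregated shadows -/

section Averages

/-- The average over `Γ` is close to `f` if it is compared with a set `Γ'` on which the
fluctuations are controlled and which differs from `Γ` only within a small set `Sh`. -/
lemma abs_average_sub_le {N : ℕ} {Γ Γ' Sh : Finset (Fin N)} {Y F : Fin N → ℝ} {f p κ B ε₁ : ℝ}
    (hΓ : ∀ k, k ∉ Sh → (k ∈ Γ ↔ k ∈ Γ')) (hYF : ∀ k, |Y k - F k| ≤ B)
    (hF : ∀ k ∈ Γ, |F k - f| ≤ ε₁) (hcard : N * (p - κ) ≤ Γ'.card)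
    (hsum : |∑ k ∈ Γ', (Y k - F k)| ≤ N * (κ * B)) (hSh : (Sh.card : ℝ) ≤ N * (2 * κ))
    (hN : 0 < N) (hB : 0 ≤ B) (h3 : 3 * κ < p) :
    |(Γ.card : ℝ)⁻¹ * ∑ k ∈ Γ, Y k - f| ≤ ε₁ + 3 * κ * B / (p - 3 * κ) := by
  classical
  have hN' : (0 : ℝ) < N := by exact_mod_cast hN
  have hκ : 0 ≤ κ := by
    have : (0 : ℝ) ≤ N * (2 * κ) := (Nat.cast_nonneg _).trans hSh
    nlinarith
  have hc : (Γ'.card : ℝ) ≤ Γ.card + Sh.card := by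
    have : Γ' ⊆ Γ ∪ Sh := fun k hk => by
      by_cases hs : k ∈ Sh
      · exact Finset.mem_union_right _ hs
      · exact Finset.mem_union_left _ ((hΓ k hs).2 hk)
    exact_mod_cast (Finset.card_le_card this).trans (Finset.card_union_le _ _)
  -- One `κ` is the deviation of the count of `Γ'`; the other two are the samples lost to the shell.
  have hlow : N * (p - 3 * κ) ≤ Γ.card := by linarith
  have hpos : 0 < N * (p - 3 * κ) := mul_pos hN' (by linarith)
  have hg : (0 : ℝ) < Γ.card := hpos.trans_le hlow
  -- Outside the shell the two sums have the same terms, and each term inside is at most `B`.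
  have hd : |∑ k ∈ Γ, (Y k - F k) - ∑ k ∈ Γ', (Y k - F k)| ≤ N * (2 * κ) * B := by
    have e : ∑ k ∈ Γ, (Y k - F k) - ∑ k ∈ Γ', (Y k - F k) =
        ∑ k ∈ Sh, ((if k ∈ Γ then Y k - F k else 0) - (if k ∈ Γ' then Y k - F k else 0)) := by
      rw [Finset.sum_subset (Finset.subset_univ Sh)]
      · simp only [Finset.sum_sub_distrib, Finset.sum_ite_mem, Finset.univ_inter]
      · intro k _ hk
        simp [hΓ k hk]
    rw [e]
    calc _ ≤ ∑ _k ∈ Sh, B := by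
          refine (Finset.abs_sum_le_sum_abs _ _).trans (Finset.sum_le_sum fun k _ => ?_)
          have := hYF k
          split_ifs <;> simp [hB, this]
          rwa [abs_sub_comm]
      _ = Sh.card * B := by simp
      _ ≤ _ := by gcongr
  have h1 : |∑ k ∈ Γ, (Y k - F k)| ≤ N * (3 * κ * B) := by
    have := abs_add_le (∑ k ∈ Γ, (Y k - F k) - ∑ k ∈ Γ', (Y k - F k)) (∑ k ∈ Γ', (Y k - F k))
    rw [sub_add_cancel] at this
    linarith
  have h2 : |∑ k ∈ Γ, (F k - f)| ≤ Γ.card * ε₁ := by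
    calc _ ≤ ∑ _k ∈ Γ, ε₁ :=
          (Finset.abs_sum_le_sum_abs _ _).trans (Finset.sum_le_sum hF)
      _ = _ := by simp
  have e : (Γ.card : ℝ)⁻¹ * ∑ k ∈ Γ, Y k - f =
      (∑ k ∈ Γ, (Y k - F k) + ∑ k ∈ Γ, (F k - f)) / Γ.card := by
    simp only [Finset.sum_sub_distrib, Finset.sum_const, nsmul_eq_mul]
    field_simp
    ring
  rw [e, abs_div, abs_of_pos hg]
  calc _ ≤ (N * (3 * κ * B) + Γ.card * ε₁) / Γ.card := by
        gcongr
        exact (abs_add_le _ _).trans (add_le_add h1 h2)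
    _ = ε₁ + N * (3 * κ * B) / Γ.card := by field_simp; ring
    _ ≤ ε₁ + N * (3 * κ * B) / (N * (p - 3 * κ)) := by gcongr
    _ = _ := by rw [mul_div_mul_left _ _ hN'.ne']

/-- The fraction of the samples that fall into a set. -/
lemma measure_pi_card_deviation_le {Ω : Type*} [MeasurableSpace Ω] {W N : ℕ}
    (ν : Fin W → Measure Ω) [∀ w, IsProbabilityMeasure (ν w)] (w : Fin W) {G : Set Ω}
    (hG : MeasurableSet G) [DecidablePred (· ∈ G)] {κ : ℝ} (hκ : 0 ≤ κ) :
    Measure.pi (fun q : Fin W × Fin N => ν q.1)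
      {s | N * κ < |((Finset.univ.filter fun k => s (w, k) ∈ G).card : ℝ) -
        N * (ν w).real G|} ≤ ENNReal.ofReal (2 * Real.exp (-(N * κ ^ 2 / 2))) := by
  refine le_trans (le_of_eq ?_) (measure_pi_sum_deviation_le ν w (g := G.indicator 1)
    (measurable_one.indicator hG) one_pos hκ (Eventually.of_forall fun s => ?_))
  · congr 1
    ext s
    simp only [Set.mem_ofPred_eq, mul_one]
    rw [Finset.sum_sub_distrib, integral_indicator_one hG]
    simp [Set.indicator_apply]
  · by_cases hs : s ∈ G <;> simp [hs]

end Averages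

/-! ### Measurability and conditional unbiasedness of one labelled sample -/

section SingleRegion

open scoped Matrix.Norms.L2Operator

variable {D L : ℕ} {a : Site D L → ℕ} {c : PhaseConstants} {b : Boundary} {ℓ W : ℕ}
  {T : Site D L → (Fin ℓ → Set.Icc (-1 : ℝ) 1) → SuperOp a} {ρs : SysOp D L} {ω : Fin W → AncOp a}

lemma IsLindbladianPhase.continuous_heisL (h : IsLindbladianPhase c b a T ρs ω) (j : Site D L) :
    Continuous fun y => heisL (T j y) := by
  refine (LipschitzWith.of_dist_le_mul (K := Real.toNNReal |c.lip|) fun y y' => ?_).continuous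
  rw [dist_eq_norm, ← heisL_sub, Real.coe_toNNReal _ (abs_nonneg _)]
  refine (h.lipschitz j y y').norm_heisL_le.trans (le_of_eq ?_)
  rw [abs_mul, abs_of_nonneg (dist_nonneg (x := y) (y := y'))]

lemma IsLindbladianPhase.continuous_trace (h : IsLindbladianPhase c b a T ρs ω) (w : Fin W)
    (B : FullOp a) :
    Continuous fun y : Param D L ℓ × ℝ => (B * phaseState T ρs (ω w) y.1 y.2).trace := by
  have h1 : Continuous fun y : Param D L ℓ × ℝ => semi (heisL (∑ j, T j (y.1 j))) y.2 := by
    let _ : NormedAlgebra ℚ (FullOp a →L[ℂ] FullOp a) := NormedAlgebra.restrictScalars ℚ ℂ _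
    simp only [heisL_sum, semi]
    refine NormedSpace.exp_continuous.comp (continuous_snd.smul ?_)
    refine continuous_finsetSum _ fun j _ => (h.continuous_heisL j).comp ?_
    exact (continuous_apply j).comp continuous_fst
  simp only [phaseState, trace_mul_evolve]
  exact Continuous.matrix_trace ((h1.clm_apply continuous_const).matrix_mul continuous_const)

lemma IsLindbladianPhase.measurable_trace (h : IsLindbladianPhase c b a T ρs ω) (w : Fin W)
    (B : FullOp a) :
    Measurable fun y : Param D L ℓ × ℝ => (B * phaseState T ρs (ω w) y.1 y.2).trace.re :=
  Continuous.measurable (Complex.continuous_re.comp (h.continuous_trace w B))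

lemma measurable_sample {G : Param D L ℓ × ℝ → Record D L → ℝ}
    (hG : ∀ z, Measurable fun y => G y z) :
    Measurable fun s : Sample D L ℓ => G (s.1, s.2.1) s.2.2 := by
  have h1 : Measurable fun s : (Param D L ℓ × ℝ) × Record D L => G s.1 s.2 :=
    measurable_from_prod_countable_left hG
  have h2 : Measurable fun s : Sample D L ℓ => ((s.1, s.2.1), s.2.2) := by fun_prop
  exact h1.comp h2

lemma IsLindbladianPhase.measurable_recordProb (h : IsLindbladianPhase c b a T ρs ω) (w : Fin W) :
    Measurable fun s : Sample D L ℓ =>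
      recordProb (traceSnd (phaseState T ρs (ω w) s.1 s.2.1)) s.2.2 := by
  refine measurable_sample
    (G := fun y z => recordProb (traceSnd (phaseState T ρs (ω w) y.1 y.2)) z) fun z => ?_
  simp only [recordProb, ← trace_kronecker_one_mul]
  exact measurable_const.mul
    (h.measurable_trace w (productOp (fun j => pauliProj (z j)) ⊗ₖ (1 : AncOp a)))

lemma IsLindbladianPhase.isState (h : IsLindbladianPhase c b a T ρs ω) (w : Fin W) :
    IsState (ρs ⊗ₖ ω w) :=
  isState_kronecker h.reference_state (h.auxiliary_state w)

lemma IsLindbladianPhase.phaseState_isHermitian (h : IsLindbladianPhase c b a T ρs ω) (w : Fin W)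
    (x : Param D L ℓ) (t : ℝ) : (phaseState T ρs (ω w) x t).IsHermitian :=
  (h.local_terms x).evolve_isHermitian (h.isState w).1.1 t

lemma IsLindbladianPhase.recordProb_nonneg (h : IsLindbladianPhase c b a T ρs ω) (w : Fin W)
    (x : Param D L ℓ) {t : ℝ} (ht : 0 ≤ t) (z : Record D L) :
    0 ≤ recordProb (traceSnd (phaseState T ρs (ω w) x t)) z :=
  (h.local_terms x).recordProb_nonneg (h.isState w) ht z

lemma IsLindbladianPhase.sum_recordProb (h : IsLindbladianPhase c b a T ρs ω) (w : Fin W)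
    (x : Param D L ℓ) {t : ℝ} (ht : 0 ≤ t) :
    ∑ z, recordProb (traceSnd (phaseState T ρs (ω w) x t)) z = 1 :=
  _root_.sum_recordProb (traceSnd_isHermitian (h.phaseState_isHermitian w x t))
    ((traceSnd_trace _).trans ((h.local_terms x).trace_evolve (h.isState w) ht))

lemma IsLindbladianPhase.isProbabilityMeasure_sampleLaw (h : IsLindbladianPhase c b a T ρs ω)
    (w : Fin W) {tmax : ℝ} (htmax : 0 < tmax) :
    IsProbabilityMeasure (sampleLaw T ρs (ω w) tmax) := by
  have := isProbabilityMeasure_uniformTime htmax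
  refine isProbabilityMeasure_labelledLaw (h.measurable_recordProb w) (fun x => ?_) fun x => ?_
  · filter_upwards [ae_uniformTime tmax] with t ht z using h.recordProb_nonneg w x ht.1 z
  · filter_upwards [ae_uniformTime tmax] with t ht using h.sum_recordProb w x ht.1

lemma IsLindbladianPhase.sampleLaw_preimage (h : IsLindbladianPhase c b a T ρs ω)
    (w : Fin W) {tmax : ℝ} (htmax : 0 < tmax) {B : Set (Param D L ℓ × ℝ)} (hB : MeasurableSet B) :
    (sampleLaw T ρs (ω w) tmax) {s | (s.1, s.2.1) ∈ B} =
      ((uniformParam D L ℓ).prod (uniformTime tmax)) B := by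
  have := isProbabilityMeasure_uniformTime htmax
  refine labelledLaw_preimage (h.measurable_recordProb w) (fun x => ?_) (fun x => ?_) hB
  · filter_upwards [ae_uniformTime tmax] with t ht z using h.recordProb_nonneg w x ht.1 z
  · filter_upwards [ae_uniformTime tmax] with t ht using h.sum_recordProb w x ht.1

lemma ae_sampleLaw (η : AncOp a) (tmax : ℝ) :
    ∀ᵐ s ∂sampleLaw T ρs η tmax, s.2.1 ∈ Set.Icc 0 tmax :=
  ae_labelledLaw _ (ae_uniformTime tmax)

/-- The error of a single-copy shadow as an estimate of the expectation value at its own label. -/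
noncomputable def shadowError (T : Site D L → (Fin ℓ → Set.Icc (-1 : ℝ) 1) → SuperOp a)
    (ρs : SysOp D L) (η : AncOp a) (A : Finset (Site D L)) (O : RegionOp A) (s : Sample D L ℓ) : ℝ :=
  (O * reduceTo A (shadow s.2.2)).trace.re -
    (embedHom A a O * phaseState T ρs η s.1 s.2.1).trace.re

lemma IsLindbladianPhase.measurable_shadowError (h : IsLindbladianPhase c b a T ρs ω) (w : Fin W)
    (A : Finset (Site D L)) (O : RegionOp A) : Measurable (shadowError T ρs (ω w) A O) :=
  measurable_sample (G := fun y z => (O * reduceTo A (shadow z)).trace.re -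
    (embedHom A a O * phaseState T ρs (ω w) y.1 y.2).trace.re) fun _ =>
      measurable_const.sub (h.measurable_trace w (embedHom A a O))

lemma IsLindbladianPhase.abs_shadowError_le (h : IsLindbladianPhase c b a T ρs ω) (w : Fin W)
    {A : Finset (Site D L)} {O : RegionOp A} (hO : ‖O‖ ≤ 1) {s : Sample D L ℓ} (hs : 0 ≤ s.2.1) :
    |shadowError T ρs (ω w) A O s| ≤ 8 ^ A.card + 1 := by
  refine (abs_sub _ _).trans (add_le_add ?_ ?_)
  · refine (Complex.abs_re_le_norm _).trans ((norm_trace_reduceTo_shadow_le A O _).trans ?_)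
    exact mul_le_of_le_one_left (by positivity) hO
  · refine (Complex.abs_re_le_norm _).trans ?_
    exact ((h.local_terms s.1).norm_trace_mul_evolve_le (h.isState w) hs _).trans
      ((norm_embedHom_le A O).trans hO)

lemma IsLindbladianPhase.sum_recordProb_mul_shadowError (h : IsLindbladianPhase c b a T ρs ω)
    (w : Fin W) (A : Finset (Site D L)) (O : RegionOp A) (x : Param D L ℓ) {t : ℝ} (ht : 0 ≤ t) :
    ∑ z, recordProb (traceSnd (phaseState T ρs (ω w) x t)) z *
      shadowError T ρs (ω w) A O (x, t, z) = 0 := by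
  simp only [shadowError, mul_sub, Finset.sum_sub_distrib, ← Finset.sum_mul,
    h.sum_recordProb w x ht, one_mul]
  simp only [← trace_embedOp_mul]
  rw [sum_recordProb_mul_re_trace (traceSnd_isHermitian (h.phaseState_isHermitian w x t)),
    trace_embedOp_mul, trace_embedHom_mul, sub_self]

/-- The error is centred at every label of nonnegative time, so it stays centred after restriction
to any set of labels. This is what lets a sum over the samples in a window be treated by Hoeffding's
inequality. -/
lemma IsLindbladianPhase.integral_indicator_shadowError (h : IsLindbladianPhase c b a T ρs ω)
    (w : Fin W) (A : Finset (Site D L)) (O : RegionOp A) {tmax : ℝ} (htmax : 0 < tmax)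
    (B : Set (Param D L ℓ × ℝ)) :
    ∫ s, Set.indicator {s : Sample D L ℓ | (s.1, s.2.1) ∈ B} (shadowError T ρs (ω w) A O) s
      ∂sampleLaw T ρs (ω w) tmax = 0 := by
  have := isProbabilityMeasure_uniformTime htmax
  refine integral_labelledLaw_eq_zero (h.measurable_recordProb w) (fun x => ?_) (fun x => ?_)
  · filter_upwards [ae_uniformTime tmax] with t ht z using h.recordProb_nonneg w x ht.1 z
  · filter_upwards [ae_uniformTime tmax] with t ht
    by_cases hB : (x, t) ∈ B
    · have : ∀ z, Set.indicator {s : Sample D L ℓ | (s.1, s.2.1) ∈ B}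
          (shadowError T ρs (ω w) A O) (x, t, z) = shadowError T ρs (ω w) A O (x, t, z) :=
        fun z => Set.indicator_of_mem (by exact hB) _
      simp only [this]
      exact h.sum_recordProb_mul_shadowError w A O x ht.1
    · have : ∀ z, Set.indicator {s : Sample D L ℓ | (s.1, s.2.1) ∈ B}
          (shadowError T ρs (ω w) A O) (x, t, z) = 0 :=
        fun z => Set.indicator_of_notMem (by exact hB) _
      simp [this]

end SingleRegion

/-! ### Uniform accuracy on one region -/

section SingleRegion

open scoped Matrix.Norms.L2Operator

variable {D L : ℕ} {a : Site D L → ℕ} {c : PhaseConstants} {b : Boundary} {ℓ W N : ℕ}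
  {T : Site D L → (Fin ℓ → Set.Icc (-1 : ℝ) 1) → SuperOp a} {ρs : SysOp D L} {ω : Fin W → AncOp a}

lemma reduceTo_shadow_isHermitian (A : Finset (Site D L)) (z : Record D L) :
    (reduceTo A (shadow z)).IsHermitian := by
  ext σ τ
  simp only [Matrix.conjTranspose_apply, reduceTo, Matrix.of_apply, star_sum]
  exact Finset.sum_congr rfl fun η _ => (shadow_isHermitian z).apply _ _

lemma trace_mul_aggregatedShadow {A : Finset (Site D L)} {O : RegionOp A} (hO : O.IsHermitian)
    {r : ℕ} {γ tmax : ℝ} (s : Fin N → Sample D L ℓ) (x : Param D L ℓ) (t : ℝ) :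
    (O * aggregatedShadow b c.range r γ tmax A s x t).trace =
      (((closeSamples b c.range r γ tmax A s x t).card : ℝ)⁻¹ *
        ∑ k ∈ closeSamples b c.range r γ tmax A s x t,
          (O * reduceTo A (shadow (s k).2.2)).trace.re : ℝ) := by
  rw [aggregatedShadow, Matrix.mul_smul, Matrix.trace_smul, Finset.mul_sum, Matrix.trace_sum,
    smul_eq_mul]
  push_cast
  congr 1
  refine Finset.sum_congr rfl fun k _ => Complex.ext (by simp) ?_
  rw [trace_mul_im_eq_zero hO (reduceTo_shadow_isHermitian A _), Complex.ofReal_im]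

lemma mem_closeSamples {A : Finset (Site D L)} {r : ℕ} {γ tmax : ℝ} {s : Fin N → Sample D L ℓ}
    {x : Param D L ℓ} {t : ℝ} {k : Fin N} : k ∈ closeSamples b c.range r γ tmax A s x t ↔
      ((s k).1, (s k).2.1) ∈ windowSet (nearbyTerms b c.range A r) γ x (min t tmax) := by
  simp [closeSamples, windowSet]

/-- The aggregated shadow is accurate if the samples near the query point are typical. -/
lemma IsLindbladianPhase.norm_trace_sub_aggregatedShadow_le (h : IsLindbladianPhase c b a T ρs ω)
    (w : Fin W) {A : Finset (Site D L)} {O : RegionOp A} (hO : O.IsHermitian) (hO1 : ‖O‖ ≤ 1)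
    {r : ℕ} {γ tmax ε₁ ε₂ p κ B : ℝ} (hγ : 0 ≤ γ) (htmax : 0 < tmax)
    (hε₁ : |c.strength| * (A.card * (2 * c.range + 1) ^ D : ℕ) * γ +
      (|c.lip| * γ * (nearbyTerms b c.range A r).card +
        c.lrConst D * A.card * Real.exp (c.velocity D * tmax) * Real.exp (-(r / 2))) * tmax ≤ ε₁)
    (hB : 8 ^ A.card + 1 ≤ B)
    {s : Fin N → Sample D L ℓ} (hs : ∀ k, (s k).2.1 ∈ Set.Icc 0 tmax)
    {x : Param D L ℓ} {t : ℝ} (ht : 0 ≤ t)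
    (hε₂ : ‖(embedHom A a O * phaseState T ρs (ω w) x t).trace -
      (embedHom A a O * phaseState T ρs (ω w) x (min t tmax)).trace‖ ≤ ε₂)
    {Γ' Sh : Finset (Fin N)}
    (hΓ : ∀ k, k ∉ Sh → (k ∈ closeSamples b c.range r γ tmax A s x t ↔ k ∈ Γ'))
    (hcard : N * (p - κ) ≤ Γ'.card)
    (hsum : |∑ k ∈ Γ', shadowError T ρs (ω w) A O (s k)| ≤ N * (κ * B))
    (hSh : (Sh.card : ℝ) ≤ N * (2 * κ)) (hN : 0 < N) (h3 : 3 * κ < p) :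
    ‖(embedHom A a O * phaseState T ρs (ω w) x t).trace -
        (O * aggregatedShadow b c.range r γ tmax A s x t).trace‖ ≤
      ε₂ + (ε₁ + 3 * κ * B / (p - 3 * κ)) := by
  have hB0 : 0 ≤ B := le_trans (by positivity) hB
  have hmin : 0 ≤ min t tmax := le_min ht htmax.le
  have e : (embedHom A a O * phaseState T ρs (ω w) x (min t tmax)).trace =
      ((embedHom A a O * phaseState T ρs (ω w) x (min t tmax)).trace.re : ℂ) := by
    refine Complex.ext (by simp) ?_
    rw [Complex.ofReal_im, trace_embedHom_mul, ← trace_embedOp_mul]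
    exact trace_mul_im_eq_zero (embedOp_isHermitian hO)
      (traceSnd_isHermitian (h.phaseState_isHermitian w x _))
  have key := abs_average_sub_le (Γ := closeSamples b c.range r γ tmax A s x t)
    (Y := fun k => (O * reduceTo A (shadow (s k).2.2)).trace.re)
    (F := fun k => (embedHom A a O * phaseState T ρs (ω w) (s k).1 (s k).2.1).trace.re)
    (f := (embedHom A a O * phaseState T ρs (ω w) x (min t tmax)).trace.re) (ε₁ := ε₁)
    hΓ (fun k => (h.abs_shadowError_le w hO1 (hs k).1).trans hB) (fun k hk => ?_) hcard hsum hSh hN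
    hB0 h3
  · refine (norm_sub_le_norm_sub_add_norm_sub _ _ _).trans (add_le_add hε₂ ?_)
    rw [trace_mul_aggregatedShadow hO, e, ← Complex.ofReal_sub, Complex.norm_real, Real.norm_eq_abs,
      abs_sub_comm]
    exact key
  · rw [abs_sub_comm, ← Complex.sub_re]
    refine (Complex.abs_re_le_norm _).trans ?_
    rw [mem_closeSamples] at hk
    have h1 := h.norm_trace_sub_le w A O hγ hk.1 (hs k).1 hmin (min_le_right t tmax) hk.2
    refine (h1.trans (mul_le_of_le_one_left ?_ hO1)).trans hε₁
    have h2 := c.lrConst_nonneg D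
    exact add_nonneg (mul_nonneg (mul_nonneg (abs_nonneg _) (Nat.cast_nonneg _)) hγ)
      (mul_nonneg (add_nonneg (mul_nonneg (mul_nonneg (abs_nonneg _) hγ) (Nat.cast_nonneg _))
        (mul_nonneg (mul_nonneg (mul_nonneg h2 (Nat.cast_nonneg _)) (Real.exp_pos _).le)
          (Real.exp_pos _).le)) htmax.le)

open Classical in
/-- The samples are typical for a query point. -/
lemma IsLindbladianPhase.measure_atypical_le (h : IsLindbladianPhase c b a T ρs ω)
    (w : Fin W) {A : Finset (Site D L)} {O : RegionOp A} (hO1 : ‖O‖ ≤ 1)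
    {γ η η' tmax p κ B : ℝ} (hγ : 0 ≤ γ) (hγ1 : γ ≤ 1) (htmax : 0 < tmax) (hγt : γ ≤ tmax / 2)
    (hB : 8 ^ A.card + 1 ≤ B) (F : Finset (Site D L))
    (hp : p ≤ (γ / 2) ^ (ℓ * F.card) * (γ / tmax)) (hη : 0 ≤ η) (hη' : 0 ≤ η')
    (hκ : ℓ * F.card * (2 * η) + 4 * η' / tmax ≤ κ)
    (x : Param D L ℓ) {t : ℝ} (ht : t ∈ Set.Icc 0 tmax) :
    dataLaw T ρs ω tmax N {s | ¬
      (N * (p - κ) ≤ (Finset.univ.filter fun k =>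
          ((s (w, k)).1, (s (w, k)).2.1) ∈ windowSet F γ x t).card ∧
        |∑ k with ((s (w, k)).1, (s (w, k)).2.1) ∈ windowSet F γ x t,
          shadowError T ρs (ω w) A O (s (w, k))| ≤ N * (κ * B) ∧
        ((Finset.univ.filter fun k =>
          ((s (w, k)).1, (s (w, k)).2.1) ∈ shellSet F γ η η' x t).card : ℝ) ≤ N * (2 * κ))} ≤
      ENNReal.ofReal (6 * Real.exp (-(N * κ ^ 2 / 2))) := by
  have hκ0 : 0 ≤ κ := le_trans (by positivity) hκ
  have hB0 : 0 < B := lt_of_lt_of_le (by positivity) hB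
  have : ∀ w, IsProbabilityMeasure (sampleLaw T ρs (ω w) tmax) :=
    fun w => h.isProbabilityMeasure_sampleLaw w htmax
  have hlabel : Measurable fun s : Sample D L ℓ => (s.1, s.2.1) := by fun_prop
  set Wd : Set (Sample D L ℓ) := {s | (s.1, s.2.1) ∈ windowSet F γ x t} with hWd
  set Sh : Set (Sample D L ℓ) := {s | (s.1, s.2.1) ∈ shellSet F γ η η' x t} with hSh
  have hWm : MeasurableSet Wd := hlabel (measurableSet_windowSet F γ x t)
  have hSm : MeasurableSet Sh := hlabel (measurableSet_shellSet F γ η η' x t)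
  have hWp : p ≤ (sampleLaw T ρs (ω w) tmax).real Wd := by
    rw [measureReal_def, h.sampleLaw_preimage w htmax (measurableSet_windowSet F γ x t)]
    have := isProbabilityMeasure_uniformTime htmax
    refine hp.trans ((ENNReal.ofReal_le_iff_le_toReal (measure_ne_top _ _)).1 ?_)
    exact le_measure_windowSet F x hγ hγ1 htmax ht hγt
  have hSp : (sampleLaw T ρs (ω w) tmax).real Sh ≤ κ := by
    rw [measureReal_def, h.sampleLaw_preimage w htmax (measurableSet_shellSet F γ η η' x t)]
    refine ENNReal.toReal_le_of_le_ofReal hκ0 ?_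
    exact (measure_shellSet_le F x htmax hη hη').trans (ENNReal.ofReal_le_ofReal hκ)
  -- Three concentration events: the count in the window, the count in the shell, and the summed
  -- shadow error in the window. Each costs `2 * exp`, whence the factor `6`.
  have h1 := measure_pi_card_deviation_le (N := N) (fun w => sampleLaw T ρs (ω w) tmax) w hWm hκ0
  have h2 := measure_pi_card_deviation_le (N := N) (fun w => sampleLaw T ρs (ω w) tmax) w hSm hκ0
  have h3 := measure_pi_sum_deviation_le (N := N) (fun w => sampleLaw T ρs (ω w) tmax) w
    (g := Wd.indicator (shadowError T ρs (ω w) A O))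
    ((h.measurable_shadowError w A O).indicator hWm) hB0 hκ0 (by
      filter_upwards [ae_sampleLaw (T := T) (ρs := ρs) (ω w) tmax] with s hs
      by_cases hsW : s ∈ Wd
      · rw [Set.indicator_of_mem hsW]
        exact (h.abs_shadowError_le w hO1 hs.1).trans hB
      · rw [Set.indicator_of_notMem hsW, abs_zero]
        exact hB0.le)
  rw [hWd, h.integral_indicator_shadowError w A O htmax] at h3
  have e6 : (6 : ℝ) * Real.exp (-(N * κ ^ 2 / 2)) = 2 * Real.exp (-(N * κ ^ 2 / 2)) +
      2 * Real.exp (-(N * κ ^ 2 / 2)) + 2 * Real.exp (-(N * κ ^ 2 / 2)) := by ring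
  rw [e6, ENNReal.ofReal_add (by positivity) (by positivity),
    ENNReal.ofReal_add (by positivity) (by positivity)]
  refine le_trans (measure_mono ?_) ((measure_union_le _ _).trans
    (add_le_add ((measure_union_le _ _).trans (add_le_add h1 h2)) h3))
  intro s hs
  by_contra hcon
  simp only [Set.mem_union, Set.mem_ofPred_eq, not_or, not_lt, sub_zero] at hcon
  obtain ⟨⟨hc1, hc2⟩, hc3⟩ := hcon
  refine hs ⟨?_, ?_, ?_⟩
  · have hc := (abs_le.1 hc1).1
    have : (N : ℝ) * p ≤ N * (sampleLaw T ρs (ω w) tmax).real Wd := by gcongr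
    have hle : N * (p - κ) ≤ ((Finset.univ.filter fun k => s (w, k) ∈ Wd).card : ℝ) := by linarith
    exact hle
  · refine le_of_eq_of_le ?_ hc3
    congr 1
    rw [Finset.sum_filter]
    exact Finset.sum_congr rfl fun k _ => by simp [Set.indicator_apply]
  · have hc := (abs_le.1 hc2).2
    have : (N : ℝ) * (sampleLaw T ρs (ω w) tmax).real Sh ≤ N * κ := by gcongr
    have hle : ((Finset.univ.filter fun k => s (w, k) ∈ Sh).card : ℝ) ≤ N * (2 * κ) := by linarith
    exact hle

/-- With high probability, the aggregated shadow on one region is accurate at all query points. -/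
theorem IsLindbladianPhase.measure_inaccurate_le (h : IsLindbladianPhase c b a T ρs ω)
    (w : Fin W) {A : Finset (Site D L)} {O : RegionOp A} (hO : O.IsHermitian) (hO1 : ‖O‖ ≤ 1)
    {r m : ℕ} {γ tmax ε₁ ε₂ p κ B : ℝ} (hγ : 0 ≤ γ) (hγ1 : γ ≤ 1) (htmax : 0 < tmax)
    (hγt : γ ≤ tmax / 2) (hB : 8 ^ A.card + 1 ≤ B) (hm : 0 < m)
    (hε₁ : |c.strength| * (A.card * (2 * c.range + 1) ^ D : ℕ) * γ +
      (|c.lip| * γ * (nearbyTerms b c.range A r).card +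
        c.lrConst D * A.card * Real.exp (c.velocity D * tmax) * Real.exp (-(r / 2))) * tmax ≤ ε₁)
    (hε₂ : ∀ (x : Param D L ℓ) (t : ℝ), 0 ≤ t →
      ‖(embedHom A a O * phaseState T ρs (ω w) x t).trace -
        (embedHom A a O * phaseState T ρs (ω w) x (min t tmax)).trace‖ ≤ ε₂)
    (hp : p ≤ (γ / 2) ^ (ℓ * (nearbyTerms b c.range A r).card) * (γ / tmax))
    (hκ : (ℓ * (nearbyTerms b c.range A r).card + 1) * (4 / m : ℝ) ≤ κ) (hN : 0 < N)
    (h3 : 3 * κ < p) :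
    dataLaw T ρs ω tmax N {s | ∃ (x : Param D L ℓ) (t : ℝ), 0 ≤ t ∧
      ε₂ + (ε₁ + 3 * κ * B / (p - 3 * κ)) <
        ‖(embedHom A a O * phaseState T ρs (ω w) x t).trace -
          (O * aggregatedShadow b c.range r γ tmax A (fun k => s (w, k)) x t).trace‖} ≤
      ENNReal.ofReal (((m + 1 : ℕ) : ℝ) ^ (ℓ * (nearbyTerms b c.range A r).card + 1) *
        (6 * Real.exp (-(N * κ ^ 2 / 2)))) := by
  classical
  set F := nearbyTerms b c.range A r with hF
  have hm' : (0 : ℝ) < m := by exact_mod_cast hm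
  have : ∀ w, IsProbabilityMeasure (sampleLaw T ρs (ω w) tmax) :=
    fun w => h.isProbabilityMeasure_sampleLaw w htmax
  -- Only coordinates in `F` are varied, because the window does not see the others. The number of
  -- grid points is therefore independent of the system size.
  let X : ({j // j ∈ F} → Fin ℓ → Fin (m + 1)) → Param D L ℓ := fun q j i =>
    if hj : j ∈ F then gridPoint m (q ⟨j, hj⟩ i) else gridPoint m 0
  let τ : Fin (m + 1) → ℝ := fun q => tmax * (q / m)
  have hτ : ∀ q, τ q ∈ Set.Icc 0 tmax := by
    intro q
    have : (q / m : ℝ) ≤ 1 := by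
      rw [div_le_one hm']; exact_mod_cast Nat.lt_succ_iff.1 q.2
    exact ⟨by positivity, mul_le_of_le_one_right htmax.le this⟩
  -- The grid spacing sets the shell widths: `2 / m` in each parameter and `tmax / m` in time, each
  -- costing probability `4 / m`.
  have hκ' : ℓ * F.card * (2 * (2 / m : ℝ)) + 4 * (tmax / m) / tmax ≤ κ := by
    refine le_trans (le_of_eq ?_) hκ
    field_simp
    ring
  have hnull : dataLaw T ρs ω tmax N {s | ¬ ∀ k, (s (w, k)).2.1 ∈ Set.Icc 0 tmax} = 0 := by
    refine ae_iff.1 (ae_all_iff.2 fun k => ?_)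
    exact (measurePreserving_eval (fun q : Fin W × Fin N => sampleLaw T ρs (ω q.1) tmax)
      (w, k)).quasiMeasurePreserving.ae (ae_sampleLaw (T := T) (ρs := ρs) (ω w) tmax)
  have hgrid := fun q : ({j // j ∈ F} → Fin ℓ → Fin (m + 1)) × Fin (m + 1) =>
    h.measure_atypical_le (N := N) w hO1 hγ hγ1 htmax hγt hB F hp
      (show (0 : ℝ) ≤ 2 / m by positivity) (show 0 ≤ tmax / m by positivity) hκ' (X q.1) (hτ q.2)
  have hcardQ : Fintype.card (({j // j ∈ F} → Fin ℓ → Fin (m + 1)) × Fin (m + 1)) =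
      (m + 1) ^ (ℓ * F.card + 1) := by
    simp [pow_succ, pow_mul]
  have hsum : ∑ _q : ({j // j ∈ F} → Fin ℓ → Fin (m + 1)) × Fin (m + 1),
      ENNReal.ofReal (6 * Real.exp (-(N * κ ^ 2 / 2))) =
      ENNReal.ofReal (((m + 1 : ℕ) : ℝ) ^ (ℓ * F.card + 1) *
        (6 * Real.exp (-(N * κ ^ 2 / 2)))) := by
    rw [Finset.sum_const, Finset.card_univ, hcardQ, nsmul_eq_mul,
      ← ENNReal.ofReal_natCast, ← ENNReal.ofReal_mul (Nat.cast_nonneg _), Nat.cast_pow]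
  rw [← hsum, ← add_zero (∑ _q, _), ← hnull]
  refine le_trans (measure_mono ?_) ((measure_union_le _ _).trans (add_le_add
    ((measure_iUnion_fintype_le _ _).trans (Finset.sum_le_sum fun q _ => hgrid q)) le_rfl))
  rintro s ⟨x, t, ht, hlt⟩
  by_contra hcon
  simp only [Set.mem_union, Set.mem_iUnion, Set.mem_ofPred_eq, not_or, not_exists, not_not] at hcon
  obtain ⟨hgood, hs⟩ := hcon
  refine hlt.not_ge ?_
  choose q hq using fun (j : {j // j ∈ F}) (i : Fin ℓ) => exists_gridPoint hm (x j i)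
  have hu1 : min t tmax / tmax ≤ 1 := (div_le_one htmax).2 (min_le_right _ _)
  obtain ⟨q', hq'⟩ := exists_grid hm (u := min t tmax / tmax)
    (div_nonneg (le_min ht htmax.le) htmax.le) hu1
  obtain ⟨hg1, hg2, hg3⟩ := hgood (q, q')
  -- Typicality is known at the nearest grid point and the accuracy is wanted at the query itself;
  -- off the shell of the grid point the two windows contain the same samples.
  refine h.norm_trace_sub_aggregatedShadow_le w hO hO1 hγ htmax hε₁ hB hs ht (hε₂ x t ht)
    (fun k hk => ?_) hg1 hg2 hg3 hN h3
  rw [mem_closeSamples, Finset.mem_filter_univ]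
  rw [Finset.mem_filter_univ] at hk
  refine mem_windowSet_iff_of_notMem_shellSet (fun j hj i => ?_) ?_ hγ hk
  · have e : X q j i = gridPoint m (q ⟨j, hj⟩ i) := dif_pos hj
    rw [e]
    exact hq ⟨j, hj⟩ i
  · have e : min t tmax - τ q' = tmax * (min t tmax / tmax - q' / m) := by
      rw [mul_sub, mul_div_cancel₀ _ htmax.ne']
    rw [e, abs_mul, abs_of_pos htmax, div_eq_mul_one_div tmax]
    gcongr

end SingleRegion

/-! ### Union bound over regions and auxiliary states -/

section Estimator

open scoped Matrix.Norms.L2Operator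

variable {D L : ℕ} {a : Site D L → ℕ} {c : PhaseConstants} {b : Boundary} {ℓ W N : ℕ}
  {T : Site D L → (Fin ℓ → Set.Icc (-1 : ℝ) 1) → SuperOp a} {ρs : SysOp D L} {ω : Fin W → AncOp a}

lemma isHermitian_inv_norm_smul {ι : Type*} [Fintype ι] [DecidableEq ι] {O : Matrix ι ι ℂ}
    (hO : O.IsHermitian) : (((‖O‖⁻¹ : ℝ) : ℂ) • O).IsHermitian := by
  rw [Matrix.IsHermitian, Matrix.conjTranspose_smul, hO.eq]
  simp

lemma norm_inv_norm_smul_le_one {ι : Type*} [Fintype ι] [DecidableEq ι] (O : Matrix ι ι ℂ) :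
    ‖((‖O‖⁻¹ : ℝ) : ℂ) • O‖ ≤ 1 := by
  rw [norm_smul, Complex.norm_real, norm_inv, norm_norm]
  exact inv_mul_le_one

lemma norm_smul_inv_norm_smul {ι : Type*} [Fintype ι] [DecidableEq ι] (O : Matrix ι ι ℂ) :
    (‖O‖ : ℂ) • (((‖O‖⁻¹ : ℝ) : ℂ) • O) = O := by
  rcases eq_or_ne O 0 with rfl | h
  · simp
  · rw [smul_smul, Complex.ofReal_inv, mul_inv_cancel₀, one_smul]
    exact_mod_cast norm_ne_zero_iff.2 h

/-- With high probability, the estimator is accurate for all query points. -/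
theorem IsLindbladianPhase.measure_estimator_inaccurate_le (h : IsLindbladianPhase c b a T ρs ω)
    {M : ℕ} {S : Fin M → Finset (Site D L)} {O : ∀ i, RegionOp (S i)}
    (hO : ∀ i, (O i).IsHermitian) {k n₁ r m : ℕ} (hS : ∀ i, (S i).card ≤ k)
    (hn : ∀ i, (nearbyTerms b c.range (S i) r).card ≤ n₁)
    {γ tmax ε ε₁ ε₂ p κ : ℝ} (hγ : 0 ≤ γ) (hγ1 : γ ≤ 1) (htmax : 0 < tmax)
    (hγt : γ ≤ tmax / 2) (hm : 0 < m)
    (hε₁ : |c.strength| * (k * (2 * c.range + 1) ^ D : ℕ) * γ +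
      (|c.lip| * γ * n₁ +
        c.lrConst D * k * Real.exp (c.velocity D * tmax) * Real.exp (-(r / 2))) * tmax ≤ ε₁)
    (hε₂ : ∀ (w : Fin W) (A : Finset (Site D L)), A.card ≤ k → ∀ O : RegionOp A, ‖O‖ ≤ 1 →
      ∀ (x : Param D L ℓ) (t : ℝ), 0 ≤ t →
      ‖(embedHom A a O * phaseState T ρs (ω w) x t).trace -
        (embedHom A a O * phaseState T ρs (ω w) x (min t tmax)).trace‖ ≤ ε₂)
    (hp : p ≤ (γ / 2) ^ (ℓ * n₁) * (γ / tmax))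
    (hκ : (ℓ * n₁ + 1) * (4 / m : ℝ) ≤ κ) (hN : 0 < N) (h3 : 3 * κ < p)
    (hε : ε₂ + (ε₁ + 3 * κ * (8 ^ k + 1) / (p - 3 * κ)) ≤ ε) :
    dataLaw T ρs ω tmax N
      {s | ¬ ∀ (x : Param D L ℓ) (t : ℝ) (w : Fin W), 0 ≤ t →
        ‖expectation T ρs (ω w) S O x t -
          estimator b c.range r γ tmax S O (fun k => s (w, k)) x t‖ ≤ ε * ∑ i, ‖O i‖} ≤
      ENNReal.ofReal (W * (M * (((m + 1 : ℕ) : ℝ) ^ (ℓ * n₁ + 1) *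
        (6 * Real.exp (-(N * κ ^ 2 / 2)))))) := by
  classical
  -- Normalisation makes one absolute accuracy serve all observables; `O i = 0` is harmless because
  -- the inverse of zero is zero.
  let O' : ∀ i, RegionOp (S i) := fun i => ((‖O i‖⁻¹ : ℝ) : ℂ) • O i
  have hlr := c.lrConst_nonneg D
  let E : Fin W → Fin M → Set (Fin W × Fin N → Sample D L ℓ) := fun w i =>
    {s | ∃ (x : Param D L ℓ) (t : ℝ), 0 ≤ t ∧ ε₂ + (ε₁ + 3 * κ * (8 ^ k + 1) / (p - 3 * κ)) <
      ‖(embedHom (S i) a (O' i) * phaseState T ρs (ω w) x t).trace -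
        (O' i * aggregatedShadow b c.range r γ tmax (S i) (fun k => s (w, k)) x t).trace‖}
  have hE : ∀ w i, dataLaw T ρs ω tmax N (E w i) ≤ ENNReal.ofReal
      (((m + 1 : ℕ) : ℝ) ^ (ℓ * n₁ + 1) * (6 * Real.exp (-(N * κ ^ 2 / 2)))) := by
    intro w i
    have hSk : ((S i).card : ℝ) ≤ k := by exact_mod_cast hS i
    have hni : ((nearbyTerms b c.range (S i) r).card : ℝ) ≤ n₁ := by exact_mod_cast hn i
    refine (h.measure_inaccurate_le (N := N) w (isHermitian_inv_norm_smul (hO i))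
      (norm_inv_norm_smul_le_one (O i)) (r := r) (B := 8 ^ k + 1) (ε₁ := ε₁) (p := p) hγ hγ1 htmax
      hγt ?_ hm ?_
      (hε₂ w (S i) (hS i) _ (norm_inv_norm_smul_le_one (O i))) ?_ ?_ hN h3).trans ?_
    · have : (8 : ℝ) ^ (S i).card ≤ 8 ^ k := pow_le_pow_right₀ (by norm_num) (hS i)
      linarith
    · refine le_trans (add_le_add ?_ ?_) hε₁
      · have : (((S i).card * (2 * c.range + 1) ^ D : ℕ) : ℝ) ≤ (k * (2 * c.range + 1) ^ D : ℕ) := by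
          exact_mod_cast Nat.mul_le_mul_right _ (hS i)
        gcongr
      · gcongr
    · refine hp.trans (mul_le_mul_of_nonneg_right ?_ (by positivity))
      exact pow_le_pow_of_le_one (by positivity) (by linarith) (Nat.mul_le_mul_left _ (hn i))
    · refine le_trans ?_ hκ
      gcongr
    · refine ENNReal.ofReal_le_ofReal ?_
      gcongr
      · exact_mod_cast Nat.succ_le_succ (Nat.zero_le m)
      · exact hn i
  refine (measure_mono ?_).trans ((measure_iUnion_fintype_le _ fun w => ⋃ i, E w i).trans ?_)
  · intro s hs
    by_contra hcon
    refine hs fun x t w ht => ?_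
    simp only [Set.mem_iUnion, not_exists] at hcon
    rw [expectation_eq_sum, estimator, ← Finset.sum_sub_distrib, Finset.mul_sum]
    refine (norm_sum_le _ _).trans (Finset.sum_le_sum fun i _ => ?_)
    have h1 := hcon w i
    simp only [E, Set.mem_ofPred_eq, not_exists, not_and, not_lt] at h1
    have h2 := (h1 x t ht).trans hε
    have e : (embedHom (S i) a (O i) * phaseState T ρs (ω w) x t).trace -
        (O i * aggregatedShadow b c.range r γ tmax (S i) (fun k => s (w, k)) x t).trace =
        (‖O i‖ : ℂ) * ((embedHom (S i) a (O' i) * phaseState T ρs (ω w) x t).trace -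
        (O' i * aggregatedShadow b c.range r γ tmax (S i) (fun k => s (w, k)) x t).trace) := by
      conv_lhs => rw [← norm_smul_inv_norm_smul (O i)]
      rw [map_smul, Matrix.smul_mul, Matrix.smul_mul, Matrix.trace_smul, Matrix.trace_smul,
        ← smul_sub, smul_eq_mul]
    rw [e, norm_mul, Complex.norm_real, norm_norm, mul_comm]
    exact mul_le_mul_of_nonneg_right h2 (norm_nonneg _)
  · set q := ((m + 1 : ℕ) : ℝ) ^ (ℓ * n₁ + 1) * (6 * Real.exp (-(N * κ ^ 2 / 2)))
    calc ∑ w, dataLaw T ρs ω tmax N (⋃ i, E w i)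
        ≤ ∑ _w : Fin W, ∑ _i : Fin M, ENNReal.ofReal q :=
          Finset.sum_le_sum fun w _ => (measure_iUnion_fintype_le _ _).trans
            (Finset.sum_le_sum fun i _ => hE w i)
      _ = ENNReal.ofReal (W * (M * q)) := by
        simp only [Finset.sum_const, Finset.card_univ, Fintype.card_fin, nsmul_eq_mul]
        rw [ENNReal.ofReal_mul (Nat.cast_nonneg _), ENNReal.ofReal_mul (Nat.cast_nonneg _),
          ENNReal.ofReal_natCast, ENNReal.ofReal_natCast]

end Estimator

/-! ### Choice of the constants -/

/-- `f x` is at most exponential in `x ^ q`, uniformly for `x ≥ log 2`. -/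
def ExpBounded (q : ℕ) (f : ℝ → ℝ) : Prop :=
  ∃ b : ℝ, 0 ≤ b ∧ ∀ x, Real.log 2 ≤ x → f x ≤ Real.exp (b * x ^ q)

namespace ExpBounded

variable {q : ℕ} {f g : ℝ → ℝ}

lemma log_two_pos : 0 < Real.log 2 := Real.log_pos one_lt_two

/-- Since `x` stays above `log 2 > 0`, constants can be absorbed into the exponential. -/
lemma const (q : ℕ) (C : ℝ) : ExpBounded q fun _ => C := by
  refine ⟨|C| / Real.log 2 ^ q, div_nonneg (abs_nonneg C) (pow_nonneg log_two_pos.le q), fun x hx => ?_⟩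
  have h0 := log_two_pos
  have h1 : |C| ≤ |C| / Real.log 2 ^ q * x ^ q := by
    rw [div_mul_eq_mul_div, le_div_iff₀ (by positivity)]
    gcongr
  linarith [le_abs_self C, Real.add_one_le_exp (|C| / Real.log 2 ^ q * x ^ q)]

lemma mono (hf : ExpBounded q f) (h : ∀ x, Real.log 2 ≤ x → g x ≤ f x) : ExpBounded q g := by
  obtain ⟨b, hb, hf⟩ := hf
  exact ⟨b, hb, fun x hx => (h x hx).trans (hf x hx)⟩

lemma mul (hf : ExpBounded q f) (hg : ExpBounded q g) (h0 : ∀ x, Real.log 2 ≤ x → 0 ≤ g x) :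
    ExpBounded q fun x => f x * g x := by
  obtain ⟨b, hb, hf⟩ := hf
  obtain ⟨d, hd, hg⟩ := hg
  refine ⟨b + d, add_nonneg hb hd, fun x hx => ?_⟩
  rw [add_mul, Real.exp_add]
  exact mul_le_mul (hf x hx) (hg x hx) (h0 x hx) (Real.exp_pos _).le

lemma add (hf : ExpBounded q f) (hg : ExpBounded q g) : ExpBounded q fun x => f x + g x := by
  obtain ⟨b, hb, hf⟩ := hf
  obtain ⟨d, hd, hg⟩ := hg
  have h2 : ExpBounded q fun x => 2 * Real.exp ((b + d) * x ^ q) :=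
    (const q 2).mul ⟨b + d, add_nonneg hb hd, fun x _ => le_rfl⟩ fun x _ => (Real.exp_pos _).le
  refine h2.mono fun x hx => ?_
  have hx0 : 0 ≤ x := log_two_pos.le.trans hx
  have hxq : 0 ≤ x ^ q := by positivity
  have h3 : Real.exp (b * x ^ q) ≤ Real.exp ((b + d) * x ^ q) := by gcongr; linarith
  have h4 : Real.exp (d * x ^ q) ≤ Real.exp ((b + d) * x ^ q) := by gcongr; linarith
  linarith [hf x hx, hg x hx]

lemma lift (hf : ExpBounded q f) (k : ℕ) : ExpBounded (q + k) f := by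
  obtain ⟨b, hb, hf⟩ := hf
  have h0 := log_two_pos
  refine ⟨b / Real.log 2 ^ k, by positivity, fun x hx => (hf x hx).trans ?_⟩
  have hx0 : 0 ≤ x := h0.le.trans hx
  rw [Real.exp_le_exp, div_mul_eq_mul_div, le_div_iff₀ (by positivity), pow_add, ← mul_assoc]
  gcongr

lemma exp_mul (b : ℝ) : ExpBounded 1 fun x => Real.exp (b * x) := by
  refine ⟨|b|, abs_nonneg b, fun x hx => ?_⟩
  have hx0 : 0 ≤ x := log_two_pos.le.trans hx
  rw [pow_one]
  exact Real.exp_le_exp.2 (mul_le_mul_of_nonneg_right (le_abs_self b) hx0)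

lemma pow_self (n : ℕ) : ExpBounded 1 fun x => x ^ n := by
  refine ⟨n, by positivity, fun x hx => ?_⟩
  have hx0 : 0 ≤ x := log_two_pos.le.trans hx
  rw [pow_one, Real.exp_nat_mul]
  exact pow_le_pow_left₀ hx0 (by linarith [Real.add_one_le_exp x]) n

/-- The origin of the power `D + 1`: a volume of order `x ^ D` in the exponent times a logarithm of
the base of order `x`. -/
lemma pow_natCast (hf : ExpBounded 1 f) {n : ℝ → ℕ} {C : ℝ} {D : ℕ}
    (h0 : ∀ x, Real.log 2 ≤ x → 0 ≤ f x) (hn : ∀ x, Real.log 2 ≤ x → (n x : ℝ) ≤ C * x ^ D) :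
    ExpBounded (D + 1) fun x => f x ^ n x := by
  obtain ⟨b, hb, hf⟩ := hf
  refine ⟨b * |C|, by positivity, fun x hx => ?_⟩
  have hx0 : 0 ≤ x := log_two_pos.le.trans hx
  calc f x ^ n x ≤ Real.exp (b * x ^ 1) ^ n x := by
        gcongr
        · exact h0 x hx
        · exact hf x hx
    _ = Real.exp (n x * (b * x ^ 1)) := (Real.exp_nat_mul _ _).symm
    _ ≤ Real.exp (|C| * x ^ D * (b * x ^ 1)) := by
        gcongr
        refine (hn x hx).trans ?_
        gcongr
        exact le_abs_self C
    _ = _ := by congr 1; ring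

end ExpBounded

/-- Time horizon, range and resolution can be chosen so that the deterministic errors are small. -/
lemma exists_window_constants (D K R : ℕ) {H g v lr s lip : ℝ} (hg : 0 < g) (hv : 0 ≤ v)
    (hlr : 0 ≤ lr) (hs : 0 ≤ s) (hlip : 0 ≤ lip) :
    ∃ Cr Ct Cγ C₃ : ℝ, 0 < Cr ∧ 0 < Ct ∧ 0 < Cγ ∧ ∀ x, Real.log 2 ≤ x →
      let ε := 2 * Real.exp (-x)
      let r := ⌈Cr * x⌉₊
      let tmax := Ct * x
      let γ := ε / (Cγ * x ^ (D + 1))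
      let n₁ := K * (2 * (r + R) + 1) ^ D
      γ ≤ 1 ∧ γ ≤ tmax / 2 ∧ H * Real.exp (-(g * tmax)) ≤ ε / 3 ∧
      s * γ + (lip * γ * n₁ + lr * K * Real.exp (v * tmax) * Real.exp (-(r / 2))) * tmax ≤ ε / 3 ∧
      (n₁ : ℝ) ≤ C₃ * x ^ D := by
  have h0 := ExpBounded.log_two_pos
  obtain ⟨s₁, hs₁, h₁⟩ := ExpBounded.const 1 (3 / 2 * H)
  -- The quotient makes the relaxation error at most `ε / 3`, with `s₁` absorbing the prefactor. The
  -- summand `2` ensures `tmax ≥ 1`, since `x ≥ log 2`.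
  set Ct := 2 + (1 + s₁) / g with hCt
  have hCt2 : 2 ≤ Ct := by
    have : 0 ≤ (1 + s₁) / g := by positivity
    linarith
  have hCt0 : 0 < Ct := by linarith
  obtain ⟨s₂, hs₂, h₂⟩ := ExpBounded.const 1 (9 / 2 * lr * K * Ct)
  -- Halved in the exponent, this cancels the prefactor, the Lieb-Robinson growth up to `tmax` and
  -- the factor `x ≤ exp x` from `tmax`, and leaves one `exp (-x)`.
  set Cr := 2 * (s₂ + v * Ct + 2) with hCr
  have hCr0 : 0 < Cr := by positivity
  set C₂ := 2 * Cr + (3 + 2 * R) / Real.log 2 with hC₂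
  set C₃ := K * C₂ ^ D with hC₃
  have hC₃0 : 0 ≤ C₃ := by positivity
  -- The summands give `4 * γ ≤ ε` and bound the time shift and the nearby parameter changes,
  -- together, by `ε / 9`.
  set Cγ := (2 * 2 + 9 * s) / Real.log 2 ^ (D + 1) + 9 * lip * C₃ * Ct with hCγ
  have hCγ0 : 0 < Cγ := by positivity
  refine ⟨Cr, Ct, Cγ, C₃, hCr0, hCt0, hCγ0, fun x hx => ?_⟩
  have hx0 : 0 < x := h0.trans_le hx
  intro ε r tmax γ n₁
  have hε0 : 0 < ε := by positivity
  have hε1 : ε ≤ 1 := by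
    have : Real.exp (-x) ≤ Real.exp (-Real.log 2) := by gcongr
    rw [Real.exp_neg (Real.log 2), Real.exp_log two_pos] at this
    simp only [ε]; linarith
  have ht1 : 1 ≤ tmax := by
    have := Real.log_two_gt_d9
    simp only [tmax]; nlinarith
  have hγε : γ * (Cγ * x ^ (D + 1)) = ε := div_mul_cancel₀ _ (by positivity)
  have hγ0 : 0 < γ := by positivity
  have hCx : 2 * 2 + 9 * s + 9 * lip * C₃ * Ct * x ^ (D + 1) ≤ Cγ * x ^ (D + 1) := by
    rw [hCγ, add_mul]
    gcongr
    rw [div_mul_eq_mul_div, le_div_iff₀ (by positivity)]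
    gcongr
  have hmain : γ * (2 * 2 + 9 * s + 9 * lip * C₃ * Ct * x ^ (D + 1)) ≤ ε := by
    rw [← hγε]; gcongr
  have hexp : γ * (2 * 2 + 9 * s + 9 * lip * C₃ * Ct * x ^ (D + 1)) =
      4 * γ + 9 * (γ * s) + 9 * (γ * (lip * C₃ * Ct * x ^ (D + 1))) := by ring
  have ht0 : 0 ≤ γ * s := by positivity
  have ht0' : 0 ≤ γ * (lip * C₃ * Ct * x ^ (D + 1)) := by positivity
  have hn₁ : (n₁ : ℝ) ≤ C₃ * x ^ D := by
    have hr : (r : ℝ) ≤ Cr * x + 1 := (Nat.ceil_lt_add_one (by positivity)).le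
    have : (2 * ((r : ℝ) + R) + 1) ≤ C₂ * x := by
      have : (3 + 2 * R : ℝ) ≤ (3 + 2 * R) / Real.log 2 * x := by
        rw [div_mul_eq_mul_div, le_div_iff₀ h0]
        gcongr
      rw [hC₂, add_mul]
      linarith
    simp only [n₁, hC₃]
    push_cast
    rw [mul_assoc, ← mul_pow]
    gcongr
  refine ⟨by linarith, by linarith, ?_, ?_, hn₁⟩
  · have e : -(g * tmax) ≤ -x + -(s₁ * x ^ 1) := by
      have : g * Ct = 2 * g + (1 + s₁) := by rw [hCt]; field_simp
      have : g * tmax = (2 * g + (1 + s₁)) * x := by rw [← this]; simp only [tmax]; ring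
      nlinarith [mul_pos hg hx0]
    have h3 := h₁ x hx
    rcases le_total H 0 with hH | hH
    · exact (mul_nonpos_of_nonpos_of_nonneg hH (Real.exp_pos _).le).trans (by positivity)
    · calc H * Real.exp (-(g * tmax)) ≤ H * Real.exp (-x + -(s₁ * x ^ 1)) := by gcongr
        _ = 2 / 3 * ((3 / 2 * H) * Real.exp (-(s₁ * x ^ 1))) * Real.exp (-x) := by
          rw [Real.exp_add]; ring
        _ ≤ 2 / 3 * (Real.exp (s₁ * x ^ 1) * Real.exp (-(s₁ * x ^ 1))) * Real.exp (-x) := by gcongr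
        _ = ε / 3 := by rw [← Real.exp_add, add_neg_cancel, Real.exp_zero]; simp only [ε]; ring
  · have hfar : lr * K * Real.exp (v * tmax) * Real.exp (-(r / 2)) * tmax ≤ ε / 9 := by
      have hr : Cr * x ≤ r := Nat.le_ceil _
      have hxx : x ≤ Real.exp x := by linarith [Real.add_one_le_exp x]
      calc lr * K * Real.exp (v * tmax) * Real.exp (-(r / 2)) * tmax
          ≤ lr * K * Real.exp (v * tmax) * Real.exp (-(Cr * x / 2)) * (Ct * Real.exp x) := by
            gcongr
            exact mul_le_mul_of_nonneg_left hxx hCt0.le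
        _ = 2 / 9 * (9 / 2 * lr * K * Ct) * (Real.exp (v * tmax) * Real.exp (-(Cr * x / 2)) *
              Real.exp x) := by ring
        _ = 2 / 9 * (9 / 2 * lr * K * Ct) * (Real.exp (-(s₂ * x ^ 1)) * Real.exp (-x)) := by
          rw [← Real.exp_add, ← Real.exp_add, ← Real.exp_add]
          congr 2
          simp only [tmax, hCr]
          ring
        _ ≤ 2 / 9 * Real.exp (s₂ * x ^ 1) * (Real.exp (-(s₂ * x ^ 1)) * Real.exp (-x)) := by
          gcongr
          exact h₂ x hx
        _ = 2 / 9 * (Real.exp (s₂ * x ^ 1) * Real.exp (-(s₂ * x ^ 1))) * Real.exp (-x) := by ring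
        _ = ε / 9 := by rw [← Real.exp_add, add_neg_cancel, Real.exp_zero]; simp only [ε]; ring
    have hnear : lip * γ * n₁ * tmax ≤ γ * (lip * C₃ * Ct * x ^ (D + 1)) := by
      calc lip * γ * n₁ * tmax ≤ lip * γ * (C₃ * x ^ D) * tmax := by gcongr
        _ = _ := by simp only [tmax]; ring
    have e1 : s * γ + (lip * γ * n₁ + lr * K * Real.exp (v * tmax) * Real.exp (-(r / 2))) * tmax =
        γ * s + lip * γ * n₁ * tmax +
          lr * K * Real.exp (v * tmax) * Real.exp (-(r / 2)) * tmax := by ring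
    linarith

/-- The number of samples can be chosen so that the statistical errors are small. -/
lemma exists_sample_size_constant (D ℓ W k : ℕ) {Ct Cγ C₃ : ℝ} (hCt : 0 < Ct) (hCγ : 0 < Cγ)
    {n : ℝ → ℕ} (hn : ∀ x, Real.log 2 ≤ x → (n x : ℝ) ≤ C₃ * x ^ D) :
    ∃ CN : ℝ, 0 < CN ∧ ∀ x, Real.log 2 ≤ x → ∀ u v : ℝ, Real.log 2 ≤ u → Real.log 2 ≤ v →
      ∀ N : ℕ, CN * v * u * (2 : ℝ) ^ (CN * x ^ (D + 1)) ≤ N →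
      let ε := 2 * Real.exp (-x)
      let γ := ε / (Cγ * x ^ (D + 1))
      let p := (γ / 2) ^ (ℓ * n x) * (γ / (Ct * x))
      let κ := p * ε / (12 * (8 ^ k + 1))
      let m := ⌈4 * (ℓ * n x + 1) / κ⌉₊
      0 < N ∧ W * (6 * ((m + 1 : ℕ) : ℝ) ^ (ℓ * n x + 1)) * Real.exp u ≤
        Real.exp (N * κ ^ 2 / 2) := by
  have h0 := ExpBounded.log_two_pos
  have hx0 : ∀ {x}, Real.log 2 ≤ x → 0 < x := fun hx => h0.trans_le hx
  have hln : ∀ x, Real.log 2 ≤ x → ((ℓ * n x : ℕ) : ℝ) ≤ ℓ * C₃ * x ^ D := fun x hx => by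
    push_cast
    rw [mul_assoc]
    gcongr
    exact hn x hx
  -- `G` is `2 / γ` and `Q` below is `1 / κ`, written so that their growth can be read off factor by
  -- factor.
  set G : ℝ → ℝ := fun x => Cγ * x ^ (D + 1) * Real.exp (1 * x) with hG
  have hG0 : ∀ x, Real.log 2 ≤ x → 0 < G x := fun x hx => by
    have := hx0 hx
    positivity
  have hGb : ExpBounded 1 G :=
    ((ExpBounded.const 1 Cγ).mul (ExpBounded.pow_self (D + 1)) fun x hx =>
      pow_nonneg (hx0 hx).le _).mul (ExpBounded.exp_mul 1) fun x _ => (Real.exp_pos _).le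
  set Q : ℝ → ℝ := fun x => G x ^ (ℓ * n x) * (Ct / 2 * x ^ 1 * G x *
    (12 * (8 ^ k + 1) / 2 * Real.exp (1 * x))) with hQ
  have hQ0 : ∀ x, Real.log 2 ≤ x → 0 < Q x := fun x hx => by
    have := hx0 hx
    have := hG0 x hx
    positivity
  have hQb : ExpBounded (D + 1) Q := by
    have h1 : ExpBounded 1 fun x => Ct / 2 * x ^ 1 * G x *
        (12 * (8 ^ k + 1) / 2 * Real.exp (1 * x)) :=
      (((ExpBounded.const 1 (Ct / 2)).mul (ExpBounded.pow_self 1) fun x hx =>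
        pow_nonneg (hx0 hx).le _).mul hGb fun x hx => (hG0 x hx).le).mul
        ((ExpBounded.const 1 _).mul (ExpBounded.exp_mul 1) fun x _ => (Real.exp_pos _).le)
        fun x _ => by positivity
    have h2 := h1.lift D
    rw [add_comm 1 D] at h2
    refine (hGb.pow_natCast (fun x hx => (hG0 x hx).le) hln).mul h2 fun x hx => ?_
    have := hx0 hx
    have := hG0 x hx
    positivity
  have hdb : ExpBounded (D + 1) fun x => ((ℓ * n x + 1 : ℕ) : ℝ) := by
    have h1 : ExpBounded 1 fun x => ℓ * C₃ * x ^ D + 1 :=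
      ((ExpBounded.const 1 _).mul (ExpBounded.pow_self D) fun x hx =>
        pow_nonneg (hx0 hx).le _).add (ExpBounded.const 1 1)
    have h2 := h1.lift D
    rw [add_comm 1 D] at h2
    exact h2.mono fun x hx => by
      have := hln x hx
      push_cast at this ⊢
      linarith
  obtain ⟨d, hd, hm⟩ : ExpBounded (D + 1) fun x => 4 * ((ℓ * n x + 1 : ℕ) : ℝ) * Q x + 2 :=
    (((ExpBounded.const _ 4).mul hdb fun x _ => Nat.cast_nonneg _).mul hQb
      fun x hx => (hQ0 x hx).le).add (ExpBounded.const _ 2)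
  -- The logarithm of a bound for the number of events in the union bound, apart from the factor
  -- that `exp u` accounts for.
  set E : ℝ → ℝ := fun x => Real.log (6 * W + 1) + ((ℓ * n x + 1 : ℕ) : ℝ) * (d * x ^ (D + 1))
    with hE
  have hE0 : ∀ x, Real.log 2 ≤ x → 0 ≤ E x := fun x hx => by
    have := hx0 hx
    have : 0 ≤ Real.log (6 * W + 1) := Real.log_nonneg (by
      have : (0 : ℝ) ≤ W := Nat.cast_nonneg W
      linarith)
    positivity
  have hEb : ExpBounded (D + 1) E := by
    have h1 : ExpBounded 1 fun x => d * x ^ (D + 1) :=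
      (ExpBounded.const 1 _).mul (ExpBounded.pow_self _) fun x hx => pow_nonneg (hx0 hx).le _
    have h2 := h1.lift D
    rw [add_comm 1 D] at h2
    refine (ExpBounded.const _ _).add (hdb.mul h2 fun x hx => ?_)
    have := hx0 hx
    positivity
  obtain ⟨e, he, hZ⟩ : ExpBounded (D + 1) fun x =>
      2 / Real.log 2 * (Q x * Q x) * (1 / Real.log 2 * E x + 1) := by
    refine ((ExpBounded.const _ _).mul (hQb.mul hQb fun x hx => (hQ0 x hx).le)
      fun x _ => mul_self_nonneg _).mul
      (((ExpBounded.const _ _).mul hEb hE0).add (ExpBounded.const _ 1)) fun x hx => ?_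
    have := hE0 x hx
    positivity
  -- Division by `log 2` converts the exponential to base `2`; the extra `1` gives `CN ≥ 1`, so the
  -- prefactor `CN` in the sample size does no harm.
  set CN := e / Real.log 2 + 1 with hCN
  have hCN1 : 1 ≤ CN := by
    have : 0 ≤ e / Real.log 2 := by positivity
    linarith
  refine ⟨CN, by linarith, fun x hx u v hu hv N hN => ?_⟩
  intro ε γ p κ m
  have hx' := hx0 hx
  have hQx := hQ0 x hx
  have hEx := hE0 x hx
  have hu0 : 0 < u := h0.trans_le hu
  have hv0 : 0 < v := h0.trans_le hv
  have hκ : κ = (Q x)⁻¹ := by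
    have h1 : γ / 2 = (G x)⁻¹ := by
      simp only [γ, ε, hG, one_mul, Real.exp_neg]
      field_simp
    have h2 : γ = 2 * (G x)⁻¹ := by rw [← h1]; ring
    have h3 : ε = 2 * (Real.exp (1 * x))⁻¹ := by simp only [ε, one_mul, Real.exp_neg]
    have hGx := hG0 x hx
    simp only [κ, p, hQ]
    rw [h1, h2, h3, inv_pow]
    field_simp
  have hNlow : 2 * Q x ^ 2 * (E x + u) ≤ N := by
    refine le_trans ?_ hN
    have h1 : Real.exp (e * x ^ (D + 1)) ≤ (2 : ℝ) ^ (CN * x ^ (D + 1)) := by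
      rw [Real.rpow_def_of_pos two_pos, Real.exp_le_exp, hCN]
      have : Real.log 2 * ((e / Real.log 2 + 1) * x ^ (D + 1)) =
          e * x ^ (D + 1) + Real.log 2 * x ^ (D + 1) := by field_simp
      rw [this]
      have : 0 ≤ Real.log 2 * x ^ (D + 1) := by positivity
      linarith
    have h2 := (hZ x hx).trans h1
    have h3 : 0 ≤ (2 : ℝ) ^ (CN * x ^ (D + 1)) := by positivity
    -- The bound `u ≥ log 2` turns the sum into a product, so that the logarithm of the failure
    -- probability enters the sample size as a factor.
    have h4 : E x + u ≤ u * (1 / Real.log 2 * E x + 1) := by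
      have : E x ≤ u * (1 / Real.log 2 * E x) := by
        rw [← mul_assoc]
        refine le_mul_of_one_le_left hEx ?_
        rw [mul_one_div, le_div_iff₀ h0]
        linarith
      linarith
    calc 2 * Q x ^ 2 * (E x + u) ≤ 2 * Q x ^ 2 * (u * (1 / Real.log 2 * E x + 1)) := by gcongr
      _ = Real.log 2 * u * (2 / Real.log 2 * (Q x * Q x) * (1 / Real.log 2 * E x + 1)) := by
        field_simp
      _ ≤ v * u * (2 : ℝ) ^ (CN * x ^ (D + 1)) := by gcongr
      _ = 1 * v * u * (2 : ℝ) ^ (CN * x ^ (D + 1)) := by ring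
      _ ≤ _ := by gcongr
  have hN0 : (0 : ℝ) < N := lt_of_lt_of_le (by positivity) hNlow
  refine ⟨by exact_mod_cast hN0, ?_⟩
  have hexp : E x + u ≤ N * κ ^ 2 / 2 := by
    rw [hκ, inv_pow, ← div_eq_mul_inv, div_div, le_div_iff₀ (by positivity)]
    linarith
  have hmle : ((m + 1 : ℕ) : ℝ) ≤ Real.exp (d * x ^ (D + 1)) := by
    refine le_trans ?_ (hm x hx)
    have h1 : (m : ℝ) ≤ 4 * (ℓ * n x + 1) / κ + 1 := by
      refine (Nat.ceil_lt_add_one ?_).le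
      rw [hκ]
      positivity
    rw [hκ, div_inv_eq_mul] at h1
    push_cast
    linarith
  have hW : (W : ℝ) * 6 ≤ Real.exp (Real.log (6 * W + 1)) := by
    rw [Real.exp_log (by positivity)]
    linarith
  calc W * (6 * ((m + 1 : ℕ) : ℝ) ^ (ℓ * n x + 1)) * Real.exp u
      = W * 6 * ((m + 1 : ℕ) : ℝ) ^ (ℓ * n x + 1) * Real.exp u := by ring
    _ ≤ Real.exp (Real.log (6 * W + 1)) * Real.exp (d * x ^ (D + 1)) ^ (ℓ * n x + 1) *
        Real.exp u := by gcongr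
    _ = Real.exp (E x + u) := by rw [← Real.exp_nat_mul, ← Real.exp_add, ← Real.exp_add]
    _ ≤ _ := Real.exp_le_exp.2 hexp

/-! ### Assembly of the main theorem -/

section SingleRegion

open scoped Matrix.Norms.L2Operator

variable {D L : ℕ} {a : Site D L → ℕ} {c : PhaseConstants} {b : Boundary} {ℓ W : ℕ}
  {T : Site D L → (Fin ℓ → Set.Icc (-1 : ℝ) 1) → SuperOp a} {ρs : SysOp D L} {ω : Fin W → AncOp a}

/-- Expectation values at time `t` and at the truncated time `min t tmax` agree up to the
relaxation error. -/
lemma norm_trace_sub_min_le {w : Fin W} {B : FullOp a} {x : Param D L ℓ} {t tmax E : ℝ}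
    (hE : 0 ≤ E) (h : tmax ≤ t → ‖(B * phaseState T ρs (ω w) x t).trace -
      (B * phaseState T ρs (ω w) x tmax).trace‖ ≤ E) :
    ‖(B * phaseState T ρs (ω w) x t).trace -
      (B * phaseState T ρs (ω w) x (min t tmax)).trace‖ ≤ E := by
  rcases le_total t tmax with ht | ht
  · rwa [min_eq_left ht, sub_self, norm_zero]
  · rw [min_eq_right ht]
    exact h ht

end SingleRegion

theorem mainTheorem1 (D ℓ W k₀ : ℕ) (c : PhaseConstants) (hrate : 0 < c.rate) :
    ∃ Cr Ct Cγ CN : ℝ, 0 < Cr ∧ 0 < Ct ∧ 0 < Cγ ∧ 0 < CN ∧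
      ∀ (L : ℕ) (b : Boundary) (a : Site D L → ℕ)
        (T : Site D L → (Fin ℓ → Set.Icc (-1 : ℝ) 1) → SuperOp a)
        (ρs : SysOp D L) (ω : Fin W → AncOp a),
        IsLindbladianPhase c b a T ρs ω →
      ∀ (M : ℕ) (S : Fin M → Finset (Site D L)) (O : ∀ i, RegionOp (S i)),
        (∀ i, ∀ u ∈ S i, ∀ v ∈ S i, siteDist b u v ≤ k₀) → (∀ i, (O i).IsHermitian) →
      ∀ ε δ δ' : ℝ, 0 < ε → ε < 1 → 0 < δ → δ < 1 → 0 < δ' → δ' < 1 →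
      ∀ (r : ℕ) (γ tε : ℝ),
        r = ⌈Cr * Real.log (2 / ε)⌉₊ → tε = Ct * Real.log (2 / ε) →
        γ = ε / (Cγ * Real.log (2 / ε) ^ (D + 1)) →
      ∀ N : ℕ,
        CN * Real.log (2 * (Fintype.card (Site D L) : ℝ) / δ') * Real.log (2 * (M : ℝ) / δ) *
            (2 : ℝ) ^ (CN * Real.log (2 / ε) ^ (D + 1)) ≤ (N : ℝ) →
        -- the probability of failure; for the outer measure this is the strong form
        dataLaw T ρs ω tε N
            {s | ¬ ∀ (x : Param D L ℓ) (t : ℝ) (w : Fin W), 0 ≤ t →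
              ‖expectation T ρs (ω w) S O x t -
                  estimator b c.range r γ tε S O (fun k => s (w, k)) x t‖ ≤
                ε * ∑ i, opNorm (O i)} ≤
          ENNReal.ofReal (1 - (1 - δ) * (1 - δ')) := by

  classical
  set K := (2 * k₀ + 1) ^ D with hK
  obtain ⟨H, g, hH, hg, hrel⟩ := exists_relaxation D K c hrate
  obtain ⟨Cr, Ct, Cγ, C₃, hCr, hCt, hCγ, hwin⟩ := exists_window_constants D K c.range (H := H)
    (s := |c.strength| * (K * (2 * c.range + 1) ^ D : ℕ)) (lip := |c.lip|) hg (c.velocity_nonneg D)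
    (c.lrConst_nonneg D) (by positivity) (abs_nonneg _)
  obtain ⟨CN, hCN, hsize⟩ := exists_sample_size_constant D ℓ W K hCt hCγ
    (n := fun x => K * (2 * (⌈Cr * x⌉₊ + c.range) + 1) ^ D) fun x hx => (hwin x hx).2.2.2.2
  refine ⟨Cr, Ct, Cγ, CN, hCr, hCt, hCγ, hCN, ?_⟩
  intro L b a T ρs ω h M S O hS hO ε δ δ' hε hε1 hδ hδ1 hδ' hδ'1 r γ tε hr htε hγ N hN
  -- Without observables `log (2 * M / δ)` carries no information, but both the estimate and the
  -- target are zero.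
  rcases Nat.eq_zero_or_pos M with rfl | hM
  · have : {s : Fin W × Fin N → Sample D L ℓ | ¬ ∀ (x : Param D L ℓ) (t : ℝ) (w : Fin W), 0 ≤ t →
        ‖expectation T ρs (ω w) S O x t -
          estimator b c.range r γ tε S O (fun k => s (w, k)) x t‖ ≤ ε * ∑ i, opNorm (O i)} = ∅ := by
      ext s
      simp [expectation, estimator]
    rw [this, measure_empty]
    exact zero_le
  set x := Real.log (2 / ε) with hx
  have hx2 : Real.log 2 ≤ x := by
    refine Real.log_le_log two_pos ?_
    rw [le_div_iff₀ hε]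
    linarith
  have hx0 : 0 < x := ExpBounded.log_two_pos.trans_le hx2
  have hεx : 2 * Real.exp (-x) = ε := by
    rw [hx, Real.exp_neg, Real.exp_log (by positivity), inv_div]
    ring
  have hM' : (1 : ℝ) ≤ M := by exact_mod_cast hM
  have hn' : (1 : ℝ) ≤ Fintype.card (Site D L) := by exact_mod_cast Fintype.card_pos
  have hwx := hwin x hx2
  have hsx := hsize x hx2 (Real.log (2 * M / δ)) (Real.log (2 * (Fintype.card (Site D L) : ℝ) / δ'))
    (Real.log_le_log two_pos (by rw [le_div_iff₀ hδ]; linarith))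
    (Real.log_le_log two_pos (by rw [le_div_iff₀ hδ']; linarith)) N hN
  simp only [hεx, ← hr, ← htε, ← hγ] at hwx hsx
  obtain ⟨hγ1, hγt, hrelax, hwindow, -⟩ := hwx
  set n₁ := K * (2 * (r + c.range) + 1) ^ D with hn₁
  set p := (γ / 2) ^ (ℓ * n₁) * (γ / tε) with hp
  -- Then `3 * κ ≤ p / 4`, and the statistical error `3 * κ * (8 ^ K + 1) / (p - 3 * κ)` is at most
  -- `(p * ε / 4) / (3 * p / 4) = ε / 3`.
  set κ := p * ε / (12 * (8 ^ K + 1)) with hκ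
  set m := ⌈4 * ((ℓ : ℝ) * n₁ + 1) / κ⌉₊ with hm
  obtain ⟨hN0, hsx⟩ := hsx
  have htε0 : 0 < tε := by rw [htε]; positivity
  have hγ0 : 0 < γ := by rw [hγ]; positivity
  have hp0 : 0 < p := by positivity
  have hB : (1 : ℝ) ≤ 8 ^ K + 1 := le_add_of_nonneg_left (by positivity)
  have hκ0 : 0 < κ := by positivity
  have hκp : 12 * κ * (8 ^ K + 1) = p * ε := by
    rw [hκ]; field_simp
  have hκ12 : 12 * κ ≤ p * ε := by
    rw [← hκp]
    exact le_mul_of_one_le_right (by positivity) hB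
  have hpε : p * ε ≤ p := mul_le_of_le_one_right hp0.le hε1.le
  have h3 : 3 * κ < p := by linarith
  have hm0 : 0 < m := Nat.ceil_pos.2 (by positivity)
  have hScard : ∀ i, (S i).card ≤ K := fun i => card_le_of_diam b (hS i)
  have key := h.measure_estimator_inaccurate_le (N := N) (S := S) hO (k := K) (n₁ := n₁) (r := r)
    (m := m) (γ := γ) (tmax := tε) (ε := ε) (ε₁ := ε / 3) (ε₂ := ε / 3) (p := p) (κ := κ) hScard
    (fun i => (card_nearbyTerms_le b (S i) c.range r).trans (Nat.mul_le_mul_right _ (hScard i)))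
    hγ0.le hγ1 htε0 hγt hm0 hwindow ?_ le_rfl ?_ hN0 h3 ?_
  -- The union bound gives failure probability at most `δ / 2`, which is below `δ + δ' * (1 - δ) = 1
  -- - (1 - δ) * (1 - δ')`.
  · refine key.trans (ENNReal.ofReal_le_ofReal ?_)
    have hexp : Real.exp (Real.log (2 * M / δ)) = 2 * M / δ := Real.exp_log (by positivity)
    rw [hexp] at hsx
    have h1 : W * (M * (((m + 1 : ℕ) : ℝ) ^ (ℓ * n₁ + 1) * (6 * Real.exp (-(N * κ ^ 2 / 2))))) =
        W * (6 * ((m + 1 : ℕ) : ℝ) ^ (ℓ * n₁ + 1)) * (2 * M / δ) * Real.exp (-(N * κ ^ 2 / 2)) *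
          (δ / 2) := by
      field_simp
    have h2 : W * (6 * ((m + 1 : ℕ) : ℝ) ^ (ℓ * n₁ + 1)) * (2 * M / δ) *
        Real.exp (-(N * κ ^ 2 / 2)) ≤ 1 := by
      refine (mul_le_mul_of_nonneg_right hsx (Real.exp_pos _).le).trans (le_of_eq ?_)
      rw [← Real.exp_add, add_neg_cancel, Real.exp_zero]
    rw [h1]
    have h4 := mul_le_mul_of_nonneg_right h2 (show 0 ≤ δ / 2 by positivity)
    refine h4.trans ?_
    have h5 := mul_nonneg hδ'.le (sub_nonneg.2 hδ1.le)
    linarith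
  · intro w A hA O hO1 x t ht
    refine norm_trace_sub_min_le (by positivity) fun htt => ?_
    obtain ⟨T', hT', hcomp⟩ := h.compatible x w
    refine (hrel L b a _ T' ρs (ω w) (h.local_terms x) hT' h.reference_state (h.auxiliary_state w)
      hcomp A hA O tε t htε0.le htt).trans ?_
    exact (mul_le_of_le_one_left (by positivity) hO1).trans hrelax
  · have hmle : 4 * ((ℓ : ℝ) * n₁ + 1) / κ ≤ m := Nat.le_ceil _
    have hm' : (0 : ℝ) < m := by exact_mod_cast hm0
    rw [div_le_iff₀ hκ0] at hmle
    rw [← mul_div_assoc, div_le_iff₀ hm']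
    linarith
  · have h5 : 3 * κ * (8 ^ K + 1) / (p - 3 * κ) ≤ ε / 3 := by
      rw [div_le_iff₀ (by linarith)]
      have : ε * (12 * κ) ≤ ε * p := mul_le_mul_of_nonneg_left (by linarith) hε.le
      linarith
    linarith
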